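/- **Setting.** Let $d>2$, $N\ge 2$ be integers, $L>2$ an even integer, $\lambda>0$, $v:\mathbb Z^d\to\mathbb R$ with $v(-x)=v(x)$ and $U:\mathbb N_0\to[0,\infty)$. Let $\mathbb T_L=(\mathbb Z/L\mathbb Z)^d$, identified with $\mathbb Z^d\cap(-L/2,L/2]^d$, with its nearest-neighbour edges $\mathbb E_L$, let $o$ be the origin and $\boldsymbol e_1,\dots,\boldsymbol e_d$ the unit vectors. Put $v_L(x,y)=\sum_{z\in\mathbb Z^d}v(y+Lz-x)$ and $\bar v=v(0)+\sum_x v(x)\mathbf 1_{\{v(x)<0\}}$. Assume: * $v$ is tempered: $\bar v\ge 0$ and $\sum_x|v(x)|<\infty$. * $v_L$ is separable: for each $i\in\{1,\dots,d\}$ there are $k\in\mathbb N$, a finite measure space $(T,\nu)$ and bounded measurable $\alpha,\tilde\alpha:T\times\mathbb T_L\to\mathbb C^k$ with $-v_L(x,y)=\int_T\sum_j\alpha_j(t,x)\tilde\alpha_j(t,y)\,d\nu(t)$ whenever $x_i>0\ge y_i$, and, for every $x$, $\tilde\alpha(t,x)=\overline{\alpha(t,\theta_i x)}$ for $\nu$-almost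 every $t$, where $\theta_i$ is the reflection $x_i\mapsto 1-x_i$ (mod $L$) through the midpoints of edges. * $U$ is good: there is $M<\infty$ with $n\,\bar U(n+1)\le M\,\bar U(n)$ for all $n$, where $\bar U(n)=U(n)e^{-\bar v n^2}$. Moreover $\sup\{n:U(n)>0\}\ge 2$. **Random path model.** A configuration $w=(m,c,\pi,g)$ consists of numbers $m_e\in\mathbb N_0$ of links on the edges $e\in\mathbb E_L$ such that an even number of links touches each vertex, a colour in $\{1,\dots,N\}$ for each of the (labelled) links, for each vertex $x$ a partition $\pi_x$ of the links touching $x$ into sets of at most two links of the same colour, and numbers $g_x\in\{0,\dots,4\}$ of ghost pairings. Let $u_x^i$ be the number of $i$-coloured links touching $x$ that are unpaired at $x$, $u_x=\sum_iu_x^i$, let $n_x$ be the number of pairs in $\pi_x$ plus $g_x$, and $m_e^{(i)}$ the number of $i$-coloured links on $e$. Put $$\mu(w)=\prod_{e\in\mathbb E_L}\frac{\lambda^{m_e}}{m_e!}\prod_{x\in\mathbb T_L}U(n_x)\;\exp\Big(-\sum_{x,y\in\mathbb T_L}v_L(x,y)n_xn_y\Big).$$ Let $\mathbb Z^\ell$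 be the $\mu$-mass of the closed configurations ($u_x=g_x=0$ for all $x$) and $\mathbb E$ the expectation under $\mu/\mathbb Z^\ell$ restricted to closed configurations. For $x\ne y$ let $\mathbb Z(x,y)$ be the $\mu$-mass of the configurations with $u_z=g_z=0$ for $z\ne x,y$ and with $u_z^1=u_z^2=1$, $u_z^i=0$ for $i\ge3$, $g_z=2$ for $z\in\{x,y\}$. Let $\mathbb Z(x,x)$ be the sum of $\mu(w)\,2^{\mathbf 1_{\{u_x^1=2\}}+\mathbf 1_{\{u_x^2=2\}}}$ over the configurations with $u_z=g_z=0$ for $z\ne x$ and with $u_x^1,u_x^2\in\{0,2\}$, $u_x^i=0$ for $i\ge3$, $g_x=2+u_x/2$. The two-point function is $\mathbb G(x,y)=\lambda^2\,\mathbb Z(x,y)/\mathbb Z^\ell$. For every $L\in\mathbb N$ let $$C_L(d)=\frac1{L^d}\sum_{k\in\mathbb T_L^*\setminus\{o\}}\frac{\cos^2(k_1/2)}{\varepsilon(k)},\qquad \varepsilon(k)=2\sum_{j=1}^d(1-\cos k_j),\qquad \mathbb T_L^*=\tfrac{2\pi}{L}\big(\mathbb Z\cap(-\tfrac L2,\tfrac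 L2]\big)^d .$$ **Theorem.** One has $\mathbb Z^\ell>0$, and the series $\sum_w\mu(w)$ and $\sum_w\mu(w)m^{(1)}_{\{o,\boldsymbol e_j\}}(w)$ over all configurations converge. If $v$ is invariant under permutations of the coordinates of $\mathbb Z^d$, then $$\frac1{|\mathbb T_L|}\sum_{x\in\mathbb T_L}\mathbb G(o,x)\;\ge\;\frac{\mathbb G(o,\boldsymbol e_1)+\mathbb G(o,o)}2-\big(1+2\,\mathbb E(m^{(1)}_{\{o,\boldsymbol e_1\}})\big)\,C_L(d).$$ Without this invariance the same inequality holds with $\mathbb E(m^{(1)}_{\{o,\boldsymbol e_1\}})$ replaced by $\max_{1\le j\le d}\mathbb E(m^{(1)}_{\{o,\boldsymbol e_j\}})$. Moreover $C_L(d)\ge0$ for every $L$, and $$\lim_{L\to\infty}C_L(d)=\frac{2E^{\mathrm{rw}}(N_o)-1}{4d},$$ where $E^{\mathrm{rw}}(N_o)<\infty$ is the expected number of visits (time $0$ included) to the origin of simple random walk on $\mathbb Z^d$ started at the origin. -/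

import Mathlib

open MeasureTheory ProbabilityTheory Filter Topology
open scoped NNReal ENNReal

namespace RPM

noncomputable section

/-! ### The random path model on a finite simple graph -/

/-- The edges of `G` that contain the vertex `x`. -/
abbrev EdgeAt {V : Type} (G : SimpleGraph V) (x : V) : Type :=
  {e : G.edgeSet // x ∈ (e : Sym2 V)}

/-- The links touching `x`: an edge `e` at `x` and a label of one of the `m e` links on `e`. -/
abbrev LinkAt {V : Type} (G : SimpleGraph V) (m : G.edgeSet → ℕ) (x : V) : Type :=
  Σ e : EdgeAt G x, Fin (m e.1)

/-- Configurations `w = (m, c, π, g)` with `N` colours. The colours `1, …, N` are encoded by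
`Fin N`, the element `a` of `Fin N` standing for the colour `a + 1`. A partition of the links
touching `x` into sets of at most two links of equal colour is encoded by the involution `π x`
which exchanges the two elements of each pair; its fixed points are the unpaired links. -/
structure Config {V : Type} [Fintype V] [DecidableEq V] (G : SimpleGraph V)
    [DecidableRel G.Adj] (N : ℕ) where
  /-- number of links on each edge -/
  m : G.edgeSet → ℕ
  /-- an even number of links touches each vertex -/
  even_links : ∀ x : V, Even (∑ e : EdgeAt G x, m e.1)
  /-- colouring of the links -/
  c : ∀ e : G.edgeSet, Fin (m e) → Fin N
  /-- pairings at the vertices -/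
  π : ∀ x : V, LinkAt G m x → LinkAt G m x
  π_invol : ∀ (x : V) (l : LinkAt G m x), π x (π x l) = l
  π_colour : ∀ (x : V) (l : LinkAt G m x), c (π x l).1.1 (π x l).2 = c l.1.1 l.2
  /-- ghost pairings -/
  g : V → Fin 5

section Model

variable {V : Type} [Fintype V] [DecidableEq V] {G : SimpleGraph V} [DecidableRel G.Adj] {N : ℕ}

/-- The colour, in `{1, …, N}`, of a link touching `x`. -/
def Config.colour (w : Config G N) (x : V) (l : LinkAt G w.m x) : ℕ := (w.c l.1.1 l.2 : ℕ) + 1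

/-- `u_x^i`: the number of `i`-links touching `x` that are unpaired at `x`. -/
def Config.u (w : Config G N) (x : V) (i : ℕ) : ℕ :=
  (Finset.univ.filter fun l : LinkAt G w.m x => w.colour x l = i ∧ w.π x l = l).card

/-- `u_x`: the number of links touching `x` that are unpaired at `x`. -/
def Config.uTot (w : Config G N) (x : V) : ℕ := ∑ i ∈ Finset.Icc 1 N, w.u x i

/-- `n_x^i`: the number of pairings of `i`-links at `x` (two paired links form one pairing). -/
def Config.nCol (w : Config G N) (x : V) (i : ℕ) : ℕ :=
  (Finset.univ.filter fun l : LinkAt G w.m x => w.colour x l = i ∧ w.π x l ≠ l).card / 2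

/-- `n_x`: the total number of pairings at `x`, ghost pairings included. -/
def Config.n (w : Config G N) (x : V) : ℕ := ∑ i ∈ Finset.Icc 1 N, w.nCol x i + (w.g x : ℕ)

/-- The number of `i`-links on the edge `{x, y}` (zero if `x` and `y` are not adjacent). -/
def Config.linkCount (w : Config G N) (x y : V) (i : ℕ) : ℕ :=
  if h : G.Adj x y then
    (Finset.univ.filter fun p : Fin (w.m ⟨s(x, y), h⟩) => (w.c ⟨s(x, y), h⟩ p : ℕ) + 1 = i).card
  else 0

/-- Configurations without unpaired links and without ghost pairings. -/
def Config.Closed (w : Config G N) : Prop := ∀ x : V, w.uTot x = 0 ∧ (w.g x : ℕ) = 0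

/-- The interaction `V(w) = ∑_{x,y} v(x,y) n_x n_y`. -/
def Config.interaction (v : V → V → ℝ) (w : Config G N) : ℝ :=
  ∑ x : V, ∑ y : V, v x y * w.n x * w.n y

/-- The weight `μ(w)` of a configuration. -/
def weight (U : ℕ → ℝ≥0) (v : V → V → ℝ) (lam : ℝ) (w : Config G N) : ℝ :=
  (∏ e : G.edgeSet, lam ^ w.m e / (Nat.factorial (w.m e) : ℝ)) *
    (∏ x : V, (U (w.n x) : ℝ)) * Real.exp (-w.interaction v)

variable (G N)

/-- The partition function `Z^ℓ` of the closed configurations. -/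
def partitionClosed (U : ℕ → ℝ≥0) (v : V → V → ℝ) (lam : ℝ) : ℝ :=
  ∑' w : {w : Config G N // w.Closed}, weight U v lam w.1

/-- The expectation `E(f)` under the probability measure `P(w) = μ(w) / Z^ℓ` on closed
configurations. -/
def expectation (U : ℕ → ℝ≥0) (v : V → V → ℝ) (lam : ℝ) (f : Config G N → ℝ) : ℝ :=
  ∑' w : {w : Config G N // w.Closed},
    weight U v lam w.1 / partitionClosed G N U v lam * f w.1

variable {G N}

/-- The configurations counted by `Z(x,y)` for `x ≠ y`: at each of `x` and `y` there are exactly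
one unpaired `1`-link, one unpaired `2`-link and two ghost pairings; nothing is unpaired and there
is no ghost pairing elsewhere. -/
def Config.OffDiag (w : Config G N) (x y : V) : Prop :=
  (∀ z : V, z ≠ x → z ≠ y → w.uTot z = 0 ∧ (w.g z : ℕ) = 0) ∧
  ∀ z : V, z = x ∨ z = y →
    w.u z 1 = 1 ∧ w.u z 2 = 1 ∧ (∀ i ∈ Finset.Icc 3 N, w.u z i = 0) ∧ (w.g z : ℕ) = 2

/-- The configurations counted by `Z(x,x)`: at `x` there are zero or two unpaired `1`-links, zero
or two unpaired `2`-links, no unpaired link of another colour, and `2 + u_x / 2` ghost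
pairings; nothing is unpaired and there is no ghost pairing elsewhere. -/
def Config.Diag (w : Config G N) (x : V) : Prop :=
  (∀ z : V, z ≠ x → w.uTot z = 0 ∧ (w.g z : ℕ) = 0) ∧
  (w.u x 1 = 0 ∨ w.u x 1 = 2) ∧ (w.u x 2 = 0 ∨ w.u x 2 = 2) ∧
  (∀ i ∈ Finset.Icc 3 N, w.u x i = 0) ∧ (w.g x : ℕ) = 2 + w.uTot x / 2

open Classical in
/-- The directed partition function `Z(x,y)`. -/
def partitionDirected (G : SimpleGraph V) [DecidableRel G.Adj] (N : ℕ)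
    (U : ℕ → ℝ≥0) (v : V → V → ℝ) (lam : ℝ) (x y : V) : ℝ :=
  if x = y then
    ∑' w : Config G N, weight U v lam w *
      (if w.Diag x then
        (2 : ℝ) ^ ((if w.u x 1 = 2 then 1 else 0) + (if w.u x 2 = 2 then 1 else 0) : ℕ) else 0)
  else
    ∑' w : Config G N, weight U v lam w * (if w.OffDiag x y then 1 else 0)

/-- The two-point function `𝔾(x,y) = λ² Z(x,y) / Z^ℓ`. -/
def twoPoint (G : SimpleGraph V) [DecidableRel G.Adj] (N : ℕ)
    (U : ℕ → ℝ≥0) (v : V → V → ℝ) (lam : ℝ) (x y : V) : ℝ :=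
  lam ^ 2 * (partitionDirected G N U v lam x y / partitionClosed G N U v lam)

end Model

/-! ### The torus -/

/-- The vertices of the torus `(ℤ / Lℤ)^d`. The representative of `x` in `(-L/2, L/2]^d` has the
coordinates `(x i).valMinAbs`. -/
abbrev Torus (d L : ℕ) : Type := Fin d → ZMod L

/-- The unit vector in direction `j`. -/
def unitVec (d L : ℕ) (j : Fin d) : Torus d L := Pi.single j 1

/-- The nearest-neighbour graph of the torus. -/
def torusGraph (d L : ℕ) : SimpleGraph (Torus d L) :=
  SimpleGraph.fromRel fun x y => ∃ j : Fin d, y = x + unitVec d L j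

instance (d L : ℕ) : DecidableRel (torusGraph d L).Adj := Classical.decRel _

/-! ### Potentials and weight functions -/

/-- The periodised potential `v_L(x,y) = ∑_{z ∈ ℤ^d} v(y + L z - x)`. -/
def periodic (d L : ℕ) (v : (Fin d → ℤ) → ℝ) (x y : Torus d L) : ℝ :=
  ∑' z : Fin d → ℤ, v fun i => (y i).valMinAbs + L * z i - (x i).valMinAbs

/-- `v̄ = v(0) + ∑_x v(x) 1{v(x) < 0}`. -/
def vbar {d : ℕ} (v : (Fin d → ℤ) → ℝ) : ℝ :=
  v 0 + ∑' x : Fin d → ℤ, if v x < 0 then v x else 0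

/-- Tempered potentials. -/
def Tempered {d : ℕ} (v : (Fin d → ℤ) → ℝ) : Prop :=
  0 ≤ vbar v ∧ Summable fun x : Fin d → ℤ => |v x|

/-- Good weight functions. -/
def Good {d : ℕ} (v : (Fin d → ℤ) → ℝ) (U : ℕ → ℝ≥0) : Prop :=
  ∃ M : ℝ, ∀ n : ℕ,
    (n : ℝ) * ((U (n + 1) : ℝ) * Real.exp (-vbar v * ((n + 1 : ℕ) : ℝ) ^ 2)) ≤
      M * ((U n : ℝ) * Real.exp (-vbar v * (n : ℝ) ^ 2))

/-- The range `sup {n : U(n) > 0}` of a weight function. -/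
def weightRange (U : ℕ → ℝ≥0) : ℕ∞ := ⨆ (n : ℕ) (_ : 0 < U n), (n : ℕ∞)

/-- The reflection `x_i ↦ 1 - x_i` of the torus, through the midpoints of the edges between the
hyperplanes `x_i = 0` and `x_i = 1`. For even `L` it exchanges the halves `{x_i > 0}` and
`{x_i ≤ 0}` of `(-L/2, L/2]^d`. -/
def reflect {d L : ℕ} (i : Fin d) (x : Torus d L) : Torus d L := Function.update x i (1 - x i)

/-- `i`-separability of a function on pairs of vertices of the torus. -/
def SeparableDir {d L : ℕ} (w : Torus d L → Torus d L → ℝ) (i : Fin d) : Prop :=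
  ∃ (k : ℕ) (T : Type) (_ : MeasurableSpace T) (ν : Measure T)
    (α α' : T → Torus d L → Fin k → ℂ),
    IsFiniteMeasure ν ∧
    (∀ x j, Measurable fun t => α t x j) ∧ (∀ x j, Measurable fun t => α' t x j) ∧
    (∃ B : ℝ, ∀ t x j, ‖α t x j‖ ≤ B ∧ ‖α' t x j‖ ≤ B) ∧
    (∀ x y : Torus d L, 0 < (x i).valMinAbs → (y i).valMinAbs ≤ 0 →
      -(w x y : ℂ) = ∫ t, ∑ j : Fin k, α t x j * α' t y j ∂ν) ∧
    ∀ x : Torus d L, ∀ᵐ t ∂ν, ∀ j : Fin k, α' t x j = starRingEnd ℂ (α t (reflect i x) j)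

/-- Separability of the potential `v` on the torus of side length `L`. -/
def Separable {d : ℕ} (L : ℕ) (v : (Fin d → ℤ) → ℝ) : Prop :=
  ∀ i : Fin d, SeparableDir (periodic d L v) i

/-- Invariance of the potential under permutations of the coordinates. -/
def PermInvariant {d : ℕ} (v : (Fin d → ℤ) → ℝ) : Prop :=
  ∀ (σ : Equiv.Perm (Fin d)) (x : Fin d → ℤ), v (fun i => x (σ i)) = v x

/-! ### The model on the torus -/

/-- The two-point function on the torus. -/
def torusTwoPoint (d L N : ℕ) [NeZero L] (U : ℕ → ℝ≥0) (v : (Fin d → ℤ) → ℝ) (lam : ℝ)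
    (x y : Torus d L) : ℝ :=
  twoPoint (torusGraph d L) N U (periodic d L v) lam x y

/-- The expected number of `1`-links on the edge between the origin and the `j`-th unit vector. -/
def expectedLinks (d L N : ℕ) [NeZero L] (U : ℕ → ℝ≥0) (v : (Fin d → ℤ) → ℝ) (lam : ℝ)
    (j : Fin d) : ℝ :=
  expectation (torusGraph d L) N U (periodic d L v) lam
    fun w => (w.linkCount 0 (unitVec d L j) 1 : ℝ)

/-! ### The Fourier sum and the simple random walk -/

/-- The integer vectors `n ∈ (-L/2, L/2]^d`; the dual torus consists of the `k = 2πn/L`. -/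
def dualIndex (d L : ℕ) : Finset (Fin d → ℤ) :=
  Fintype.piFinset fun _ =>
    (Finset.Ioc (-(L : ℤ)) L).filter fun n => -(L : ℤ) < 2 * n ∧ 2 * n ≤ L

/-- The point `k = 2πn/L` of the dual torus. -/
def dualPoint {d : ℕ} (L : ℕ) (n : Fin d → ℤ) : Fin d → ℝ := fun i => 2 * Real.pi / L * n i

/-- `ε(k) = 2 ∑_j (1 - cos k_j)`. -/
def epsilon {d : ℕ} (k : Fin d → ℝ) : ℝ := 2 * ∑ j : Fin d, (1 - Real.cos (k j))

/-- `C_L(d)`. -/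
def fourierSum (d L : ℕ) [NeZero d] : ℝ :=
  1 / (L : ℝ) ^ d * ∑ n ∈ (dualIndex d L).erase 0,
    Real.cos (dualPoint L n 0 / 2) ^ 2 / epsilon (dualPoint L n)

/-- The step of the walk coded by `(j, b)`: plus or minus the `j`-th unit vector of `ℤ^d`. -/
def walkStep {d : ℕ} (s : Fin d × Bool) : Fin d → ℤ := Pi.single s.1 (if s.2 then 1 else -1)

/-- The law of the sequence of independent uniform steps. -/
def walkLaw (d : ℕ) [NeZero d] : Measure (ℕ → Fin d × Bool) :=
  Measure.infinitePi fun _ : ℕ => uniformOn (Set.univ : Set (Fin d × Bool))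

/-- The position `S_n` of the walk started at the origin. -/
def walkPos {d : ℕ} (ω : ℕ → Fin d × Bool) (n : ℕ) : Fin d → ℤ :=
  ∑ i ∈ Finset.range n, walkStep (ω i)

open Classical in
/-- The expected number of visits at `x` of simple random walk started at the origin. -/
def expectedVisits (d : ℕ) [NeZero d] (x : Fin d → ℤ) : ℝ≥0∞ :=
  ∫⁻ ω, ∑' n : ℕ, (if walkPos ω n = x then 1 else 0) ∂(walkLaw d)

end

end RPM

namespace RPM

/-! ### Counting involutions and colourings -/

/-! Summing out colours and pairings turns the path model into a spin system. For given numbers `M`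
of links per edge and colour, counting the colourings replaces `1 / m_e!` by the product over `i` of
`1 / M_e^i!`, and the pairings at a vertex are counted, colour by colour, by involutions. Perfect
matching numbers are Gaussian moments, so every partition function becomes a `correlation`: a series
in `M` of `linkWeight` times the `moment` of the degrees plus inserted exponents. The ghost pairings
are tuned so that `𝔾(x,y)` is `λ²` times the normalised correlation of `S_x^1 S_x^2` with `S_y^1
S_y^2`, on the diagonal too (`partitionDirected_eq`). All series converge because goodness and
temperedness bound the vertex weights by a product of `C K^n / n!` (`controlled_periodic`), which
absorbs the factorial growth of the pairing numbers.

A reflection `θ` through edge midpoints splits the links into two halves and the crossing links.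
Separability makes `-v(x, θ y)` positive semidefinite on a half, and by Schur's product theorem so
is its exponential; hence moments of glued monomials form a positive kernel (`moment_glue_kernel`).
This is applied to sums of two kinds of operators on a half: multiplication by `λ S_x^1 S_x^2`, and
differentiation in both of the first two components at a vertex of a crossing edge. In the series
over crossing links a derivative lowers the link numbers, and an index shift turns it into an
insertion at the mirror vertex. Two derivatives at the same crossing edge leave the contact term
`(B₁ + 1)(B₂ + 1) - B₁ B₂ = 1 + B₁ + B₂`, whose expectation `1 + 2 E(m^(1))` is the constant of the
theorem (`hasSum_opForm`, `opForm_nonneg`).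

If `u` lives on one half, its Laplacian is supported there and at the mirror images of the crossing
vertices, which is exactly what these operators produce. So the form `quad`, namely `⟨Δh, Γ Δh⟩`
minus a Dirichlet form, is non-negative at `(u, u ∘ θ)`. Since every edge admits such a reflection,
copying one half of a maximiser onto the other shows that `quad` is non-positive (`quad_nonpos`): a
quadratic form of Gaussian domination. Tested on characters it gives the infrared bound, that the
transform of `𝔾` at `k ≠ 0` is at most the largest conductance divided by `ε(k)`. Adding Fourier
inversion at `o` and `e_1` gives the modes the non-negative weight `1 + cos k_1`; isolating `k = 0`
yields the lower bound (`average_lower_bound`).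

For the limit, symmetry in the coordinates reduces `C_L(d)` to a Riemann sum of `1 / (1 - φ)`, where
`φ` is the characteristic function of a step. For `d > 2` the singularity at zero is integrable and
domination gives convergence (`tendsto_riemannSum`). Expanding `1 / (1 - φ)` geometrically
identifies the integral with the expected number of visits (`hasSum_return`). -/

/-- The number of perfect matchings of a set with `n` elements. -/
def pairings : ℕ → ℕ
  | 0 => 1
  | 1 => 0
  | n + 2 => (n + 1) * pairings n

lemma pairings_odd (j : ℕ) : pairings (2 * j + 1) = 0 := by
  induction j with
  | zero => rfl
  | succ j ih => rw [show 2 * (j + 1) + 1 = (2 * j + 1) + 2 by ring, pairings, ih, mul_zero]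

lemma pairings_even (j : ℕ) : pairings (2 * j) * (2 ^ j * j.factorial) = (2 * j).factorial := by
  induction j with
  | zero => rfl
  | succ j ih =>
    rw [show 2 * (j + 1) = 2 * j + 2 by ring, pairings, Nat.factorial_succ (2 * j + 1),
      Nat.factorial_succ (2 * j), ← ih, Nat.factorial_succ j]
    ring

/-- The number of involutions of a set with `k` elements that have exactly `a` fixed points. -/
def involutions (k a : ℕ) : ℕ := k.choose a * pairings (k - a)

lemma even_sub_of_involutions_ne_zero {k a : ℕ} (h : involutions k a ≠ 0) :
    a ≤ k ∧ Even (k - a) := by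
  rw [involutions, mul_ne_zero_iff] at h
  refine ⟨by by_contra hk; exact h.1 (Nat.choose_eq_zero_of_lt (by omega)), ?_⟩
  by_contra hk
  obtain ⟨j, hj⟩ := Nat.not_even_iff_odd.1 hk
  exact h.2 (hj ▸ pairings_odd j)

@[simp] lemma involutions_zero (k : ℕ) : involutions k 0 = pairings k := by simp [involutions]

/-- Removing the additional element leaves its partner as the only fixed point. -/
lemma pairings_add_one (k : ℕ) : pairings (k + 1) = involutions k 1 := by
  cases k with
  | zero => simp [pairings, involutions]
  | succ k => simp [pairings, involutions]

/-- Two additional elements are either matched with each other, or their partners are two distinct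
elements, assigned in one of two orders. This is the origin of the powers of two in `Z(x,x)`. -/
lemma pairings_add_two (k : ℕ) : pairings (k + 2) = pairings k + 2 * involutions k 2 := by
  match k with
  | 0 => simp [pairings, involutions]
  | 1 => simp [pairings, involutions]
  | k + 2 =>
    have h : 2 * (k + 2).choose 2 = (k + 2) * (k + 1) := by
      rw [Nat.choose_two_right, Nat.mul_div_cancel' (Nat.even_mul_pred_self _).two_dvd]; rfl
    rw [pairings, involutions, ← mul_assoc, h, Nat.add_sub_cancel, pairings]
    ring

/-- Closed form with denominators cleared, in the shape of the formula for the size of a conjugacy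
class. -/
lemma involutions_mul (j a : ℕ) :
    involutions (a + 2 * j) a * (a.factorial * 2 ^ j * j.factorial) = (a + 2 * j).factorial := by
  rw [involutions, Nat.add_sub_cancel_left, ← Nat.add_choose_mul_factorial_mul_factorial,
    ← pairings_even, Nat.choose_symm_add]
  ring

open Classical in
-- Involutions with `a` fixed points on `a + 2 * j` elements are the permutations whose cycle type
-- consists of `j` twos, and the size of that conjugacy class is known.
lemma card_involutions {α : Type*} [Fintype α] (a : ℕ) :
    Nat.card {f : α → α // (∀ x, f (f x) = x) ∧ (Finset.univ.filter fun x => f x = x).card = a} =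
      involutions (Fintype.card α) a := by
  -- All nontrivial cycles of an involution have length two, so the complement of the fixed points
  -- has twice as many elements as there are cycles.
  have key : ∀ σ : Equiv.Perm α, (∀ x, σ (σ x) = x) →
      (Finset.univ.filter fun x => σ x = x).card + 2 * (Multiset.card σ.cycleType) =
        Fintype.card α ∧ σ.cycleType = Multiset.replicate (Multiset.card σ.cycleType) 2 := by
    intro σ hσ
    have : Fact (Nat.Prime 2) := ⟨Nat.prime_two⟩
    have h2 : σ ^ 2 = 1 := by ext x; simp [sq, hσ]
    have h3 : σ.cycleType = Multiset.replicate (Multiset.card σ.cycleType) 2 :=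
      Multiset.eq_replicate.2 ⟨rfl, Equiv.Perm.pow_prime_eq_one_iff.1 h2⟩
    refine ⟨?_, h3⟩
    have h4 := Equiv.Perm.sum_cycleType σ
    rw [h3, Multiset.sum_replicate, smul_eq_mul] at h4
    have h5 : σ.support = (Finset.univ.filter fun x => σ x = x)ᶜ := by
      ext x; simp
    have h6 := Finset.card_add_card_compl (Finset.univ.filter fun x => σ x = x)
    rw [← h5, ← h4] at h6
    omega
  by_cases hk : ∃ j, Fintype.card α = a + 2 * j
  · obtain ⟨j, hj⟩ := hk
    have e : {f : α → α // (∀ x, f (f x) = x) ∧ (Finset.univ.filter fun x => f x = x).card = a} ≃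
        {σ : Equiv.Perm α // σ.cycleType = Multiset.replicate j 2} :=
      { toFun := fun f => ⟨⟨f.1, f.1, f.2.1, f.2.1⟩, by
          have h := key ⟨f.1, f.1, f.2.1, f.2.1⟩ f.2.1
          have h' := f.2.2
          simp only [Equiv.coe_fn_mk] at h
          rw [h.2]
          congr 1
          omega⟩
        invFun := fun σ => ⟨σ.1, by
          have : Fact (Nat.Prime 2) := ⟨Nat.prime_two⟩
          have h2 : σ.1 ^ 2 = 1 := by
            rw [Equiv.Perm.pow_prime_eq_one_iff, σ.2]
            intro c hc; exact Multiset.eq_of_mem_replicate hc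
          have h3 : ∀ x, σ.1 (σ.1 x) = x := fun x => by
            have := congrArg (fun τ : Equiv.Perm α => τ x) h2
            simpa [sq] using this
          refine ⟨h3, ?_⟩
          have h4 := (key σ.1 h3).1
          rw [σ.2, Multiset.card_replicate] at h4
          omega⟩
        left_inv := fun f => rfl
        right_inv := fun σ => by ext; rfl }
    rw [Nat.card_congr e, Nat.card_eq_fintype_card, Fintype.card_subtype]
    have h := Equiv.Perm.card_of_cycleType_mul_eq α (Multiset.replicate j 2)
    have h2 : ∏ n ∈ (Multiset.replicate j 2).toFinset, ((Multiset.replicate j 2).count n).factorial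
        = j.factorial := by
      rcases Nat.eq_zero_or_pos j with rfl | hj0
      · simp
      · rw [Multiset.toFinset_replicate, if_neg hj0.ne']
        simp
    rw [h2, Multiset.sum_replicate, Multiset.prod_replicate, if_pos
      ⟨by rw [smul_eq_mul]; omega, fun c hc => (Multiset.eq_of_mem_replicate hc).ge⟩,
      smul_eq_mul, hj, mul_comm j 2, Nat.add_sub_cancel, ← involutions_mul j a] at h
    rw [hj]
    exact Nat.eq_of_mul_eq_mul_right (by positivity) h
  -- With the wrong parity, or too many prescribed fixed points, both sides vanish.
  · have h0 : involutions (Fintype.card α) a = 0 := by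
      by_contra h
      obtain ⟨h1, j, h2⟩ := even_sub_of_involutions_ne_zero h
      exact hk ⟨j, by omega⟩
    rw [h0]
    have : IsEmpty {f : α → α //
        (∀ x, f (f x) = x) ∧ (Finset.univ.filter fun x => f x = x).card = a} := by
      refine ⟨fun f => hk ⟨Multiset.card (Equiv.Perm.cycleType ⟨f.1, f.1, f.2.1, f.2.1⟩), ?_⟩⟩
      have h := (key ⟨f.1, f.1, f.2.1, f.2.1⟩ f.2.1).1
      have h' := f.2.2
      simp only [Equiv.coe_fn_mk] at h
      exact h.symm.trans (congrArg (· + _) h')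
    exact Nat.card_of_isEmpty

open Classical in
-- A colour-preserving involution is the same as an independent choice of an involution on each
-- colour class.
lemma card_coloured_involutions {X ι : Type*} [Fintype X] [Fintype ι] (col : X → ι) (a : ι → ℕ) :
    Nat.card {f : X → X // (∀ x, f (f x) = x) ∧ (∀ x, col (f x) = col x) ∧
      ∀ i, (Finset.univ.filter fun x => col x = i ∧ f x = x).card = a i} =
      ∏ i, involutions (Finset.univ.filter fun x => col x = i).card (a i) := by
  have hfix : ∀ (i : ι) (f : X → X) (g : {x // col x = i} → {x // col x = i}),
      (∀ x, (g x : X) = f x) → (Finset.univ.filter fun x => g x = x).card =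
        (Finset.univ.filter fun x => col x = i ∧ f x = x).card := by
    intro i f g hg
    refine Finset.card_bij (fun x _ => x.1) ?_ (fun x _ y _ h => Subtype.ext h) ?_
    · intro x hx
      simp only [Finset.mem_filter, Finset.mem_univ, true_and] at hx ⊢
      exact ⟨x.2, by rw [← hg, hx]⟩
    · intro x hx
      simp only [Finset.mem_filter, Finset.mem_univ, true_and] at hx
      exact ⟨⟨x, hx.1⟩, by simp [Subtype.ext_iff, hg, hx.2], rfl⟩
  let e : {f : X → X // (∀ x, f (f x) = x) ∧ (∀ x, col (f x) = col x) ∧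
      ∀ i, (Finset.univ.filter fun x => col x = i ∧ f x = x).card = a i} ≃
      ∀ i, {g : {x // col x = i} → {x // col x = i} // (∀ x, g (g x) = x) ∧
        (Finset.univ.filter fun x => g x = x).card = a i} :=
    { toFun := fun f i => ⟨fun x => ⟨f.1 x, by rw [f.2.2.1, x.2]⟩,
        fun x => Subtype.ext (f.2.1 x), by
          rw [← f.2.2.2 i]; exact hfix i f.1 _ fun x => rfl⟩
      invFun := fun g => ⟨fun x => ((g (col x)).1 ⟨x, rfl⟩).1, by
        -- The colour of an image equals that of its argument only propositionally; this equation
        -- removes the dependence on which of the two names the class.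
        have h1 : ∀ (i : ι) (x : X) (h : col x = i),
            ((g (col x)).1 ⟨x, rfl⟩).1 = ((g i).1 ⟨x, h⟩).1 := by
          rintro i x rfl; rfl
        refine ⟨fun x => ?_, fun x => ((g (col x)).1 ⟨x, rfl⟩).2, fun i => ?_⟩
        · change ((g (col ((g (col x)).1 ⟨x, rfl⟩).1)).1 ⟨((g (col x)).1 ⟨x, rfl⟩).1, rfl⟩).1 = x
          rw [h1 (col x) _ ((g (col x)).1 ⟨x, rfl⟩).2, (g (col x)).2.1]
        · rw [← (g i).2.2]
          exact (hfix i _ _ fun x => (h1 i x.1 x.2).symm).symm⟩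
      left_inv := fun f => rfl
      right_inv := fun g => by
        funext i
        refine Subtype.ext (funext fun x => Subtype.ext ?_)
        obtain ⟨x, rfl⟩ := x
        rfl }
  rw [Nat.card_congr e, Nat.card_pi]
  refine Finset.prod_congr rfl fun i _ => ?_
  rw [← Fintype.card_subtype, ← card_involutions]
  congr!

open Classical in
-- Compare the coefficient of the monomial with exponents `M` in `(∑ X_i)^m`, computed once by the
-- multinomial theorem and once by multiplying out the `m` factors.
lemma card_colourings {ι : Type*} [Fintype ι] (m : ℕ) (M : ι → ℕ) (hM : ∑ i, M i = m) :
    Nat.card {c : Fin m → ι // ∀ i, (Finset.univ.filter fun p => c p = i).card = M i} *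
      ∏ i, (M i).factorial = m.factorial := by
  have h1 : ((∑ i, MvPolynomial.X i : MvPolynomial ι ℕ) ^ m).coeff (Finsupp.equivFunOnFinite.symm M)
      = Nat.multinomial Finset.univ M := by
    rw [Finset.sum_pow_eq_sum_piAntidiag, MvPolynomial.coeff_sum]
    simp only [← map_natCast (MvPolynomial.C : ℕ →+* MvPolynomial ι ℕ), MvPolynomial.coeff_C_mul]
    have : ∀ k : ι → ℕ, ∏ i, (MvPolynomial.X i : MvPolynomial ι ℕ) ^ k i =
        MvPolynomial.monomial (Finsupp.equivFunOnFinite.symm k) 1 := by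
      intro k
      rw [MvPolynomial.monomial_eq, Finsupp.prod_fintype _ _ (by simp)]
      simp
    simp only [this, MvPolynomial.coeff_monomial, EmbeddingLike.apply_eq_iff_eq]
    rw [Finset.sum_eq_single M]
    · simp
    · intro b _ hb; simp [hb]
    · intro h; exact absurd (by simp [hM]) h
  have h2 : ((∑ i, MvPolynomial.X i : MvPolynomial ι ℕ) ^ m).coeff (Finsupp.equivFunOnFinite.symm M)
      = Nat.card {c : Fin m → ι // ∀ i, (Finset.univ.filter fun p => c p = i).card = M i} := by
    have : (∑ i, MvPolynomial.X i : MvPolynomial ι ℕ) ^ m =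
        ∏ _p : Fin m, ∑ i, MvPolynomial.X i := by simp
    rw [this, Finset.prod_univ_sum, MvPolynomial.coeff_sum, Nat.card_eq_fintype_card,
      Fintype.card_subtype, Finset.card_filter]
    rw [Fintype.piFinset_univ]
    refine Finset.sum_congr rfl fun c _ => ?_
    have h3 : ∏ p, (MvPolynomial.X (c p) : MvPolynomial ι ℕ) =
        MvPolynomial.monomial (∑ p, Finsupp.single (c p) 1) 1 := by
      rw [MvPolynomial.monomial_sum_one]; rfl
    rw [h3, MvPolynomial.coeff_monomial]
    refine if_congr ?_ rfl rfl
    rw [DFunLike.ext_iff]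
    refine forall_congr' fun i => ?_
    rw [Finsupp.finsetSum_apply]
    simp only [Finsupp.single_apply, Finset.card_filter]
    rfl
  rw [← h2, h1, mul_comm, Nat.multinomial_spec, hM]

/-! ### Summation over configurations with given numbers of links and unpaired links -/

section Fibres

variable {V : Type} [Fintype V] [DecidableEq V] {G : SimpleGraph V} [DecidableRel G.Adj] {N : ℕ}

/-- The number of links of each colour on each edge. -/
def Config.links (w : Config G N) (e : G.edgeSet) (i : Fin N) : ℕ :=
  (Finset.univ.filter fun p : Fin (w.m e) => w.c e p = i).card

/-- The number of unpaired links of each colour at each vertex. -/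
def Config.unpaired (w : Config G N) (x : V) (i : Fin N) : ℕ := w.u x (i + 1)

/-- The number of links of each colour touching each vertex. -/
def degrees (M : G.edgeSet → Fin N → ℕ) (x : V) (i : Fin N) : ℕ := ∑ e : EdgeAt G x, M e.1 i

lemma sum_Icc_eq_sum_fin {α : Type*} [AddCommMonoid α] (N : ℕ) (f : ℕ → α) :
    ∑ i ∈ Finset.Icc 1 N, f i = ∑ i : Fin N, f (i + 1) := by
  rw [Fin.sum_univ_eq_sum_range fun i => f (i + 1), Finset.range_eq_Ico, Finset.sum_Ico_add',
    zero_add]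
  rfl

lemma Config.sum_links (w : Config G N) (e : G.edgeSet) : ∑ i, w.links e i = w.m e := by
  simpa [Config.links] using (Finset.card_eq_sum_card_fiberwise
    (s := (Finset.univ : Finset (Fin (w.m e)))) (t := (Finset.univ : Finset (Fin N)))
    (f := w.c e) (by simp)).symm

lemma card_links_at {m : G.edgeSet → ℕ} (c : ∀ e : G.edgeSet, Fin (m e) → Fin N) (x : V)
    (i : Fin N) :
    (Finset.univ.filter fun l : LinkAt G m x => c l.1.1 l.2 = i).card =
      ∑ e : EdgeAt G x, (Finset.univ.filter fun p : Fin (m e.1) => c e.1 p = i).card := by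
  simp only [Finset.card_filter]
  rw [Fintype.sum_sigma]

lemma Config.unpaired_eq (w : Config G N) (x : V) (i : Fin N) :
    w.unpaired x i = (Finset.univ.filter fun l : LinkAt G w.m x =>
      w.c l.1.1 l.2 = i ∧ w.π x l = l).card := by
  simp [Config.unpaired, Config.u, Config.colour, Fin.ext_iff]

lemma Config.nCol_eq (w : Config G N) (x : V) (i : Fin N) :
    w.nCol x (i + 1) = (degrees w.links x i - w.unpaired x i) / 2 := by
  rw [Config.nCol, Config.unpaired_eq]
  congr 1
  have h1 : degrees w.links x i = (Finset.univ.filter fun l : LinkAt G w.m x =>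
      w.c l.1.1 l.2 = i).card := (card_links_at w.c x i).symm
  rw [h1, ← Finset.card_filter_add_card_filter_not
    (s := Finset.univ.filter fun l : LinkAt G w.m x => w.c l.1.1 l.2 = i)
    (fun l => w.π x l = l), Finset.filter_filter, Finset.filter_filter, Nat.add_sub_cancel_left]
  simp [Config.colour, Fin.ext_iff]

lemma Config.n_eq (w : Config G N) (x : V) :
    w.n x = ∑ i, (degrees w.links x i - w.unpaired x i) / 2 + w.g x := by
  rw [Config.n, sum_Icc_eq_sum_fin]
  simp only [Config.nCol_eq]

lemma Config.uTot_eq (w : Config G N) (x : V) : w.uTot x = ∑ i, w.unpaired x i := by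
  rw [Config.uTot, sum_Icc_eq_sum_fin]; rfl

/-- The part of the weight of a configuration that depends on the numbers of pairings only. -/
noncomputable def vertexWeight (U : ℕ → ℝ≥0) (v : V → V → ℝ) (n : V → ℕ) : ℝ :=
  (∏ x, (U (n x) : ℝ)) * Real.exp (-∑ x, ∑ y, v x y * n x * n y)

omit [DecidableEq V] in
lemma vertexWeight_nonneg (U : ℕ → ℝ≥0) (v : V → V → ℝ) (n : V → ℕ) :
    0 ≤ vertexWeight U v n := by
  unfold vertexWeight; positivity

lemma weight_nonneg {U : ℕ → ℝ≥0} {v : V → V → ℝ} {lam : ℝ} (hlam : 0 < lam) (w : Config G N) :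
    0 ≤ weight U v lam w := by
  unfold weight; positivity

/-- The weight of the links on the edges. -/
noncomputable def linkWeight {E : Type*} [Fintype E] (lam : ℝ) (M : E → Fin N → ℕ) : ℝ :=
  ∏ e, ∏ i, lam ^ M e i / ((M e i).factorial : ℝ)

lemma linkWeight_nonneg {E : Type*} [Fintype E] {lam : ℝ} (hlam : 0 < lam) (M : E → Fin N → ℕ) :
    0 ≤ linkWeight lam M := by
  unfold linkWeight; positivity

open Classical in
-- A configuration in the fibre is a colouring followed by an independent choice of a coloured
-- involution at each vertex. The number of the latter depends on the colouring only through `M`, so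
-- the count is a product. The parity assumption ensures that link numbers `M` are admissible at
-- all.
lemma card_fibre (M : G.edgeSet → Fin N → ℕ) (a : V → Fin N → ℕ) (γ : V → Fin 5)
    (hM : ∀ x, Even (∑ i, degrees M x i)) :
    Finite {w : Config G N // w.links = M ∧ w.unpaired = a ∧ w.g = γ} ∧
    Nat.card {w : Config G N // w.links = M ∧ w.unpaired = a ∧ w.g = γ} *
      ∏ e, ∏ i, (M e i).factorial =
      (∏ e, (∑ i, M e i).factorial) * ∏ x, ∏ i, involutions (degrees M x i) (a x i) := by
  set m : G.edgeSet → ℕ := fun e => ∑ i, M e i with hm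
  let C := {c : ∀ e : G.edgeSet, Fin (m e) → Fin N //
    ∀ e i, (Finset.univ.filter fun p => c e p = i).card = M e i}
  let P : C → V → Type := fun c x => {f : LinkAt G m x → LinkAt G m x //
    (∀ l, f (f l) = l) ∧ (∀ l, c.1 (f l).1.1 (f l).2 = c.1 l.1.1 l.2) ∧
      ∀ i, (Finset.univ.filter fun l => c.1 l.1.1 l.2 = i ∧ f l = l).card = a x i}
  let Φ : (Σ c : C, ∀ x, P c x) → {w : Config G N // w.links = M ∧ w.unpaired = a ∧ w.g = γ} :=
    fun s => ⟨⟨m, fun x => by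
        have h := hM x
        simp only [degrees] at h
        rw [Finset.sum_comm] at h
        exact h, s.1.1, fun x => (s.2 x).1, fun x => (s.2 x).2.1, fun x => (s.2 x).2.2.1, γ⟩, by
        refine ⟨?_, ?_, rfl⟩
        · funext e i
          rw [← s.1.2 e i]
          simp only [Config.links]
        · funext x i
          rw [Config.unpaired_eq, ← (s.2 x).2.2.2 i]⟩
  have hΦ : Function.Bijective Φ := by
    constructor
    · rintro ⟨⟨c, hc⟩, p⟩ ⟨⟨c', hc'⟩, p'⟩ h
      simp only [Φ, Subtype.mk.injEq, Config.mk.injEq, heq_eq_eq, true_and, and_true] at h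
      obtain ⟨h1, h2⟩ := h
      subst h1
      congr 1
      funext x
      exact Subtype.ext (congrFun h2 x)
    · rintro ⟨⟨m', hev, c, π, h1, h2, g⟩, hl, hu, hg⟩
      have hmm : m' = m := by
        funext e
        rw [hm, ← hl]
        exact (Config.sum_links ⟨m', hev, c, π, h1, h2, g⟩ e).symm
      subst hmm
      dsimp only at hg
      subst hg
      refine ⟨⟨⟨c, fun e i => ?_⟩, fun x => ⟨π x, h1 x, h2 x, fun i => ?_⟩⟩, rfl⟩
      · have := congrFun (congrFun hl e) i
        rw [← this]
        simp only [Config.links]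
      · rw [← hu, Config.unpaired_eq]
  have hC : Nat.card C * ∏ e, ∏ i, (M e i).factorial = ∏ e, (m e).factorial := by
    have e : C ≃ ∀ e : G.edgeSet, {c : Fin (m e) → Fin N //
        ∀ i, (Finset.univ.filter fun p => c p = i).card = M e i} :=
      { toFun := fun c e => ⟨c.1 e, c.2 e⟩
        invFun := fun c => ⟨fun e => (c e).1, fun e => (c e).2⟩
        left_inv := fun c => rfl
        right_inv := fun c => rfl }
    rw [Nat.card_congr e, Nat.card_pi, ← Finset.prod_mul_distrib]
    refine Finset.prod_congr rfl fun e _ => ?_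
    rw [← card_colourings (m e) (M e) rfl]
    congr!
  have hP : ∀ c : C, Nat.card (∀ x, P c x) =
      ∏ x, ∏ i, involutions (degrees M x i) (a x i) := by
    intro c
    rw [Nat.card_pi]
    refine Finset.prod_congr rfl fun x _ => ?_
    have h := card_coloured_involutions (fun l : LinkAt G m x => c.1 l.1.1 l.2) (a x)
    refine Eq.trans ?_ (h.trans ?_)
    · congr!
    · refine Finset.prod_congr rfl fun i _ => ?_
      congr 1
      have h3 := card_links_at c.1 x i
      refine Eq.trans ?_ (h3.trans ?_)
      · congr!
      · refine Finset.sum_congr rfl fun e _ => ?_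
        rw [← c.2 e.1 i]
  refine ⟨Finite.of_surjective Φ hΦ.2, ?_⟩
  rw [← Nat.card_congr (Equiv.ofBijective Φ hΦ), Nat.card_sigma]
  simp only [hP, Finset.sum_const, smul_eq_mul]
  rw [← hC, Finset.card_univ, ← Nat.card_eq_fintype_card]
  ring

open Classical in
-- In `ℝ≥0∞` the sum may be regrouped by fibres without convergence questions. The weight is
-- constant on a fibre, and `card_fibre` trades the factorials of the total link numbers for those
-- of the coloured ones.
lemma tsum_config (U : ℕ → ℝ≥0) (v : V → V → ℝ) (lam : ℝ)
    (F : (G.edgeSet → Fin N → ℕ) × (V → Fin N → ℕ) × (V → Fin 5) → ℝ≥0∞) :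
    ∑' w : Config G N, ENNReal.ofReal (weight U v lam w) * F (w.links, w.unpaired, w.g) =
      ∑' s : (G.edgeSet → Fin N → ℕ) × (V → Fin N → ℕ) × (V → Fin 5),
        if ∀ x, Even (∑ i, degrees s.1 x i) then
          ENNReal.ofReal (linkWeight lam s.1 *
            ((∏ x, ∏ i, involutions (degrees s.1 x i) (s.2.1 x i) : ℕ) : ℝ) *
            vertexWeight U v fun x => ∑ i, (degrees s.1 x i - s.2.1 x i) / 2 + s.2.2 x) * F s
        else 0 := by
  rw [← ENNReal.tsum_fiberwise _ fun w : Config G N => (w.links, w.unpaired, w.g)]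
  refine tsum_congr fun s => ?_
  obtain ⟨M, a, γ⟩ := s
  have hset : (fun w : Config G N => (w.links, w.unpaired, w.g)) ⁻¹' {(M, a, γ)} =
      {w : Config G N | w.links = M ∧ w.unpaired = a ∧ w.g = γ} := by
    ext w; simp [Prod.ext_iff]
  rw [hset]
  split_ifs with h
  · obtain ⟨hfin, hcard⟩ := card_fibre M a γ h
    have hw : ∀ b : {w : Config G N | w.links = M ∧ w.unpaired = a ∧ w.g = γ},
        ENNReal.ofReal (weight U v lam b.1) * F (b.1.links, b.1.unpaired, b.1.g) =
        ENNReal.ofReal ((∏ e, lam ^ (∑ i, M e i) / ((∑ i, M e i).factorial : ℝ)) *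
          vertexWeight U v fun x => ∑ i, (degrees M x i - a x i) / 2 + γ x) * F (M, a, γ) := by
      rintro ⟨w, rfl, rfl, rfl⟩
      congr 2
      simp only [weight, vertexWeight, Config.interaction, ← Config.n_eq, Config.sum_links, mul_assoc]
    simp only [hw]
    rw [ENNReal.tsum_const, ← mul_assoc]
    congr 1
    have : Finite ↑{w : Config G N | w.links = M ∧ w.unpaired = a ∧ w.g = γ} := hfin
    rw [ENat.card_eq_coe_natCard, ENat.toENNReal_coe, ← ENNReal.ofReal_natCast,
      ← ENNReal.ofReal_mul (by positivity)]
    congr 1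
    have hc' := congrArg (Nat.cast : ℕ → ℝ) (show Nat.card
      ↑{w : Config G N | w.links = M ∧ w.unpaired = a ∧ w.g = γ} * _ = _ from hcard)
    rw [Nat.cast_mul, Nat.cast_mul] at hc'
    rw [← mul_assoc]
    congr 1
    have hne : ((∏ e : G.edgeSet, ∏ i, (M e i).factorial : ℕ) : ℝ) ≠ 0 := by
      exact_mod_cast (Finset.prod_pos fun e _ => Finset.prod_pos fun i _ =>
        Nat.factorial_pos _).ne'
    have hne' : ((∏ e : G.edgeSet, (∑ i, M e i).factorial : ℕ) : ℝ) ≠ 0 := by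
      exact_mod_cast (Finset.prod_pos fun e _ => Nat.factorial_pos _).ne'
    have h1 : linkWeight lam M = (∏ e, lam ^ (∑ i, M e i)) /
        ((∏ e : G.edgeSet, ∏ i, (M e i).factorial : ℕ) : ℝ) := by
      simp only [linkWeight, Finset.prod_div_distrib, Finset.prod_pow_eq_pow_sum]
      push_cast; rfl
    have h2 : ∏ e, lam ^ (∑ i, M e i) / ((∑ i, M e i).factorial : ℝ) =
        (∏ e, lam ^ (∑ i, M e i)) / ((∏ e : G.edgeSet, (∑ i, M e i).factorial : ℕ) : ℝ) := by
      rw [Finset.prod_div_distrib]; push_cast; rfl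
    rw [h1, h2, mul_div_assoc', div_mul_eq_mul_div, div_eq_div_iff hne' hne]
    linear_combination (∏ e, lam ^ (∑ i, M e i)) * hc'
  -- Configurations have an even number of links at each vertex, so otherwise the fibre is empty.
  · have : IsEmpty ↑{w : Config G N | w.links = M ∧ w.unpaired = a ∧ w.g = γ} := by
      refine ⟨fun w => h fun x => ?_⟩
      obtain ⟨w, rfl, -, -⟩ := w
      simp only [degrees]
      rw [Finset.sum_comm]
      simpa only [Config.sum_links] using w.even_links x
    exact tsum_empty

end Fibres

/-! ### Summability -/

lemma pairings_le (n : ℕ) : pairings n ≤ 2 ^ (n / 2) * (n / 2).factorial := by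
  induction n using Nat.strong_induction_on with
  | _ n ih =>
    match n with
    | 0 => simp [pairings]
    | 1 => simp [pairings]
    | n + 2 =>
      rw [pairings, Nat.add_div_right _ two_pos, Nat.factorial_succ, pow_succ]
      calc (n + 1) * pairings n ≤ (2 * (n / 2 + 1)) * (2 ^ (n / 2) * (n / 2).factorial) :=
            Nat.mul_le_mul (by omega) (ih n (by omega))
        _ = _ := by ring

/-- Isolates the factorial of the number of pairs, which the vertex weights can absorb; the
remaining growth is only exponential in `k`. -/
lemma involutions_le (k a : ℕ) : involutions k a ≤ 4 ^ k * ((k - a) / 2).factorial := by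
  calc involutions k a ≤ 2 ^ k * (2 ^ ((k - a) / 2) * ((k - a) / 2).factorial) :=
        Nat.mul_le_mul (Nat.choose_le_two_pow k a) (pairings_le _)
    _ ≤ 2 ^ k * (2 ^ k * ((k - a) / 2).factorial) := by
        gcongr
        · norm_num
        · omega
    _ = _ := by rw [← mul_assoc, ← mul_pow]; norm_num

/-- Every finite set of families lies in a finite box, over which the sum of products factorises. -/
lemma summable_pi_prod {ι : Type*} [Fintype ι] {β : ι → Type*} {f : ∀ i, β i → ℝ}
    (hf : ∀ i b, 0 ≤ f i b) (hs : ∀ i, Summable (f i)) :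
    Summable fun n : ∀ i, β i => ∏ i, f i (n i) := by
  classical
  refine summable_of_sum_le (c := ∏ i, ∑' b, f i b)
    (fun n => Finset.prod_nonneg fun i _ => hf i _) fun s => ?_
  calc ∑ n ∈ s, ∏ i, f i (n i)
      ≤ ∑ n ∈ Fintype.piFinset fun i => s.image fun n => n i, ∏ i, f i (n i) := by
        refine Finset.sum_le_sum_of_subset_of_nonneg ?_ fun n _ _ =>
          Finset.prod_nonneg fun i _ => hf i _
        intro n hn
        exact Fintype.mem_piFinset.2 fun i => Finset.mem_image_of_mem _ hn
    _ = ∏ i, ∑ b ∈ s.image fun n => n i, f i b := (Finset.prod_univ_sum _ _).symm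
    _ ≤ ∏ i, ∑' b, f i b := Finset.prod_le_prod
        (fun i _ => Finset.sum_nonneg fun b _ => hf i b)
        fun i _ => (hs i).sum_le_tsum _ fun b _ => hf i b

section

variable {N : ℕ} {E : Type*} [Fintype E]

lemma summable_linkWeight {lam : ℝ} (hlam : 0 < lam) :
    Summable fun M : E → Fin N → ℕ => linkWeight lam M := by
  unfold linkWeight
  refine summable_pi_prod (β := fun _ => Fin N → ℕ)
    (f := fun _ m => ∏ i, lam ^ m i / ((m i).factorial : ℝ)) (fun e m => by positivity) fun e => ?_
  exact summable_pi_prod (β := fun _ => ℕ) (f := fun _ m => lam ^ m / (m.factorial : ℝ))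
    (fun i m => by positivity) fun i => Real.summable_pow_div_factorial lam

lemma linkWeight_mul_pow (lam R : ℝ) (M : E → Fin N → ℕ) :
    linkWeight lam M * R ^ (∑ e, ∑ i, M e i) = linkWeight (lam * R) M := by
  simp only [linkWeight, ← Finset.prod_pow_eq_pow_sum, ← Finset.prod_mul_distrib]
  refine Finset.prod_congr rfl fun e _ => Finset.prod_congr rfl fun i _ => ?_
  rw [mul_pow]; ring

end

/-- Bound on the weights of the vertices that makes all series of the model converge. -/
def Controlled {V : Type} [Fintype V] (U : ℕ → ℝ≥0) (v : V → V → ℝ) : Prop :=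
  ∃ C K : ℝ, 0 ≤ C ∧ 1 ≤ K ∧
    ∀ n : V → ℕ, vertexWeight U v n ≤ ∏ x, C * K ^ n x / ((n x).factorial : ℝ)

section

variable {V : Type} [Fintype V] {N : ℕ}

/-- The expectation of the monomial with exponents `A` under the functional which corresponds to
independent spins with weights `U` and interaction `v`. -/
noncomputable def moment (U : ℕ → ℝ≥0) (v : V → V → ℝ) (A : V → Fin N → ℕ) : ℝ :=
  ((∏ x, ∏ i, pairings (A x i) : ℕ) : ℝ) * vertexWeight U v fun x => (∑ i, A x i) / 2

lemma moment_nonneg (U : ℕ → ℝ≥0) (v : V → V → ℝ) (A : V → Fin N → ℕ) :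
    0 ≤ moment U v A := mul_nonneg (Nat.cast_nonneg _) (vertexWeight_nonneg _ _ _)

/-- The product of the factorials of the `j x i` divides the factorial of their sum, which is at
most `(n x)!`; this cancels against the denominators in `Controlled`. The slack `r` leaves room for
ghost pairings. -/
lemma prod_mul_vertexWeight_le {U : ℕ → ℝ≥0} {v : V → V → ℝ} (h : Controlled U v) (r : ℕ) :
    ∃ D R : ℝ, 0 ≤ D ∧ 1 ≤ R ∧ ∀ (k : V → Fin N → ℕ) (j : V → Fin N → ℕ) (q : V → Fin N → ℕ)
      (n : V → ℕ), (∀ x i, q x i ≤ 4 ^ k x i * (j x i).factorial) → (∀ x, ∑ i, j x i ≤ n x) →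
      (∀ x, n x ≤ ∑ i, k x i + r) →
      ((∏ x, ∏ i, q x i : ℕ) : ℝ) * vertexWeight U v n ≤ D * R ^ (∑ x, ∑ i, k x i) := by
  obtain ⟨C, K, hC, hK, hb⟩ := h
  refine ⟨(C * K ^ r) ^ Fintype.card V, 4 * K, by positivity, by linarith, ?_⟩
  intro k j q n hq hj hn
  calc ((∏ x, ∏ i, q x i : ℕ) : ℝ) * vertexWeight U v n
      ≤ ((∏ x, ∏ i, q x i : ℕ) : ℝ) * ∏ x, C * K ^ n x / ((n x).factorial : ℝ) :=
        mul_le_mul_of_nonneg_left (hb n) (Nat.cast_nonneg _)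
    _ = ∏ x, ((∏ i, q x i : ℕ) : ℝ) * (C * K ^ n x / ((n x).factorial : ℝ)) := by
        rw [Finset.prod_mul_distrib]; push_cast; rfl
    _ ≤ ∏ x, (C * K ^ r) * (4 * K) ^ (∑ i, k x i) := by
        refine Finset.prod_le_prod (fun x _ => by positivity) fun x _ => ?_
        have h1 : ∏ i, q x i ≤ 4 ^ (∑ i, k x i) * (n x).factorial := by
          calc ∏ i, q x i ≤ ∏ i, 4 ^ k x i * (j x i).factorial :=
                Finset.prod_le_prod' fun i _ => hq x i
            _ = 4 ^ (∑ i, k x i) * ∏ i, (j x i).factorial := by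
                rw [Finset.prod_mul_distrib, Finset.prod_pow_eq_pow_sum]
            _ ≤ _ := by
                gcongr
                exact (Nat.le_of_dvd (Nat.factorial_pos _)
                  (Nat.prod_factorial_dvd_factorial_sum _ _)).trans (Nat.factorial_le (hj x))
        have h2 : ((∏ i, q x i : ℕ) : ℝ) ≤ 4 ^ (∑ i, k x i) * ((n x).factorial : ℝ) := by
          exact_mod_cast h1
        have h3 : K ^ n x ≤ K ^ (∑ i, k x i + r) := pow_le_pow_right₀ hK (hn x)
        have h4 : (0 : ℝ) < (n x).factorial := by positivity
        calc ((∏ i, q x i : ℕ) : ℝ) * (C * K ^ n x / ((n x).factorial : ℝ))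
            ≤ (4 ^ (∑ i, k x i) * ((n x).factorial : ℝ)) *
              (C * K ^ (∑ i, k x i + r) / ((n x).factorial : ℝ)) := by gcongr
          _ = _ := by rw [pow_add, mul_pow]; field_simp
    _ = _ := by
        rw [Finset.prod_mul_distrib, Finset.prod_pow_eq_pow_sum, Finset.prod_const,
          Finset.card_univ]

lemma moment_le {U : ℕ → ℝ≥0} {v : V → V → ℝ} (h : Controlled U v) (N : ℕ) :
    ∃ D R : ℝ, 0 ≤ D ∧ 1 ≤ R ∧ ∀ A : V → Fin N → ℕ,
      moment U v A ≤ D * R ^ (∑ x, ∑ i, A x i) := by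
  obtain ⟨D, R, hD, hR, hb⟩ := prod_mul_vertexWeight_le (N := N) h 0
  refine ⟨D, R, hD, hR, fun A => hb A (fun x i => A x i / 2) _ _ (fun x i => ?_) (fun x => ?_)
    fun x => Nat.div_le_self _ _⟩
  · refine (pairings_le _).trans (Nat.mul_le_mul_right _ ?_)
    calc 2 ^ (A x i / 2) ≤ 2 ^ A x i := Nat.pow_le_pow_right two_pos (Nat.div_le_self _ _)
      _ ≤ 4 ^ A x i := Nat.pow_le_pow_left (by norm_num) _
  · rw [Nat.le_div_iff_mul_le two_pos, Finset.sum_mul]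
    exact Finset.sum_le_sum fun i _ => Nat.div_mul_le_self _ _

end

section

variable {V : Type} [Fintype V] [DecidableEq V] {G : SimpleGraph V} [DecidableRel G.Adj] {N : ℕ}

lemma sum_degrees_le (M : G.edgeSet → Fin N → ℕ) :
    ∑ x, ∑ i, degrees M x i ≤ Fintype.card V * ∑ e, ∑ i, M e i := by
  rw [← smul_eq_mul, ← Finset.card_univ, ← Finset.sum_const]
  refine Finset.sum_le_sum fun x _ => ?_
  simp only [degrees]
  rw [Finset.sum_comm]
  calc ∑ e : EdgeAt G x, ∑ i, M e.1 i
      = ∑ e ∈ Finset.univ.map (Function.Embedding.subtype fun e : G.edgeSet => x ∈ (e : Sym2 V)),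
          ∑ i, M e i := by rw [Finset.sum_map]; rfl
    _ ≤ _ := Finset.sum_le_sum_of_subset (Finset.subset_univ _)

omit [DecidableEq V] in
lemma summable_of_le_pow {lam : ℝ} (hlam : 0 < lam) {f : (G.edgeSet → Fin N → ℕ) → ℝ} {D R : ℝ}
    (h0 : ∀ M, 0 ≤ f M) (hR : 0 < R)
    (h : ∀ M, f M ≤ D * R ^ (∑ e, ∑ i, M e i)) :
    Summable fun M => linkWeight lam M * f M := by
  refine Summable.of_nonneg_of_le (fun M => mul_nonneg (linkWeight_nonneg hlam M) (h0 M))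
    (fun M => ?_) ((summable_linkWeight (E := G.edgeSet) (N := N) (mul_pos hlam hR)).mul_left D)
  rw [← linkWeight_mul_pow, mul_left_comm]
  exact mul_le_mul_of_nonneg_left (h M) (linkWeight_nonneg hlam M)

/-- Convergence of the series that define correlations, with a factor of at most exponential
growth. -/
lemma summable_correlation {U : ℕ → ℝ≥0} {v : V → V → ℝ} (hc : Controlled U v) {lam : ℝ}
    (hlam : 0 < lam) (a : V → Fin N → ℕ) {p : (G.edgeSet → Fin N → ℕ) → ℝ} {C R : ℝ}
    (hp0 : ∀ M, 0 ≤ p M) (hR : 1 ≤ R) (hp : ∀ M, p M ≤ C * R ^ (∑ e, ∑ i, M e i)) :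
    Summable fun M : G.edgeSet → Fin N → ℕ =>
      linkWeight lam M * (p M * moment U v (degrees M + a)) := by
  obtain ⟨D, S, hD, hS, hb⟩ := moment_le hc N
  have hC : 0 ≤ C := by
    have := (hp0 0).trans (hp 0)
    simpa using this
  refine summable_of_le_pow hlam (D := C * (D * S ^ ∑ x, ∑ i, a x i))
    (R := R * S ^ Fintype.card V) (fun M => mul_nonneg (hp0 M) (moment_nonneg _ _ _))
    (by positivity) fun M => ?_
  calc p M * moment U v (degrees M + a)
      ≤ (C * R ^ (∑ e, ∑ i, M e i)) *
          (D * (S ^ (Fintype.card V * ∑ e, ∑ i, M e i) * S ^ ∑ x, ∑ i, a x i)) := by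
        refine mul_le_mul (hp M) ((hb _).trans ?_) (moment_nonneg _ _ _) (by positivity)
        refine mul_le_mul_of_nonneg_left ?_ hD
        rw [← pow_add]
        refine pow_le_pow_right₀ hS ?_
        simp only [Pi.add_apply, Finset.sum_add_distrib]
        exact Nat.add_le_add_right (sum_degrees_le M) _
    _ = _ := by rw [mul_pow, pow_mul]; ring

/-- The numbers of unpaired links range over an infinite set. A factor `1/2` per unpaired link makes
that sum converge, and it costs at most a factor two per link at a vertex, because no more links can
be unpaired than touch the vertex. -/
lemma summable_weight {U : ℕ → ℝ≥0} {v : V → V → ℝ} (hc : Controlled U v) {lam : ℝ}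
    (hlam : 0 < lam) : Summable fun w : Config G N => weight U v lam w := by
  classical
  -- Four is the largest number of ghost pairings at a vertex.
  obtain ⟨D, R, hD, hR, hb⟩ := prod_mul_vertexWeight_le (N := N) hc 4
  have key : Summable fun s : (G.edgeSet → Fin N → ℕ) × (V → Fin N → ℕ) × (V → Fin 5) =>
      linkWeight lam s.1 * (D * (2 * R) ^ (∑ x, ∑ i, degrees s.1 x i)) *
        ((∏ x, ∏ i, (1 / 2 : ℝ) ^ s.2.1 x i) * 1) := by
    refine Summable.mul_of_nonneg (f := fun M : G.edgeSet → Fin N → ℕ =>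
        linkWeight lam M * (D * (2 * R) ^ (∑ x, ∑ i, degrees M x i)))
      (g := fun s : (V → Fin N → ℕ) × (V → Fin 5) => (∏ x, ∏ i, (1 / 2 : ℝ) ^ s.1 x i) * 1)
      ?_ ?_ ?_ ?_
    · refine summable_of_le_pow hlam (D := D) (R := (2 * R) ^ Fintype.card V)
        (fun M => by positivity) (by positivity) fun M => ?_
      rw [← pow_mul]
      exact mul_le_mul_of_nonneg_left (pow_le_pow_right₀ (by linarith) (sum_degrees_le M)) hD
    · refine Summable.mul_of_nonneg (f := fun a : V → Fin N → ℕ => ∏ x, ∏ i, (1 / 2 : ℝ) ^ a x i)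
        (g := fun _ : V → Fin 5 => (1 : ℝ)) ?_ (Summable.of_finite) ?_ ?_
      · exact summable_pi_prod (β := fun _ => Fin N → ℕ)
          (f := fun _ m => ∏ i, (1 / 2 : ℝ) ^ m i) (fun _ _ => by positivity) fun _ =>
          summable_pi_prod (β := fun _ => ℕ) (f := fun _ m => (1 / 2 : ℝ) ^ m)
            (fun _ _ => by positivity) fun _ => summable_geometric_two
      · intro a; dsimp only; positivity
      · intro _; exact zero_le_one
    · intro M; exact mul_nonneg (linkWeight_nonneg hlam M) (by positivity)
    · intro s; dsimp only; positivity
  have hfin : ∑' w : Config G N, ENNReal.ofReal (weight U v lam w) ≠ ⊤ := by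
    have h1 := tsum_config (G := G) (N := N) U v lam fun _ => 1
    simp only [mul_one] at h1
    rw [h1]
    refine ne_top_of_le_ne_top key.tsum_ofReal_ne_top (ENNReal.tsum_le_tsum fun s => ?_)
    obtain ⟨M, a, γ⟩ := s
    split_ifs with hM
    swap
    · exact zero_le
    refine ENNReal.ofReal_le_ofReal ?_
    dsimp only
    rw [mul_one, mul_assoc, mul_assoc]
    refine mul_le_mul_of_nonneg_left ?_ (linkWeight_nonneg hlam M)
    by_cases h0 : ∏ x, ∏ i, involutions (degrees M x i) (a x i) = 0
    · rw [h0, Nat.cast_zero, zero_mul]; positivity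
    have ha : ∀ x i, a x i ≤ degrees M x i := fun x i =>
      (even_sub_of_involutions_ne_zero (Finset.prod_ne_zero_iff.1
        (Finset.prod_ne_zero_iff.1 h0 x (Finset.mem_univ _)) i (Finset.mem_univ _))).1
    have hsum : (1 : ℝ) ≤ 2 ^ (∑ x, ∑ i, degrees M x i) * ∏ x, ∏ i, (1 / 2 : ℝ) ^ a x i := by
      simp only [← Finset.prod_pow_eq_pow_sum, ← Finset.prod_mul_distrib]
      have h1 : ∏ _x : V, ∏ _i : Fin N, (1 : ℝ) = 1 := by simp
      refine h1.symm.trans_le ?_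
      refine Finset.prod_le_prod (fun _ _ => by simp) fun x _ => ?_
      refine Finset.prod_le_prod (fun _ _ => zero_le_one) fun i _ => ?_
      rw [one_div, inv_pow, ← div_eq_mul_inv, one_le_div (by positivity)]
      exact pow_le_pow_right₀ one_le_two (ha x i)
    calc _ ≤ D * R ^ (∑ x, ∑ i, degrees M x i) :=
          hb _ (fun x i => (degrees M x i - a x i) / 2) _ _ (fun x i => involutions_le _ _)
            (fun x => Nat.le_add_right _ _) fun x => by
              refine Nat.add_le_add (Finset.sum_le_sum fun i _ => ?_) (by omega)
              omega
      _ ≤ D * R ^ (∑ x, ∑ i, degrees M x i) *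
          (2 ^ (∑ x, ∑ i, degrees M x i) * ∏ x, ∏ i, (1 / 2 : ℝ) ^ a x i) :=
          le_mul_of_one_le_right (by positivity) hsum
      _ = _ := by rw [mul_pow]; ring
  refine (ENNReal.summable_toReal hfin).congr fun w => ?_
  exact ENNReal.toReal_ofReal (weight_nonneg hlam w)

lemma Config.linkCount_of_adj (w : Config G N) {x y : V} (h : G.Adj x y) (i : Fin N) :
    w.linkCount x y (i + 1) = w.links ⟨s(x, y), h⟩ i := by
  simp [Config.linkCount, h, Config.links, Fin.ext_iff]

lemma weight_mul_two (U : ℕ → ℝ≥0) (v : V → V → ℝ) (lam : ℝ) (w : Config G N) :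
    weight U v (lam * 2) w = weight U v lam w * 2 ^ (∑ e, w.m e) := by
  simp only [weight, mul_pow, ← Finset.prod_pow_eq_pow_sum, mul_div_right_comm,
    Finset.prod_mul_distrib]
  ring

/-- A link number is below two to the total number of links, and this power is absorbed by doubling
`lam`, for which the weights are still summable. -/
lemma summable_weight_mul_linkCount {U : ℕ → ℝ≥0} {v : V → V → ℝ} (hc : Controlled U v) {lam : ℝ}
    (hlam : 0 < lam) (x y : V) (i : ℕ) :
    Summable fun w : Config G N => weight U v lam w * (w.linkCount x y i : ℝ) := by
  refine Summable.of_nonneg_of_le (fun w => mul_nonneg (weight_nonneg hlam w) (Nat.cast_nonneg _))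
    (fun w => ?_) (summable_weight (G := G) (N := N) hc (mul_pos hlam two_pos))
  rw [weight_mul_two]
  refine mul_le_mul_of_nonneg_left ?_ (weight_nonneg hlam w)
  have h : w.linkCount x y i ≤ 2 ^ (∑ e, w.m e) := by
    rw [Config.linkCount]
    split_ifs with h
    · calc _ ≤ w.m ⟨s(x, y), h⟩ := (Finset.card_le_univ _).trans (by simp)
        _ ≤ ∑ e, w.m e := Finset.single_le_sum (f := w.m) (fun _ _ => Nat.zero_le _)
            (Finset.mem_univ _)
        _ ≤ _ := Nat.lt_two_pow_self.le
    · exact Nat.zero_le _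
  exact_mod_cast h

end

/-! ### Partition functions as correlations -/

section

variable {V : Type} [Fintype V] [DecidableEq V] {G : SimpleGraph V} [DecidableRel G.Adj] {N : ℕ}

/-- The unnormalised correlation of the monomial with exponents `a`. -/
noncomputable def correlation (G : SimpleGraph V) [DecidableRel G.Adj] (U : ℕ → ℝ≥0)
    (v : V → V → ℝ) (lam : ℝ) (a : V → Fin N → ℕ) : ℝ :=
  ∑' M : G.edgeSet → Fin N → ℕ, linkWeight lam M * moment U v (degrees M + a)

/-- The exponents of the product of the first two spin components at `x`. -/
def insertion (N : ℕ) (x : V) : V → Fin N → ℕ := fun z i => if z = x ∧ (i : ℕ) < 2 then 1 else 0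

open Classical in
-- Selects from `tsum_config` one profile of unpaired links and ghosts, and returns from `ℝ≥0∞` to
-- the reals.
lemma tsum_config_fibre (U : ℕ → ℝ≥0) (v : V → V → ℝ) {lam : ℝ} (hlam : 0 < lam)
    (a : V → Fin N → ℕ) (γ : V → Fin 5) (f : (G.edgeSet → Fin N → ℕ) → ℝ) (hf : ∀ M, 0 ≤ f M) :
    ∑' w : Config G N, weight U v lam w * (if w.unpaired = a ∧ w.g = γ then f w.links else 0) =
      ∑' M : G.edgeSet → Fin N → ℕ, if ∀ x, Even (∑ i, degrees M x i) then
          (linkWeight lam M *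
            ((∏ x, ∏ i, involutions (degrees M x i) (a x i) : ℕ) : ℝ) *
            vertexWeight U v fun x => ∑ i, (degrees M x i - a x i) / 2 + γ x) * f M
        else 0 := by
  have h := tsum_config (G := G) (N := N) U v lam fun s =>
    if s.2 = (a, γ) then ENNReal.ofReal (f s.1) else 0
  rw [ENNReal.tsum_prod'] at h
  have h2 : ∀ M : G.edgeSet → Fin N → ℕ, ∑' b : (V → Fin N → ℕ) × (V → Fin 5),
      (if ∀ x, Even (∑ i, degrees M x i) then
          ENNReal.ofReal (linkWeight lam M *
            ((∏ x, ∏ i, involutions (degrees M x i) (b.1 x i) : ℕ) : ℝ) *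
            vertexWeight U v fun x => ∑ i, (degrees M x i - b.1 x i) / 2 + b.2 x) *
            (if b = (a, γ) then ENNReal.ofReal (f M) else 0)
        else 0) = ENNReal.ofReal (if ∀ x, Even (∑ i, degrees M x i) then
          (linkWeight lam M *
            ((∏ x, ∏ i, involutions (degrees M x i) (a x i) : ℕ) : ℝ) *
            vertexWeight U v fun x => ∑ i, (degrees M x i - a x i) / 2 + γ x) * f M
        else 0) := by
    intro M
    rw [tsum_eq_single ((a, γ) : (V → Fin N → ℕ) × (V → Fin 5))]
    · rw [if_pos rfl, apply_ite ENNReal.ofReal, ENNReal.ofReal_zero,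
        ← ENNReal.ofReal_mul (mul_nonneg (mul_nonneg (linkWeight_nonneg hlam M) (Nat.cast_nonneg _))
          (vertexWeight_nonneg _ _ _))]
    · intro b hb
      rw [if_neg hb, mul_zero, ite_self]
  simp only [h2] at h
  have h3 := congrArg ENNReal.toReal h
  rw [ENNReal.tsum_toReal_eq, ENNReal.tsum_toReal_eq] at h3
  · refine Eq.trans (tsum_congr fun w => ?_) (h3.trans (tsum_congr fun M => ?_))
    · rw [ENNReal.toReal_mul, ENNReal.toReal_ofReal (weight_nonneg hlam w)]
      simp only [Prod.mk.injEq]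
      split_ifs
      · rw [ENNReal.toReal_ofReal (hf _)]
      · simp
    · rw [ENNReal.toReal_ofReal]
      split_ifs
      · exact mul_nonneg (mul_nonneg (mul_nonneg (linkWeight_nonneg hlam M) (Nat.cast_nonneg _))
          (vertexWeight_nonneg _ _ _)) (hf M)
      · exact le_rfl
  · exact fun _ => ENNReal.ofReal_ne_top
  · intro w
    refine ENNReal.mul_ne_top ENNReal.ofReal_ne_top ?_
    split_ifs <;> simp

omit [DecidableEq V] in
/-- Pairing numbers with at most one unpaired link of each colour. -/
lemma involutions_eq_moment (U : ℕ → ℝ≥0) (v : V → V → ℝ) (k a : V → Fin N → ℕ)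
    (γ : V → Fin 5) (ha : ∀ x i, a x i ≤ 1) (hγ : ∀ x, (γ x : ℕ) = ∑ i, a x i)
    (hev : ∀ x, Even (∑ i, a x i)) :
    (if ∀ x, Even (∑ i, k x i) then ((∏ x, ∏ i, involutions (k x i) (a x i) : ℕ) : ℝ) *
      vertexWeight U v fun x => ∑ i, (k x i - a x i) / 2 + γ x else 0) = moment U v (k + a) := by
  have h1 : ∀ x i, involutions (k x i) (a x i) = pairings ((k + a) x i) := by
    intro x i
    have := ha x i
    simp only [Pi.add_apply]
    interval_cases h : a x i
    · simp
    · rw [pairings_add_one]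
  simp only [h1, moment]
  by_cases h0 : ∏ x, ∏ i, pairings ((k + a) x i) = 0
  · rw [h0]; simp
  have h2 : ∀ x i, Even ((k + a) x i) := by
    intro x i
    have h3 := Finset.prod_ne_zero_iff.1 (Finset.prod_ne_zero_iff.1 h0 x (Finset.mem_univ _)) i
      (Finset.mem_univ _)
    by_contra hodd
    obtain ⟨j, hj⟩ := Nat.not_even_iff_odd.1 hodd
    exact h3 (hj ▸ pairings_odd j)
  have h4 : ∀ x, Even (∑ i, k x i) := by
    intro x
    have : Even (∑ i, (k + a) x i) := Finset.even_sum _ fun i _ => h2 x i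
    simp only [Pi.add_apply, Finset.sum_add_distrib] at this
    exact (Nat.even_add.1 this).2 (hev x)
  rw [if_pos h4]
  congr 2
  funext x
  -- Colour by colour `(k - a) / 2 + a = (k + a) / 2`: with one ghost per unpaired link, the number
  -- of pairings is half the degree of the monomial. Hence the two ghosts at each endpoint in
  -- `Z(x,y)`.
  rw [hγ, ← Finset.sum_add_distrib, Nat.sum_div fun i _ => (h2 x i).two_dvd]
  refine Finset.sum_congr rfl fun i _ => ?_
  obtain ⟨j, hj⟩ := h2 x i
  have := ha x i
  simp only [Pi.add_apply] at hj ⊢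
  omega

open Classical in
lemma tsum_config_eq {U : ℕ → ℝ≥0} {v : V → V → ℝ} {lam : ℝ} (hlam : 0 < lam)
    (a : V → Fin N → ℕ) (γ : V → Fin 5) (f : (G.edgeSet → Fin N → ℕ) → ℝ) (hf : ∀ M, 0 ≤ f M)
    (ha : ∀ x i, a x i ≤ 1) (hγ : ∀ x, (γ x : ℕ) = ∑ i, a x i) (hev : ∀ x, Even (∑ i, a x i)) :
    ∑' w : Config G N, weight U v lam w * (if w.unpaired = a ∧ w.g = γ then f w.links else 0) =
      ∑' M : G.edgeSet → Fin N → ℕ, linkWeight lam M * (f M * moment U v (degrees M + a)) := by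
  rw [tsum_config_fibre U v hlam a γ f hf]
  refine tsum_congr fun M => ?_
  rw [← involutions_eq_moment U v (degrees M) a γ ha hγ hev]
  split_ifs <;> ring

lemma Config.closed_iff (w : Config G N) : w.Closed ↔ w.unpaired = 0 ∧ w.g = 0 := by
  simp only [Config.Closed, Config.uTot_eq, Finset.sum_eq_zero_iff, Finset.mem_univ, true_imp_iff,
    funext_iff, forall_and, Fin.ext_iff, Pi.zero_apply]
  rfl

lemma partitionClosed_eq {U : ℕ → ℝ≥0} {v : V → V → ℝ} {lam : ℝ} (hlam : 0 < lam) :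
    partitionClosed G N U v lam = correlation G U v lam (0 : V → Fin N → ℕ) := by
  classical
  have h := tsum_config_eq (G := G) (N := N) (U := U) (v := v) hlam 0 0 (fun _ => 1)
    (fun _ => zero_le_one) (by simp) (by simp) (by simp)
  rw [partitionClosed, correlation]
  simp only [one_mul] at h
  rw [← h]
  refine (tsum_subtype {w : Config G N | w.Closed} fun w => weight U v lam w).trans
    (tsum_congr fun w => ?_)
  simp [Set.indicator_apply, Config.closed_iff]

lemma expectation_linkCount {U : ℕ → ℝ≥0} {v : V → V → ℝ} {lam : ℝ} (hlam : 0 < lam)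
    (hN : 1 < N) {x y : V} (hxy : G.Adj x y) :
    expectation G N U v lam (fun w => (w.linkCount x y 1 : ℝ)) =
      (∑' M : G.edgeSet → Fin N → ℕ, linkWeight lam M *
        ((M ⟨s(x, y), hxy⟩ ⟨0, by omega⟩ : ℝ) * moment U v (degrees M))) /
        correlation G U v lam (0 : V → Fin N → ℕ) := by
  classical
  have h := tsum_config_eq (G := G) (N := N) (U := U) (v := v) hlam 0 0
    (fun M => (M ⟨s(x, y), hxy⟩ ⟨0, by omega⟩ : ℝ))
    (fun _ => Nat.cast_nonneg _) (by simp) (by simp) (by simp)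
  simp only [add_zero] at h
  rw [expectation, ← h, div_eq_mul_inv, ← tsum_mul_right, partitionClosed_eq hlam]
  refine (tsum_subtype {w : Config G N | w.Closed} fun w => weight U v lam w /
    correlation G U v lam (0 : V → Fin N → ℕ) * (w.linkCount x y 1 : ℝ)).trans
    (tsum_congr fun w => ?_)
  have hl := w.linkCount_of_adj hxy ⟨0, by omega⟩
  rw [zero_add] at hl
  simp only [Set.indicator_apply, Set.mem_ofPred_eq, Config.closed_iff, hl]
  split_ifs
  · ring
  · simp

omit [Fintype V] in
lemma sum_insertion (hN : 1 < N) (x z : V) :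
    ∑ i, insertion N x z i = if z = x then 2 else 0 := by
  by_cases h : z = x
  · simp only [insertion, h, true_and, if_true]
    rw [← Finset.card_filter]
    exact Fin.card_filter_val_lt.trans (by omega)
  · simp [insertion, h]

lemma Config.u_eq_iff {x : V} (w : Config G N) (hN : 1 < N) :
    (w.u x 1 = 1 ∧ w.u x 2 = 1 ∧ ∀ i ∈ Finset.Icc 3 N, w.u x i = 0) ↔
      ∀ i, w.unpaired x i = if (i : ℕ) < 2 then 1 else 0 := by
  constructor
  · rintro ⟨h1, h2, h3⟩ ⟨i, hi⟩
    simp only [Config.unpaired]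
    match i with
    | 0 => simpa using h1
    | 1 => simpa using h2
    | i + 2 => simpa using h3 (i + 2 + 1) (Finset.mem_Icc.2 ⟨by omega, by omega⟩)
  · intro h
    refine ⟨by simpa [Config.unpaired] using h ⟨0, by omega⟩,
      by simpa [Config.unpaired] using h ⟨1, hN⟩, fun i hi => ?_⟩
    obtain ⟨h1, h2⟩ := Finset.mem_Icc.1 hi
    have := h ⟨i - 1, by omega⟩
    simp only [Config.unpaired] at this
    rw [if_neg (by omega), Nat.sub_add_cancel (by omega)] at this
    exact this

/-- For distinct endpoints the conditions determine `unpaired` and `g` completely, with at most one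
unpaired link of each colour at each vertex, so a single instance of `tsum_config_eq` suffices. -/
lemma partitionDirected_of_ne {U : ℕ → ℝ≥0} {v : V → V → ℝ} {lam : ℝ} (hlam : 0 < lam)
    (hN : 1 < N) {x y : V} (hxy : x ≠ y) :
    partitionDirected G N U v lam x y =
      correlation G U v lam (insertion N x + insertion N y) := by
  classical
  have hsum : ∀ z, ∑ i, (insertion N x + insertion N y) z i = if z = x ∨ z = y then 2 else 0 := by
    intro z
    simp only [Pi.add_apply, Finset.sum_add_distrib, sum_insertion hN]
    by_cases h1 : z = x
    · have h2 : z ≠ y := fun h => hxy (h1.symm.trans h)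
      simp [h1, hxy]
    · simp [h1]
  have h := tsum_config_eq (G := G) (N := N) (U := U) (v := v) hlam
    (insertion N x + insertion N y) (fun z => if z = x ∨ z = y then 2 else 0) (fun _ => 1)
    (fun _ => zero_le_one) (fun z i => by
      simp only [Pi.add_apply, insertion]
      by_cases h1 : z = x
      · have h2 : z ≠ y := fun h => hxy (h1.symm.trans h)
        simp only [h2, false_and, if_false]
        split_ifs <;> simp
      · simp only [h1, false_and, if_false]
        split_ifs <;> simp)
    (fun z => by rw [hsum]; split_ifs <;> rfl) (fun z => by rw [hsum]; split_ifs <;> decide)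
  simp only [one_mul] at h
  rw [partitionDirected, if_neg hxy, correlation, ← h]
  refine tsum_congr fun w => ?_
  congr 1
  refine if_congr ?_ rfl rfl
  have hz : ∀ z, z = x ∨ z = y → ∀ i, (insertion N x + insertion N y) z i =
      if (i : ℕ) < 2 then 1 else 0 := by
    rintro z (rfl | rfl) i
    · simp [insertion, hxy]
    · simp [insertion, hxy.symm]
  have hz' : ∀ z, ¬ (z = x ∨ z = y) → ∀ i, (insertion N x + insertion N y) z i = 0 := by
    intro z hz i
    rw [not_or] at hz
    simp [insertion, hz.1, hz.2]
  constructor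
  · rintro ⟨h1, h2⟩
    constructor
    · funext z i
      by_cases hzz : z = x ∨ z = y
      · rw [hz z hzz i]
        have h3 := h2 z hzz
        exact (w.u_eq_iff hN).1 ⟨h3.1, h3.2.1, h3.2.2.1⟩ i
      · rw [hz' z hzz i]
        have h3 := (h1 z (fun h => hzz (Or.inl h)) fun h => hzz (Or.inr h)).1
        rw [Config.uTot_eq, Finset.sum_eq_zero_iff] at h3
        exact h3 i (Finset.mem_univ i)
    · funext z
      refine Fin.ext ?_
      split_ifs with hzz
      · exact (h2 z hzz).2.2.2
      · exact (h1 z (fun h => hzz (Or.inl h)) fun h => hzz (Or.inr h)).2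
  · rintro ⟨h1, h2⟩
    constructor
    · intro z hzx hzy
      have hzz : ¬ (z = x ∨ z = y) := by simp [hzx, hzy]
      rw [Config.uTot_eq, h1, h2, hsum, if_neg hzz]
      simp only [if_neg hzz]
      exact ⟨trivial, rfl⟩
    · intro z hzz
      have h3 := (w.u_eq_iff (x := z) hN).2 fun i => by rw [h1, hz z hzz i]
      refine ⟨h3.1, h3.2.1, h3.2.2, ?_⟩
      rw [h2]
      simp only [if_pos hzz]
      rfl

/-- The exponents at a vertex with `2 s i` unpaired links of colour `i`. -/
def loopUnpaired (x : V) (s : Fin N → ℕ) : V → Fin N → ℕ := fun z i => if z = x then 2 * s i else 0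

/-- The ghost pairings in the diagonal terms. -/
def loopGhosts (x : V) (s : Fin N → ℕ) : V → Fin 5 :=
  fun z => if z = x then Fin.ofNat 5 (2 + ∑ i, s i) else 0

/-- The possible halves of the numbers of unpaired links in the diagonal terms. -/
def loopChoices (N : ℕ) : Finset (Fin N → ℕ) :=
  Fintype.piFinset fun i => if (i : ℕ) < 2 then {0, 1} else {0}

lemma sum_le_two_of_mem_loopChoices {s : Fin N → ℕ} (hs : s ∈ loopChoices N) : ∑ i, s i ≤ 2 := by
  rw [loopChoices, Fintype.mem_piFinset] at hs
  calc ∑ i, s i ≤ ∑ i : Fin N, if (i : ℕ) < 2 then 1 else 0 := by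
        refine Finset.sum_le_sum fun i _ => ?_
        have := hs i
        split_ifs at this ⊢ with h
        · simp only [Finset.mem_insert, Finset.mem_singleton] at this
          omega
        · simp only [Finset.mem_singleton] at this
          omega
    _ ≤ 2 := by
        rw [← Finset.card_filter]
        exact Fin.card_filter_val_lt.trans_le (min_le_right _ _)

omit [Fintype V] in
lemma loopGhosts_val (x : V) {s : Fin N → ℕ} (hs : s ∈ loopChoices N) (z : V) :
    (loopGhosts x s z : ℕ) = if z = x then 2 + ∑ i, s i else 0 := by
  have := sum_le_two_of_mem_loopChoices hs
  unfold loopGhosts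
  split_ifs
  · rw [Fin.val_ofNat, Nat.mod_eq_of_lt (by omega)]
  · rfl

/-- The ghost numbers make the total number of pairings at `x` the same for all choices `s`, so the
vertex weight factors out. What remains is a product over colours, each factor for the first two
colours being the right-hand side of `pairings_add_two`. -/
lemma involutions_loop (U : ℕ → ℝ≥0) (v : V → V → ℝ) (x : V) (k : V → Fin N → ℕ) (hN : 1 < N) :
    ∑ s ∈ loopChoices N, (2 : ℝ) ^ (∑ i, s i) * (if ∀ z, Even (∑ i, k z i) then
      ((∏ z, ∏ i, involutions (k z i) (loopUnpaired x s z i) : ℕ) : ℝ) *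
        (vertexWeight U v fun z => ∑ i, (k z i - loopUnpaired x s z i) / 2 + loopGhosts x s z)
      else 0) = moment U v (k + (insertion N x + insertion N x)) := by
  set A := k + (insertion N x + insertion N x) with hA
  have hterm : ∀ s ∈ loopChoices N, (2 : ℝ) ^ (∑ i, s i) * (if ∀ z, Even (∑ i, k z i) then
      ((∏ z, ∏ i, involutions (k z i) (loopUnpaired x s z i) : ℕ) : ℝ) *
        (vertexWeight U v fun z => ∑ i, (k z i - loopUnpaired x s z i) / 2 + loopGhosts x s z)
      else 0) = ((∏ i, 2 ^ s i * involutions (k x i) (2 * s i) : ℕ) : ℝ) *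
        (((∏ z ∈ Finset.univ.erase x, ∏ i, pairings (k z i) : ℕ) : ℝ) *
          vertexWeight U v fun z => (∑ i, A z i) / 2) := by
    intro s hs
    have hprod : ∏ z, ∏ i, involutions (k z i) (loopUnpaired x s z i) =
        (∏ i, involutions (k x i) (2 * s i)) *
          ∏ z ∈ Finset.univ.erase x, ∏ i, pairings (k z i) := by
      rw [← Finset.mul_prod_erase _ _ (Finset.mem_univ x)]
      congr 1
      · simp [loopUnpaired]
      · refine Finset.prod_congr rfl fun z hz => Finset.prod_congr rfl fun i _ => ?_
        rw [loopUnpaired, if_neg (Finset.ne_of_mem_erase hz), involutions_zero]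
    -- If a count vanishes, the parity condition is irrelevant, since both sides are zero. Otherwise
    -- all degrees are even.
    by_cases h0 : ∏ z, ∏ i, involutions (k z i) (loopUnpaired x s z i) = 0
    · have h1 := h0
      rw [hprod] at h1
      rw [h0, Finset.prod_mul_distrib, mul_comm (∏ i, 2 ^ s i), ← mul_assoc, Nat.cast_mul,
        mul_comm (Nat.cast _ : ℝ), mul_assoc, mul_left_comm, ← mul_assoc, mul_assoc (_ : ℝ)]
      have h2 := congrArg (Nat.cast : ℕ → ℝ) h1
      rw [Nat.cast_mul, Nat.cast_zero] at h2
      simp only [Nat.cast_zero, ite_self, mul_zero]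
      linear_combination -(((∏ i, 2 ^ s i : ℕ) : ℝ) *
        vertexWeight U v fun z => (∑ i, A z i) / 2) * h2
    have hne : ∀ z i, involutions (k z i) (loopUnpaired x s z i) ≠ 0 := fun z i =>
      Finset.prod_ne_zero_iff.1 (Finset.prod_ne_zero_iff.1 h0 z (Finset.mem_univ _)) i
        (Finset.mem_univ _)
    have hk : ∀ z i, loopUnpaired x s z i ≤ k z i ∧ Even (k z i) := by
      intro z i
      obtain ⟨h1, h2⟩ := even_sub_of_involutions_ne_zero (hne z i)
      refine ⟨h1, ?_⟩
      rw [← Nat.sub_add_cancel h1]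
      refine h2.add ?_
      unfold loopUnpaired
      split_ifs <;> simp
    rw [if_pos fun z => Finset.even_sum _ fun i _ => (hk z i).2, hprod]
    have hn : (fun z => ∑ i, (k z i - loopUnpaired x s z i) / 2 + (loopGhosts x s z : ℕ)) =
        fun z => (∑ i, A z i) / 2 := by
      funext z
      rw [loopGhosts_val x hs]
      simp only [hA, Pi.add_apply, Finset.sum_add_distrib, sum_insertion hN]
      by_cases hz : z = x
      · simp only [hz, if_true]
        rw [← add_assoc (∑ i, k x i), Nat.add_div_right _ two_pos, Nat.add_div_right _ two_pos,
          Nat.sum_div fun i _ => (hk x i).2.two_dvd]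
        have : ∑ i, (k x i - loopUnpaired x s x i) / 2 + ∑ i, s i = ∑ i, k x i / 2 := by
          rw [← Finset.sum_add_distrib]
          refine Finset.sum_congr rfl fun i _ => ?_
          have h1 := (hk x i).1
          simp only [loopUnpaired, if_true] at h1 ⊢
          omega
        omega
      · simp only [hz, if_false, add_zero]
        rw [Nat.sum_div fun i _ => (hk z i).2.two_dvd]
        simp [loopUnpaired, hz]
    rw [hn, Finset.prod_mul_distrib, Finset.prod_pow_eq_pow_sum]
    push_cast
    ring
  rw [Finset.sum_congr rfl hterm, ← Finset.sum_mul, ← Nat.cast_sum, loopChoices,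
    ← Finset.prod_univ_sum (fun i : Fin N => if (i : ℕ) < 2 then ({0, 1} : Finset ℕ) else {0})
      fun i j => 2 ^ j * involutions (k x i) (2 * j), ← mul_assoc, ← Nat.cast_mul, moment]
  congr 2
  rw [← Finset.mul_prod_erase _ (fun z => ∏ i, pairings (A z i)) (Finset.mem_univ x)]
  congr 1
  · refine Finset.prod_congr rfl fun i _ => ?_
    simp only [hA, Pi.add_apply, insertion, true_and]
    split_ifs with h
    · rw [Finset.sum_pair zero_ne_one, pairings_add_two]
      simp
    · simp
  · refine Finset.prod_congr rfl fun z hz => Finset.prod_congr rfl fun i _ => ?_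
    simp [hA, insertion, Finset.ne_of_mem_erase hz]

open Classical in
-- A diagonal configuration realises exactly one of the four patterns in which each of the first two
-- colours has zero or two unpaired links at `x`; the exponent of two is the number of colours with
-- two of them.
lemma Config.diag_factor (w : Config G N) (hN : 1 < N) (x : V) :
    (if w.Diag x then
      (2 : ℝ) ^ ((if w.u x 1 = 2 then 1 else 0) + (if w.u x 2 = 2 then 1 else 0) : ℕ) else 0) =
    ∑ s ∈ loopChoices N, (2 : ℝ) ^ (∑ i, s i) *
      (if w.unpaired = loopUnpaired x s ∧ w.g = loopGhosts x s then 1 else 0) := by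
  have hmatch : ∀ s ∈ loopChoices N, w.unpaired = loopUnpaired x s → w.g = loopGhosts x s →
      w.Diag x ∧ ∑ i, s i = (if w.u x 1 = 2 then 1 else 0) + (if w.u x 2 = 2 then 1 else 0) := by
    intro s hs h1 h2
    have hu : ∀ i : Fin N, w.u x (i + 1) = 2 * s i := fun i => by
      have := congrFun (congrFun h1 x) i
      simpa [loopUnpaired, Config.unpaired] using this
    have hs' := hs
    rw [loopChoices, Fintype.mem_piFinset] at hs'
    have hu1 := hu ⟨0, by omega⟩
    have hu2 := hu ⟨1, hN⟩
    simp only [zero_add, one_add_one_eq_two] at hu1 hu2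
    have hs1 := hs' ⟨0, by omega⟩
    have hs2 := hs' ⟨1, hN⟩
    simp only [zero_lt_two, one_lt_two, if_true, Finset.mem_insert, Finset.mem_singleton]
      at hs1 hs2
    have hsum : ∑ i, s i = s ⟨0, by omega⟩ + s ⟨1, hN⟩ := by
      rw [← Finset.sum_subset (Finset.subset_univ {(⟨0, by omega⟩ : Fin N), ⟨1, hN⟩}),
        Finset.sum_pair (by simp)]
      intro i _ hi
      simp only [Finset.mem_insert, Finset.mem_singleton, Fin.ext_iff, not_or] at hi
      have := hs' i
      rw [if_neg (by omega)] at this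
      exact Finset.mem_singleton.1 this
    have huT : w.uTot x = 2 * ∑ i, s i := by
      rw [Config.uTot_eq, h1, Finset.mul_sum]
      simp [loopUnpaired]
    refine ⟨⟨fun z hz => ⟨?_, ?_⟩, ?_, ?_, ?_, ?_⟩, ?_⟩
    · rw [Config.uTot_eq, h1]
      simp [loopUnpaired, hz]
    · rw [h2, loopGhosts_val x hs, if_neg hz]
    · omega
    · omega
    · intro i hi
      obtain ⟨h3, h4⟩ := Finset.mem_Icc.1 hi
      have h5 := hu ⟨i - 1, by omega⟩
      have h6 := hs' ⟨i - 1, by omega⟩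
      rw [if_neg (by simp only; omega), Finset.mem_singleton] at h6
      simp only at h5
      rw [h6, Nat.sub_add_cancel (by omega)] at h5
      exact h5
    · rw [h2, loopGhosts_val x hs, if_pos rfl, huT, Nat.mul_div_cancel_left _ two_pos]
    · rw [hsum]
      rcases hs1 with h | h <;> rcases hs2 with h' | h' <;> simp [hu1, hu2, h, h']
  by_cases hD : w.Diag x
  · rw [if_pos hD]
    obtain ⟨h1, h2, h3, h4, h5⟩ := hD
    let s : Fin N → ℕ := fun i => w.unpaired x i / 2
    have hval : ∀ i : Fin N, w.unpaired x i = 2 * s i ∧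
        s i ∈ if (i : ℕ) < 2 then ({0, 1} : Finset ℕ) else {0} := by
      rintro ⟨i, hi⟩
      simp only [s, Config.unpaired]
      match i, hi with
      | 0, _ => rcases h2 with h | h <;> simp [h]
      | 1, _ => rcases h3 with h | h <;> simp [h]
      | i + 2, hi =>
        have := h4 (i + 2 + 1) (Finset.mem_Icc.2 ⟨by omega, by omega⟩)
        simp [this]
    have hs : s ∈ loopChoices N := Fintype.mem_piFinset.2 fun i => (hval i).2
    have hun : w.unpaired = loopUnpaired x s := by
      funext z i
      by_cases hz : z = x
      · subst hz; simp [loopUnpaired, (hval i).1]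
      · have h6 := (h1 z hz).1
        rw [Config.uTot_eq, Finset.sum_eq_zero_iff] at h6
        simp [loopUnpaired, hz, h6 i]
    have hg : w.g = loopGhosts x s := by
      funext z
      refine Fin.ext ?_
      rw [loopGhosts_val x hs]
      by_cases hz : z = x
      · subst hz
        rw [if_pos rfl, h5, Config.uTot_eq]
        simp only [(hval _).1, ← Finset.mul_sum]
        rw [Nat.mul_div_cancel_left _ two_pos]
      · rw [if_neg hz, (h1 z hz).2]
    rw [Finset.sum_eq_single s]
    · rw [(hmatch s hs hun hg).2, if_pos (⟨hun, hg⟩ : _ ∧ _), mul_one]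
    · intro t _ hts
      rw [if_neg, mul_zero]
      rintro ⟨h, -⟩
      refine hts (funext fun i => ?_)
      have := congrFun (congrFun (hun.symm.trans h) x) i
      simp only [loopUnpaired, if_true] at this
      omega
    · intro h; exact absurd hs h
  · rw [if_neg hD]
    refine (Finset.sum_eq_zero fun s hs => ?_).symm
    rw [if_neg fun h => hD (hmatch s hs h.1 h.2).1, mul_zero]

lemma partitionDirected_self {U : ℕ → ℝ≥0} {v : V → V → ℝ} (hc : Controlled U v) {lam : ℝ}
    (hlam : 0 < lam) (hN : 1 < N) (x : V) :
    partitionDirected G N U v lam x x =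
      correlation G U v lam (insertion N x + insertion N x) := by
  classical
  rw [partitionDirected, if_pos rfl, correlation]
  have hsum : ∀ s : Fin N → ℕ, Summable fun w : Config G N => weight U v lam w *
      ((2 : ℝ) ^ (∑ i, s i) *
        (if w.unpaired = loopUnpaired x s ∧ w.g = loopGhosts x s then 1 else 0)) := by
    intro s
    refine Summable.of_nonneg_of_le (fun w => mul_nonneg (weight_nonneg hlam w) (by positivity))
      (fun w => mul_le_mul_of_nonneg_left ?_ (weight_nonneg hlam w))
      ((summable_weight (G := G) (N := N) hc hlam).mul_right (2 ^ ∑ i, s i))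
    refine mul_le_of_le_one_right (by positivity) ?_
    split_ifs <;> norm_num
  have hs2 : ∀ s : Fin N → ℕ, Summable fun M : G.edgeSet → Fin N → ℕ =>
      linkWeight lam M * ((2 : ℝ) ^ (∑ i, s i) * (if ∀ z, Even (∑ i, degrees M z i) then
      ((∏ z, ∏ i, involutions (degrees M z i) (loopUnpaired x s z i) : ℕ) : ℝ) *
        (vertexWeight U v fun z =>
          ∑ i, (degrees M z i - loopUnpaired x s z i) / 2 + loopGhosts x s z)
      else 0)) := by
    intro s
    obtain ⟨D, R, hD, hR, hb⟩ := prod_mul_vertexWeight_le (N := N) hc 4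
    refine summable_of_le_pow hlam (D := (2 : ℝ) ^ (∑ i, s i) * D) (R := R ^ Fintype.card V)
      (fun M => ?_) (by positivity) fun M => ?_
    · refine mul_nonneg (by positivity) ?_
      split_ifs
      · exact mul_nonneg (Nat.cast_nonneg _) (vertexWeight_nonneg _ _ _)
      · exact le_rfl
    · rw [mul_assoc]
      refine mul_le_mul_of_nonneg_left ?_ (by positivity)
      rw [← pow_mul]
      refine le_trans ?_ (mul_le_mul_of_nonneg_left (pow_le_pow_right₀ hR (sum_degrees_le M)) hD)
      split_ifs
      · exact hb _ (fun z i => (degrees M z i - loopUnpaired x s z i) / 2) _ _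
            (fun x i => involutions_le _ _)
            (fun x => Nat.le_add_right _ _) fun x => by
              refine Nat.add_le_add (Finset.sum_le_sum fun i _ => ?_) (by omega)
              omega
      · positivity
  simp only [Config.diag_factor _ hN, Finset.mul_sum]
  rw [Summable.tsum_finsetSum fun s _ => hsum s]
  simp only [← involutions_loop U v x _ hN, Finset.mul_sum]
  rw [Summable.tsum_finsetSum fun s _ => hs2 s]
  refine Finset.sum_congr rfl fun s _ => ?_
  have h := tsum_config_fibre (G := G) U v hlam (loopUnpaired x s) (loopGhosts x s) (fun _ => 1)
    fun _ => zero_le_one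
  have h2 := congrArg (fun t => (2 : ℝ) ^ (∑ i, s i) * t) h
  simp only [← tsum_mul_left] at h2
  refine Eq.trans (tsum_congr fun w => ?_) (h2.trans (tsum_congr fun M => ?_))
  · ring
  · split_ifs <;> ring

lemma partitionDirected_eq {U : ℕ → ℝ≥0} {v : V → V → ℝ} (hc : Controlled U v) {lam : ℝ}
    (hlam : 0 < lam) (hN : 1 < N) (x y : V) :
    partitionDirected G N U v lam x y =
      correlation G U v lam (insertion N x + insertion N y) := by
  by_cases hxy : x = y
  · subst hxy; exact partitionDirected_self hc hlam hN x
  · exact partitionDirected_of_ne hlam hN hxy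

end

/-! ### Symmetries -/

section Symmetry

variable {V : Type} [Fintype V] [DecidableEq V] {G : SimpleGraph V} [DecidableRel G.Adj] {N : ℕ}

lemma degrees_eq (M : G.edgeSet → Fin N → ℕ) (x : V) (i : Fin N) :
    degrees M x i = ∑ e : G.edgeSet, if x ∈ (e : Sym2 V) then M e i else 0 := by
  rw [← Finset.sum_filter, degrees]
  calc ∑ e : EdgeAt G x, M e.1 i
      = ∑ e ∈ Finset.univ.map (Function.Embedding.subtype fun e : G.edgeSet => x ∈ (e : Sym2 V)),
          M e i := by rw [Finset.sum_map]; rfl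
    _ = _ := by
        refine Finset.sum_congr ?_ fun _ _ => rfl
        ext e
        simp

lemma degrees_map (τ : G ≃g G) (ρ : Equiv.Perm (Fin N)) (M : G.edgeSet → Fin N → ℕ) (x : V)
    (i : Fin N) :
    degrees (fun e i => M (τ.mapEdgeSet e) (ρ i)) x i = degrees M (τ x) (ρ i) := by
  rw [degrees_eq, degrees_eq, ← Equiv.sum_comp τ.mapEdgeSet fun e =>
    if τ x ∈ (e : Sym2 V) then M e (ρ i) else 0]
  refine Finset.sum_congr rfl fun e _ => ?_
  refine if_congr ?_ rfl rfl
  obtain ⟨e, he⟩ := e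
  induction e with
  | _ y z => simp [SimpleGraph.Iso.mapEdgeSet, SimpleGraph.Hom.mapEdgeSet, Sym2.mem_iff]

omit [DecidableEq V] in
lemma moment_map (U : ℕ → ℝ≥0) {v : V → V → ℝ} (τ : V ≃ V) (hv : ∀ x y, v (τ x) (τ y) = v x y)
    (ρ : Equiv.Perm (Fin N)) (A : V → Fin N → ℕ) :
    moment U v (fun x i => A (τ x) (ρ i)) = moment U v A := by
  have h1 : ∀ x, ∑ i, A (τ x) (ρ i) = ∑ i, A (τ x) i := fun x => Equiv.sum_comp ρ (A (τ x))
  have h2 : ∀ x, ∏ i, pairings (A (τ x) (ρ i)) = ∏ i, pairings (A (τ x) i) := fun x =>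
    Equiv.prod_comp ρ fun i => pairings (A (τ x) i)
  simp only [moment, vertexWeight, h1, h2]
  rw [Equiv.prod_comp τ fun x => ∏ i, pairings (A x i),
    Equiv.prod_comp τ fun x => (U ((∑ i, A x i) / 2) : ℝ)]
  congr 4
  refine Eq.trans ?_ (Equiv.sum_comp τ _)
  refine Finset.sum_congr rfl fun x _ => ?_
  refine Eq.trans ?_ (Equiv.sum_comp τ _)
  simp only [hv]

/-- Relabelling of the links along a graph automorphism and a permutation of the colours. -/
def linksEquiv (τ : G ≃g G) (ρ : Equiv.Perm (Fin N)) :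
    (G.edgeSet → Fin N → ℕ) ≃ (G.edgeSet → Fin N → ℕ) :=
  τ.mapEdgeSet.symm.arrowCongr (ρ.symm.arrowCongr (Equiv.refl ℕ))

omit [DecidableEq V] in
lemma linkWeight_map (lam : ℝ) (τ : G ≃g G) (ρ : Equiv.Perm (Fin N)) (M : G.edgeSet → Fin N → ℕ) :
    linkWeight lam (linksEquiv τ ρ M) = linkWeight lam M := by
  simp only [linkWeight]
  refine Eq.trans ?_ (Equiv.prod_comp τ.mapEdgeSet _)
  refine Finset.prod_congr rfl fun e _ => ?_
  exact Equiv.prod_comp ρ fun i => lam ^ M (τ.mapEdgeSet e) i / ((M (τ.mapEdgeSet e) i).factorial : ℝ)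

/-- Change of variables in the sum over link numbers; the link weights and the moments are unchanged
by the relabelling, so it acts only on `p` and `a`. -/
lemma tsum_linksEquiv (U : ℕ → ℝ≥0) {v : V → V → ℝ} (lam : ℝ) (τ : G ≃g G)
    (hv : ∀ x y, v (τ x) (τ y) = v x y) (ρ : Equiv.Perm (Fin N))
    (p : (G.edgeSet → Fin N → ℕ) → ℝ) (a : V → Fin N → ℕ) :
    ∑' M : G.edgeSet → Fin N → ℕ, linkWeight lam M *
        (p (linksEquiv τ ρ M) * moment U v (degrees M + a)) =
      ∑' M : G.edgeSet → Fin N → ℕ, linkWeight lam M *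
        (p M * moment U v (degrees M + fun x i => a (τ x) (ρ i))) := by
  rw [← (linksEquiv τ ρ).tsum_eq fun M => linkWeight lam M *
        (p M * moment U v (degrees M + fun x i => a (τ x) (ρ i)))]
  refine tsum_congr fun M => ?_
  rw [linkWeight_map, ← moment_map U τ.toEquiv hv ρ (degrees M + a)]
  congr 3
  funext x i
  simp only [Pi.add_apply]
  congr 1
  exact (degrees_map τ ρ M x i).symm

lemma correlation_map (U : ℕ → ℝ≥0) {v : V → V → ℝ} (lam : ℝ) (τ : G ≃g G)
    (hv : ∀ x y, v (τ x) (τ y) = v x y) (a : V → Fin N → ℕ) :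
    correlation G U v lam (fun x => a (τ x)) = correlation G U v lam a := by
  have h := tsum_linksEquiv U lam τ hv 1 (fun _ => 1) a
  simp only [one_mul, Equiv.Perm.one_apply] at h
  exact h.symm

omit [Fintype V] in
lemma insertion_map (τ : V ≃ V) (x : V) : (fun z => insertion N (τ x) (τ z)) = insertion N x := by
  funext z i
  simp [insertion]

lemma correlation_insertion_map (U : ℕ → ℝ≥0) {v : V → V → ℝ} (lam : ℝ) (τ : G ≃g G)
    (hv : ∀ x y, v (τ x) (τ y) = v x y) (x y : V) :
    correlation G U v lam (insertion N (τ x) + insertion N (τ y)) =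
      correlation G U v lam (insertion N x + insertion N y) := by
  rw [← correlation_map U lam τ hv (insertion N (τ x) + insertion N (τ y)),
    ← insertion_map τ.toEquiv x, ← insertion_map τ.toEquiv y]
  rfl

/-- The unnormalised expectation of the number of links of a given colour on an edge. -/
noncomputable def linkSum (G : SimpleGraph V) [DecidableRel G.Adj] (U : ℕ → ℝ≥0)
    (v : V → V → ℝ) (lam : ℝ) (e : G.edgeSet) (i : Fin N) : ℝ :=
  ∑' M : G.edgeSet → Fin N → ℕ, linkWeight lam M * ((M e i : ℝ) * moment U v (degrees M))

lemma linkSum_map (U : ℕ → ℝ≥0) {v : V → V → ℝ} (lam : ℝ) (τ : G ≃g G)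
    (hv : ∀ x y, v (τ x) (τ y) = v x y) (ρ : Equiv.Perm (Fin N)) (e : G.edgeSet) (i : Fin N) :
    linkSum G U v lam (τ.mapEdgeSet e) (ρ i) = linkSum G U v lam e i := by
  have h := tsum_linksEquiv U lam τ hv ρ (fun M => (M e i : ℝ)) 0
  have h0 : (fun x (i : Fin N) => (0 : V → Fin N → ℕ) (τ x) (ρ i)) = 0 := rfl
  rw [h0] at h
  simp only [add_zero] at h
  exact h

/-- Exchanging two colours is a symmetry. Therefore the contact terms of the first two colours
coincide, and only links of colour one appear in the final bound. -/
lemma linkSum_colour (U : ℕ → ℝ≥0) (v : V → V → ℝ) (lam : ℝ) (e : G.edgeSet) (i j : Fin N) :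
    linkSum G U v lam e i = linkSum G U v lam e j := by
  have h := linkSum_map U (v := v) lam (SimpleGraph.Iso.refl : G ≃g G) (fun _ _ => rfl)
    (Equiv.swap i j) e i
  rw [Equiv.swap_apply_left] at h
  rw [← h]
  congr 1
  obtain ⟨e, he⟩ := e
  induction e with
  | _ y z => rfl

end Symmetry

/-! ### Positive definite kernels -/

/-- Entrywise powers of a positive semidefinite matrix are positive semidefinite by Schur's product
theorem, and the exponential series has positive coefficients. -/
lemma posSemidef_exp {ι : Type*} [Fintype ι] {A : Matrix ι ι ℝ} (hA : A.PosSemidef) (c : ι → ℝ) :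
    0 ≤ ∑ i, ∑ j, c i * c j * Real.exp (A i j) := by
  have hpow : ∀ k : ℕ, (Matrix.of fun i j => A i j ^ k).PosSemidef := by
    intro k
    induction k with
    | zero =>
      -- The zeroth power is the all-ones matrix, whose quadratic form is the square of the sum.
      refine Matrix.PosSemidef.of_dotProduct_mulVec_nonneg (by ext; simp) fun x => ?_
      have : star x ⬝ᵥ (Matrix.of fun i j => A i j ^ 0).mulVec x = (∑ i, x i) ^ 2 := by
        simp [dotProduct, Matrix.mulVec, sq, Finset.sum_mul]
      rw [this]; positivity
    | succ k ih =>
      have heq : (Matrix.of fun i j => A i j ^ (k + 1)) =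
          (Matrix.of fun i j => A i j ^ k).hadamard A := by
        ext i j
        simp [Matrix.hadamard, pow_succ]
      rw [heq]
      exact ih.hadamard hA
  have hs : HasSum (fun k : ℕ => ∑ i, ∑ j, c i * c j * (A i j ^ k / (k.factorial : ℝ)))
      (∑ i, ∑ j, c i * c j * Real.exp (A i j)) := by
    refine hasSum_sum fun i _ => hasSum_sum fun j _ => HasSum.mul_left _ ?_
    rw [Real.exp_eq_exp_ℝ]
    exact NormedSpace.expSeries_div_hasSum_exp (A i j)
  refine hs.nonneg fun k => ?_
  have h := (hpow k).dotProduct_mulVec_nonneg c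
  have h2 : ∑ i, ∑ j, c i * c j * (A i j ^ k / (k.factorial : ℝ)) =
      (star c ⬝ᵥ (Matrix.of fun i j => A i j ^ k).mulVec c) / (k.factorial : ℝ) := by
    simp only [dotProduct, Matrix.mulVec, Finset.sum_div, Finset.mul_sum, Pi.star_apply,
      star_trivial, Matrix.of_apply]
    refine Finset.sum_congr rfl fun i _ => Finset.sum_congr rfl fun j _ => by ring
  rw [h2]
  positivity

/-! ### Reflection positivity -/

section Reflection

variable {V : Type} [Fintype V] [DecidableEq V] {G : SimpleGraph V} [DecidableRel G.Adj] {N : ℕ}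

/-- A reflection of the graph through edges that is compatible with the interaction. -/
structure IsReflection (v : V → V → ℝ) (θ : G ≃g G) (pos : V → Prop) : Prop where
  invol : ∀ x, θ (θ x) = x
  pos_iff : ∀ x, pos (θ x) ↔ ¬ pos x
  cross : ∀ x y, G.Adj x y → pos x → ¬ pos y → y = θ x
  inv : ∀ x y, v (θ x) (θ y) = v x y
  symm : ∀ x y, v x y = v y x
  -- The sign is such that the coupling of the two halves, which enters the weight as the
  -- exponential of the negated interaction, is a positive semidefinite kernel.
  neg : ∀ c : V → ℝ, (∀ x, ¬ pos x → c x = 0) → ∑ x, ∑ y, c x * c y * v x (θ y) ≤ 0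

variable {v : V → V → ℝ} {θ : G ≃g G} {pos : V → Prop} [DecidablePred pos]

/-- The edges in the positive half. -/
abbrev PosEdge (G : SimpleGraph V) (pos : V → Prop) : Type :=
  {e : G.edgeSet // ∀ x : V, x ∈ (e : Sym2 V) → pos x}

/-- The vertices of the positive half that are joined to their mirror images. -/
abbrev CrossVertex (θ : G ≃g G) (pos : V → Prop) : Type := {x : V // pos x ∧ G.Adj x (θ x)}

/-- The edge through which the graph is reflected at a given vertex. -/
def crossEdge (b : CrossVertex θ pos) : G.edgeSet := ⟨s(b.1, θ b.1), b.2.2⟩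

/-- Decomposition of the edges under a reflection. -/
def edgeSplit (θ : G ≃g G) (pos : V → Prop) :
    PosEdge G pos ⊕ (PosEdge G pos ⊕ CrossVertex θ pos) → G.edgeSet
  | .inl e => e.1
  | .inr (.inl e) => θ.mapEdgeSet e.1
  | .inr (.inr b) => crossEdge b

omit [Fintype V] [DecidableEq V] [DecidableRel G.Adj] [DecidablePred pos] in
lemma mem_mapEdgeSet (hinv : ∀ x, θ (θ x) = x) (e : G.edgeSet) (x : V) :
    x ∈ (θ.mapEdgeSet e : Sym2 V) ↔ θ x ∈ (e : Sym2 V) := by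
  obtain ⟨e, he⟩ := e
  induction e with
  | _ y z =>
    have h : ∀ y, x = θ y ↔ θ x = y := fun y =>
      ⟨fun h => by rw [h, hinv], fun h => by rw [← h, hinv]⟩
    simp [SimpleGraph.Iso.mapEdgeSet, SimpleGraph.Hom.mapEdgeSet, Sym2.mem_iff, h]

omit [Fintype V] [DecidableEq V] [DecidableRel G.Adj] in
lemma exists_mem_edge (e : G.edgeSet) : ∃ x, x ∈ (e : Sym2 V) := by
  obtain ⟨e, he⟩ := e
  induction e with
  | _ y z => exact ⟨y, Sym2.mem_mk_left y z⟩

omit [DecidableEq V] [DecidableRel G.Adj] [DecidablePred pos] in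
-- An edge has both ends in the positive half, both in the other half, or joins a vertex to its
-- mirror image; the last point is the field `cross`. No property of the interaction matters here.
lemma edgeSplit_bijective (h : ∃ w : V → V → ℝ, IsReflection w θ pos) :
    Function.Bijective (edgeSplit θ pos) := by
  obtain ⟨w, h⟩ := h
  have hneg : ∀ (e : PosEdge G pos) x, x ∈ (θ.mapEdgeSet e.1 : Sym2 V) → ¬ pos x := by
    intro e x hx
    rw [mem_mapEdgeSet h.invol] at hx
    have := e.2 _ hx
    rwa [h.pos_iff] at this
  have hb1 : ∀ b : CrossVertex θ pos, b.1 ∈ (crossEdge b : Sym2 V) := fun b => Sym2.mem_mk_left _ _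
  have hb2 : ∀ b : CrossVertex θ pos, θ b.1 ∈ (crossEdge b : Sym2 V) :=
    fun b => Sym2.mem_mk_right _ _
  have hb3 : ∀ b : CrossVertex θ pos, ¬ pos (θ b.1) := fun b => by
    rw [h.pos_iff, not_not]; exact b.2.1
  constructor
  · rintro (e | e | b) (e' | e' | b') heq <;> simp only [edgeSplit] at heq
    · rw [Subtype.ext heq]
    · obtain ⟨x, hx⟩ := exists_mem_edge e.1
      exact absurd (e.2 x hx) (hneg e' x (heq ▸ hx))
    · exact absurd (e.2 _ (heq ▸ hb2 b')) (hb3 b')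
    · obtain ⟨x, hx⟩ := exists_mem_edge e'.1
      exact absurd (e'.2 x hx) (hneg e x (heq ▸ hx))
    · rw [Subtype.ext (θ.mapEdgeSet.injective heq)]
    · exact absurd b'.2.1 (hneg e _ (heq ▸ hb1 b'))
    · exact absurd (e'.2 _ (heq ▸ hb2 b)) (hb3 b)
    · exact absurd b.2.1 (hneg e' _ (heq ▸ hb1 b))
    · have h1 := hb1 b
      rw [heq] at h1
      rcases Sym2.mem_iff.1 h1 with h2 | h2
      · rw [Subtype.ext h2]
      · exact absurd b.2.1 (h2 ▸ hb3 b')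
  · rintro ⟨e, he⟩
    induction e with
    | _ y z =>
      have hadj : G.Adj y z := he
      by_cases hy : pos y <;> by_cases hz : pos z
      · refine ⟨.inl ⟨⟨s(y, z), he⟩, fun x hx => ?_⟩, rfl⟩
        rcases Sym2.mem_iff.1 hx with rfl | rfl <;> assumption
      · have := h.cross y z hadj hy hz
        subst this
        exact ⟨.inr (.inr ⟨y, hy, hadj⟩), rfl⟩
      · have := h.cross z y hadj.symm hz hy
        subst this
        refine ⟨.inr (.inr ⟨z, hz, hadj.symm⟩), ?_⟩
        exact Subtype.ext Sym2.eq_swap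
      · have hadj' : G.Adj (θ y) (θ z) := θ.map_adj_iff.2 hadj
        refine ⟨.inr (.inl ⟨⟨s(θ y, θ z), hadj'⟩, fun x hx => ?_⟩), ?_⟩
        · rcases Sym2.mem_iff.1 hx with rfl | rfl
          · rwa [h.pos_iff]
          · rwa [h.pos_iff]
        · refine Subtype.ext ?_
          change s(θ (θ y), θ (θ z)) = s(y, z)
          rw [h.invol, h.invol]

/-- The function equal to `a` on the positive half and to the reflection of `a'` on the other. -/
def glue {γ : Type*} (θ : G ≃g G) (pos : V → Prop) [DecidablePred pos] (a a' : V → γ) : V → γ :=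
  fun x => if pos x then a x else a' (θ x)

/-- The degrees due to the edges in the positive half. -/
def posDegrees (σ : PosEdge G pos → Fin N → ℕ) (x : V) (i : Fin N) : ℕ :=
  ∑ e, if x ∈ (e.1 : Sym2 V) then σ e i else 0

/-- The degrees in the positive half due to the reflected edges. -/
def crossDegrees (B : CrossVertex θ pos → Fin N → ℕ) (x : V) (i : Fin N) : ℕ :=
  ∑ b, if b.1 = x then B b i else 0

/-- The link numbers composed of those in the two halves and those on the reflected edges. -/
noncomputable def linksSplit (h : ∃ w : V → V → ℝ, IsReflection w θ pos) :
    (CrossVertex θ pos → Fin N → ℕ) × (PosEdge G pos → Fin N → ℕ) × (PosEdge G pos → Fin N → ℕ) ≃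
      (G.edgeSet → Fin N → ℕ) where
  toFun q := fun e => Sum.elim q.2.1 (Sum.elim q.2.2 q.1)
    ((Equiv.ofBijective _ (edgeSplit_bijective h)).symm e)
  invFun M := (fun b => M (edgeSplit θ pos (.inr (.inr b))), fun e => M (edgeSplit θ pos (.inl e)),
    fun e => M (edgeSplit θ pos (.inr (.inl e))))
  left_inv q := by
    simp only [Equiv.ofBijective_symm_apply_apply, Sum.elim_inl, Sum.elim_inr]
  right_inv M := by
    funext e
    obtain ⟨s, rfl⟩ := (edgeSplit_bijective h).2 e
    simp only [Equiv.ofBijective_symm_apply_apply]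
    rcases s with s | s | s <;> rfl

omit [DecidableEq V] [DecidableRel G.Adj] [DecidablePred pos] in
lemma linksSplit_apply (h : ∃ w : V → V → ℝ, IsReflection w θ pos)
    (q : (CrossVertex θ pos → Fin N → ℕ) × (PosEdge G pos → Fin N → ℕ) ×
      (PosEdge G pos → Fin N → ℕ)) (s : PosEdge G pos ⊕ (PosEdge G pos ⊕ CrossVertex θ pos)) :
    linksSplit h q (edgeSplit θ pos s) = Sum.elim q.2.1 (Sum.elim q.2.2 q.1) s := by
  simp only [linksSplit, Equiv.coe_fn_mk, Equiv.ofBijective_symm_apply_apply]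

lemma linkWeight_linksSplit (h : ∃ w : V → V → ℝ, IsReflection w θ pos) (lam : ℝ)
    (q : (CrossVertex θ pos → Fin N → ℕ) × (PosEdge G pos → Fin N → ℕ) ×
      (PosEdge G pos → Fin N → ℕ)) :
    linkWeight lam (linksSplit h q) =
      linkWeight lam q.1 * (linkWeight lam q.2.1 * linkWeight lam q.2.2) := by
  rw [linkWeight, ← Equiv.prod_comp (Equiv.ofBijective _ (edgeSplit_bijective h))]
  simp only [Equiv.ofBijective_apply, linksSplit_apply, Fintype.prod_sum_type, Sum.elim_inl,
    Sum.elim_inr]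
  rw [← mul_assoc, mul_comm]
  rfl

/-- A crossing link contributes to the degrees at both of its ends, which are mirror images, so
after reflection the same `crossDegrees` appear in both halves. -/
lemma degrees_linksSplit (h : ∃ w : V → V → ℝ, IsReflection w θ pos)
    (q : (CrossVertex θ pos → Fin N → ℕ) × (PosEdge G pos → Fin N → ℕ) ×
      (PosEdge G pos → Fin N → ℕ)) :
    degrees (linksSplit h q) = glue θ pos (posDegrees q.2.1 + crossDegrees q.1)
      (posDegrees q.2.2 + crossDegrees q.1) := by
  funext x i
  rw [degrees_eq, ← Equiv.sum_comp (Equiv.ofBijective _ (edgeSplit_bijective h))]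
  simp only [Equiv.ofBijective_apply, linksSplit_apply, Fintype.sum_sum_type, Sum.elim_inl,
    Sum.elim_inr]
  obtain ⟨w, h⟩ := h
  simp only [edgeSplit, mem_mapEdgeSet h.invol]
  have hb : ∀ b : CrossVertex θ pos, x ∈ (crossEdge b : Sym2 V) ↔ x = b.1 ∨ x = θ b.1 :=
    fun b => Sym2.mem_iff
  simp only [hb, glue]
  split_ifs with hx
  · have h1 : ∀ e : PosEdge G pos, ¬ θ x ∈ (e.1 : Sym2 V) := fun e he =>
      ((h.pos_iff x).1 (e.2 _ he)) hx
    have h2 : ∀ b : CrossVertex θ pos, (x = b.1 ∨ x = θ b.1) ↔ b.1 = x := fun b => by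
      constructor
      · rintro (rfl | rfl)
        · rfl
        · exact absurd b.2.1 ((h.pos_iff _).1 hx)
      · exact fun hh => Or.inl hh.symm
    simp only [h1, h2, if_false, Finset.sum_const_zero, zero_add]
    rfl
  · have h1 : ∀ e : PosEdge G pos, ¬ x ∈ (e.1 : Sym2 V) := fun e he => hx (e.2 _ he)
    have h2 : ∀ b : CrossVertex θ pos, (x = b.1 ∨ x = θ b.1) ↔ b.1 = θ x := fun b => by
      constructor
      · rintro (rfl | rfl)
        · exact absurd b.2.1 hx
        · exact (h.invol _).symm
      · intro hh; right; rw [hh, h.invol]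
    simp only [h1, h2, if_false, Finset.sum_const_zero, zero_add]
    rfl

omit [DecidableEq V] [DecidableRel G.Adj] in
lemma prod_split {β : Type*} [CommMonoid β] (h : IsReflection v θ pos) (f : V → β) :
    ∏ x, f x = (∏ x with pos x, f x) * ∏ x with pos x, f (θ x) := by
  rw [← Finset.prod_filter_mul_prod_filter_not Finset.univ pos]
  congr 1
  refine Finset.prod_bij' (fun x _ => θ x) (fun x _ => θ x) ?_ ?_ ?_ ?_ ?_
  · intro x hx; simpa [h.pos_iff] using hx
  · intro x hx; simpa [h.pos_iff] using hx
  · intro x _; exact h.invol x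
  · intro x _; exact h.invol x
  · intro x _; rw [h.invol]

omit [DecidableEq V] [DecidableRel G.Adj] in
lemma sum_split {β : Type*} [AddCommMonoid β] (h : IsReflection v θ pos) (f : V → β) :
    ∑ x, f x = (∑ x with pos x, f x) + ∑ x with pos x, f (θ x) :=
  prod_split (β := Multiplicative β) h f

omit [Fintype V] [DecidableEq V] [DecidableRel G.Adj] in
lemma glue_pos {γ : Type*} (a a' : V → γ) {x : V} (hx : pos x) : glue θ pos a a' x = a x :=
  if_pos hx

omit [DecidableEq V] [DecidableRel G.Adj] in
lemma glue_reflect {γ : Type*} (h : IsReflection v θ pos) (a a' : V → γ) {x : V} (hx : pos x) :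
    glue θ pos a a' (θ x) = a' x := by
  rw [glue, if_neg (by rw [h.pos_iff, not_not]; exact hx), h.invol]

/-- The part of the moment that depends on one half only. -/
noncomputable def halfMoment (U : ℕ → ℝ≥0) (v : V → V → ℝ) (pos : V → Prop) [DecidablePred pos]
    (a : V → Fin N → ℕ) : ℝ :=
  (∏ x with pos x, ∏ i, (pairings (a x i) : ℝ)) * (∏ x with pos x, (U ((∑ i, a x i) / 2) : ℝ)) *
    Real.exp (-∑ x with pos x, ∑ y with pos y,
      v x y * ((∑ i, a x i) / 2 : ℕ) * ((∑ i, a y i) / 2 : ℕ))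

omit [DecidableEq V] [DecidableRel G.Adj] in
-- Pairing numbers and vertex weights factorise over vertices; only the interaction couples the
-- halves. Its two mixed blocks are equal by symmetry, whence the factor two in the exponent.
lemma moment_glue (U : ℕ → ℝ≥0) (h : IsReflection v θ pos) (a a' : V → Fin N → ℕ) :
    moment U v (glue θ pos a a') = halfMoment U v pos a * halfMoment U v pos a' *
      Real.exp (∑ x with pos x, ∑ y with pos y,
        -2 * v x (θ y) * ((∑ i, a x i) / 2 : ℕ) * ((∑ i, a' y i) / 2 : ℕ)) := by
  have hp : ∀ {β : Type} [CommMonoid β] (f : (Fin N → ℕ) → β),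
      ∏ x, f (glue θ pos a a' x) = (∏ x with pos x, f (a x)) * ∏ x with pos x, f (a' x) := by
    intro β _ f
    rw [prod_split h]
    congr 1
    · exact Finset.prod_congr rfl fun x hx => by rw [glue_pos _ _ (Finset.mem_filter.1 hx).2]
    · exact Finset.prod_congr rfl fun x hx => by rw [glue_reflect h _ _ (Finset.mem_filter.1 hx).2]
  have hs : ∑ x, ∑ y, v x y * ((∑ i, glue θ pos a a' x i) / 2 : ℕ) *
        ((∑ i, glue θ pos a a' y i) / 2 : ℕ) =
      (∑ x with pos x, ∑ y with pos y,
        v x y * ((∑ i, a x i) / 2 : ℕ) * ((∑ i, a y i) / 2 : ℕ)) +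
      (∑ x with pos x, ∑ y with pos y,
        v x y * ((∑ i, a' x i) / 2 : ℕ) * ((∑ i, a' y i) / 2 : ℕ)) +
      2 * ∑ x with pos x, ∑ y with pos y,
        v x (θ y) * ((∑ i, a x i) / 2 : ℕ) * ((∑ i, a' y i) / 2 : ℕ) := by
    simp only [sum_split h, Finset.sum_add_distrib]
    have h1 : ∑ x with pos x, ∑ y with pos y, v (θ x) y *
          ((∑ i, glue θ pos a a' (θ x) i) / 2 : ℕ) * ((∑ i, glue θ pos a a' y i) / 2 : ℕ) =
        ∑ x with pos x, ∑ y with pos y,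
          v x (θ y) * ((∑ i, a x i) / 2 : ℕ) * ((∑ i, a' y i) / 2 : ℕ) := by
      rw [Finset.sum_comm]
      refine Finset.sum_congr rfl fun x hx => Finset.sum_congr rfl fun y hy => ?_
      rw [glue_reflect h _ _ (Finset.mem_filter.1 hy).2, glue_pos _ _ (Finset.mem_filter.1 hx).2,
        h.symm (θ y) x]
      ring
    have h2 : ∑ x with pos x, ∑ y with pos y, v x (θ y) *
          ((∑ i, glue θ pos a a' x i) / 2 : ℕ) * ((∑ i, glue θ pos a a' (θ y) i) / 2 : ℕ) =
        ∑ x with pos x, ∑ y with pos y,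
          v x (θ y) * ((∑ i, a x i) / 2 : ℕ) * ((∑ i, a' y i) / 2 : ℕ) := by
      refine Finset.sum_congr rfl fun x hx => Finset.sum_congr rfl fun y hy => ?_
      rw [glue_reflect h _ _ (Finset.mem_filter.1 hy).2, glue_pos _ _ (Finset.mem_filter.1 hx).2]
    have h3 : ∑ x with pos x, ∑ y with pos y, v x y *
          ((∑ i, glue θ pos a a' x i) / 2 : ℕ) * ((∑ i, glue θ pos a a' y i) / 2 : ℕ) =
        ∑ x with pos x, ∑ y with pos y,
          v x y * ((∑ i, a x i) / 2 : ℕ) * ((∑ i, a y i) / 2 : ℕ) := by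
      refine Finset.sum_congr rfl fun x hx => Finset.sum_congr rfl fun y hy => ?_
      rw [glue_pos _ _ (Finset.mem_filter.1 hy).2, glue_pos _ _ (Finset.mem_filter.1 hx).2]
    have h4 : ∑ x with pos x, ∑ y with pos y, v (θ x) (θ y) *
          ((∑ i, glue θ pos a a' (θ x) i) / 2 : ℕ) * ((∑ i, glue θ pos a a' (θ y) i) / 2 : ℕ) =
        ∑ x with pos x, ∑ y with pos y,
          v x y * ((∑ i, a' x i) / 2 : ℕ) * ((∑ i, a' y i) / 2 : ℕ) := by
      refine Finset.sum_congr rfl fun x hx => Finset.sum_congr rfl fun y hy => ?_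
      rw [glue_reflect h _ _ (Finset.mem_filter.1 hy).2,
        glue_reflect h _ _ (Finset.mem_filter.1 hx).2, h.inv]
    rw [h1, h2, h3, h4]
    ring
  have hc : ∑ x with pos x, ∑ y with pos y,
        -2 * v x (θ y) * ((∑ i, a x i) / 2 : ℕ) * ((∑ i, a' y i) / 2 : ℕ) =
      -(2 * ∑ x with pos x, ∑ y with pos y,
        v x (θ y) * ((∑ i, a x i) / 2 : ℕ) * ((∑ i, a' y i) / 2 : ℕ)) := by
    simp only [Finset.mul_sum, ← Finset.sum_neg_distrib]
    refine Finset.sum_congr rfl fun x _ => Finset.sum_congr rfl fun y _ => by ring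
  rw [moment, vertexWeight, hs, hp (fun m => (U ((∑ i, m i) / 2) : ℝ)), hc, neg_add, neg_add,
    Real.exp_add, Real.exp_add]
  rw [Nat.cast_prod]
  simp only [Nat.cast_prod]
  rw [hp fun m => ∏ i, (pairings (m i) : ℝ)]
  simp only [halfMoment]
  ring

omit [DecidableEq V] [DecidableRel G.Adj] in
-- By the field `neg`, the coupling exponent of `moment_glue` is a positive semidefinite matrix in
-- the monomials. `posSemidef_exp` applies, with the half moments absorbed into the coefficients.
lemma moment_glue_kernel (U : ℕ → ℝ≥0) (h : IsReflection v θ pos) {ι : Type*} [Fintype ι]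
    (A : ι → V → Fin N → ℕ) (c : ι → ℝ) :
    0 ≤ ∑ p, ∑ q, c p * c q * moment U v (glue θ pos (A p) (A q)) := by
  have hpsd : (Matrix.of fun p q : ι => ∑ x with pos x, ∑ y with pos y,
        -2 * v x (θ y) * ((∑ i, A p x i) / 2 : ℕ) * ((∑ i, A q y i) / 2 : ℕ)).PosSemidef := by
    refine Matrix.PosSemidef.of_dotProduct_mulVec_nonneg ?_ fun d => ?_
    · ext p q
      simp only [Matrix.conjTranspose_apply, Matrix.of_apply, star_trivial]
      rw [Finset.sum_comm]
      refine Finset.sum_congr rfl fun x _ => Finset.sum_congr rfl fun y _ => ?_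
      have : v y (θ x) = v x (θ y) := by
        rw [← h.inv y (θ x), h.invol, h.symm]
      rw [this]
      ring
    · have hn := h.neg (fun x => if pos x then ∑ p, d p * ((∑ i, A p x i) / 2 : ℕ) else 0)
        fun x hx => if_neg hx
      have hn' : ∑ x with pos x, ∑ y with pos y, (∑ p, d p * ((∑ i, A p x i) / 2 : ℕ)) *
          (∑ p, d p * ((∑ i, A p y i) / 2 : ℕ)) * v x (θ y) ≤ 0 := by
        refine le_trans (le_of_eq ?_) hn
        rw [Finset.sum_filter]
        refine Finset.sum_congr rfl fun x _ => ?_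
        split_ifs
        · rw [Finset.sum_filter]
          refine Finset.sum_congr rfl fun y _ => ?_
          split_ifs <;> simp
        · simp
      have heq : star d ⬝ᵥ (Matrix.of fun p q : ι => ∑ x with pos x, ∑ y with pos y,
          -2 * v x (θ y) * ((∑ i, A p x i) / 2 : ℕ) * ((∑ i, A q y i) / 2 : ℕ)).mulVec d =
          -2 * ∑ x with pos x, ∑ y with pos y, (∑ p, d p * ((∑ i, A p x i) / 2 : ℕ)) *
          (∑ p, d p * ((∑ i, A p y i) / 2 : ℕ)) * v x (θ y) := by
        simp only [dotProduct, Matrix.mulVec, Pi.star_apply, star_trivial, Matrix.of_apply,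
          Finset.mul_sum, Finset.sum_mul]
        calc _ = ∑ p, ∑ x with pos x, ∑ q, ∑ y with pos y, d p * (-2 * v x (θ y) *
                  ((∑ i, A p x i) / 2 : ℕ) * ((∑ i, A q y i) / 2 : ℕ) * d q) :=
              Finset.sum_congr rfl fun p _ => Finset.sum_comm
          _ = ∑ x with pos x, ∑ p, ∑ q, ∑ y with pos y, d p * (-2 * v x (θ y) *
                  ((∑ i, A p x i) / 2 : ℕ) * ((∑ i, A q y i) / 2 : ℕ) * d q) := Finset.sum_comm
          _ = _ := by
              refine Finset.sum_congr rfl fun x _ => ?_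
              rw [Finset.sum_congr rfl fun p _ => Finset.sum_comm, Finset.sum_comm]
              refine Finset.sum_congr rfl fun y _ => ?_
              rw [Finset.sum_comm]
              exact Finset.sum_congr rfl fun p _ => Finset.sum_congr rfl fun q _ => by ring
      rw [heq]
      linarith
  have h2 := posSemidef_exp hpsd fun p => c p * halfMoment U v pos (A p)
  refine h2.trans_eq (Finset.sum_congr rfl fun p _ => Finset.sum_congr rfl fun q _ => ?_)
  rw [moment_glue U h, Matrix.of_apply]
  ring

end Reflection

/-! ### Operators on a half and the contact terms of their quadratic form -/

section Reflection

variable {V : Type} [Fintype V] [DecidableEq V] {G : SimpleGraph V} [DecidableRel G.Adj] {N : ℕ}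
  {v : V → V → ℝ} {θ : G ≃g G} {pos : V → Prop} [DecidablePred pos] {U : ℕ → ℝ≥0} {lam : ℝ}

/-- The inner product of two monomials of the positive half. -/
noncomputable def halfForm (U : ℕ → ℝ≥0) (v : V → V → ℝ) (lam : ℝ) (θ : G ≃g G) (pos : V → Prop)
    [DecidablePred pos] (a a' : V → Fin N → ℕ) : ℝ :=
  ∑' s : (PosEdge G pos → Fin N → ℕ) × (PosEdge G pos → Fin N → ℕ),
    linkWeight lam s.1 * linkWeight lam s.2 *
      moment U v (glue θ pos (posDegrees s.1 + a) (posDegrees s.2 + a'))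

omit [Fintype V] [DecidableEq V] [DecidableRel G.Adj] in
lemma glue_add (a a' b b' : V → Fin N → ℕ) :
    glue θ pos a a' + glue θ pos b b' = glue θ pos (a + b) (a' + b') := by
  funext x
  simp only [glue, Pi.add_apply]
  split_ifs <;> rfl

/-- Resolves a sum over all link numbers into the crossing ones and those of the two halves. The
factor `p` depends on the crossing links only and will be used to count them. -/
lemma summable_linksSplit (h : IsReflection v θ pos) (hc : Controlled U v) (hlam : 0 < lam)
    (a a' : V → Fin N → ℕ) {p : (CrossVertex θ pos → Fin N → ℕ) → ℝ} {C R : ℝ}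
    (hp0 : ∀ B, 0 ≤ p B) (hR : 1 ≤ R) (hC : 0 ≤ C) (hp : ∀ B, p B ≤ C * R ^ (∑ b, ∑ i, B b i)) :
    HasSum (fun q : (CrossVertex θ pos → Fin N → ℕ) ×
        (PosEdge G pos → Fin N → ℕ) × (PosEdge G pos → Fin N → ℕ) =>
      linkWeight lam q.1 * (p q.1 * (linkWeight lam q.2.1 * linkWeight lam q.2.2 *
        moment U v (glue θ pos (posDegrees q.2.1 + (crossDegrees q.1 + a))
          (posDegrees q.2.2 + (crossDegrees q.1 + a'))))))
      (∑' M : G.edgeSet → Fin N → ℕ, linkWeight lam M * (p (fun b => M (crossEdge b)) *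
        moment U v (degrees M + glue θ pos a a'))) := by
  have hcross : ∀ M : G.edgeSet → Fin N → ℕ,
      ∑ b : CrossVertex θ pos, ∑ i, M (crossEdge b) i ≤ ∑ e, ∑ i, M e i := by
    intro M
    have hinj : Function.Injective (crossEdge : CrossVertex θ pos → G.edgeSet) := by
      intro b b' hb
      have := (edgeSplit_bijective ⟨v, h⟩).1 (a₁ := .inr (.inr b)) (a₂ := .inr (.inr b')) hb
      simpa using this
    calc ∑ b : CrossVertex θ pos, ∑ i, M (crossEdge b) i
        = ∑ e ∈ Finset.univ.map ⟨_, hinj⟩, ∑ i, M e i := by rw [Finset.sum_map]; rfl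
      _ ≤ _ := Finset.sum_le_sum_of_subset (Finset.subset_univ _)
  have hs := summable_correlation (G := G) hc hlam (glue θ pos a a')
    (p := fun M => p fun b => M (crossEdge b)) (C := C) (R := R) (fun M => hp0 _) hR fun M =>
      (hp _).trans (mul_le_mul_of_nonneg_left (pow_le_pow_right₀ hR (hcross M)) hC)
  have h1 := (linksSplit (N := N) ⟨v, h⟩).hasSum_iff.2 hs.hasSum
  refine h1.congr_fun fun q => ?_
  have hq : (fun b => linksSplit ⟨v, h⟩ q (crossEdge b)) = q.1 := by
    funext b
    exact linksSplit_apply ⟨v, h⟩ q (.inr (.inr b))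
  simp only [Function.comp_apply, hq, linkWeight_linksSplit, degrees_linksSplit, glue_add, add_assoc]
  ring

omit [Fintype V] [DecidableRel G.Adj] [DecidablePred pos] in
lemma crossDegrees_zero [Fintype (CrossVertex θ pos)] : (fun (x : V) (i : Fin N) =>
    ∑ b : CrossVertex θ pos, if b.1 = x then (0 : CrossVertex θ pos → Fin N → ℕ) b i else 0) = 0 := by
  funext x i; simp

/-- This is the slice of the preceding family without crossing links, where the crossing weight is
one and the crossing degrees vanish; `a` and `a'` are arbitrary, so it covers every other slice as
well. -/
lemma summable_halfForm (h : IsReflection v θ pos) (hc : Controlled U v) (hlam : 0 < lam)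
    (a a' : V → Fin N → ℕ) :
    Summable fun s : (PosEdge G pos → Fin N → ℕ) × (PosEdge G pos → Fin N → ℕ) =>
      linkWeight lam s.1 * linkWeight lam s.2 *
        moment U v (glue θ pos (posDegrees s.1 + a) (posDegrees s.2 + a')) := by
  have h1 := (summable_linksSplit h hc hlam a a' (p := fun _ => 1) (C := 1) (R := 1)
    (fun _ => zero_le_one) le_rfl zero_le_one (by simp)).summable.prod_factor
      (0 : CrossVertex θ pos → Fin N → ℕ)
  have h0 : crossDegrees (0 : CrossVertex θ pos → Fin N → ℕ) = 0 := crossDegrees_zero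
  simpa [h0, linkWeight] using h1

/-- Conditioning on the crossing links `B` writes a correlation as a combination, with positive link
weights, of inner products in which both halves carry the same additional monomial. -/
lemma hasSum_cross (h : IsReflection v θ pos) (hc : Controlled U v) (hlam : 0 < lam)
    (a a' : V → Fin N → ℕ) {p : (CrossVertex θ pos → Fin N → ℕ) → ℝ} {C R : ℝ}
    (hp0 : ∀ B, 0 ≤ p B) (hR : 1 ≤ R) (hC : 0 ≤ C) (hp : ∀ B, p B ≤ C * R ^ (∑ b, ∑ i, B b i)) :
    HasSum (fun B : CrossVertex θ pos → Fin N → ℕ => linkWeight lam B *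
        (p B * halfForm U v lam θ pos (crossDegrees B + a) (crossDegrees B + a')))
      (∑' M : G.edgeSet → Fin N → ℕ, linkWeight lam M * (p (fun b => M (crossEdge b)) *
        moment U v (degrees M + glue θ pos a a'))) := by
  refine (summable_linksSplit h hc hlam a a' hp0 hR hC hp).prod_fiberwise fun B => ?_
  exact ((summable_halfForm h hc hlam _ _).hasSum.mul_left _).mul_left _

/-- The double series is the limit of its partial sums over squares `F ×ˢ F`, and each of these is
an instance of `moment_glue_kernel` with index set `F × S`. -/
lemma halfForm_kernel (h : IsReflection v θ pos) (hc : Controlled U v) (hlam : 0 < lam)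
    {S : Type*} [Fintype S] (a : S → V → Fin N → ℕ) (c : S → ℝ) :
    0 ≤ ∑ s, ∑ t, c s * c t * halfForm U v lam θ pos (a s) (a t) := by
  have hsum : HasSum (fun q : (PosEdge G pos → Fin N → ℕ) × (PosEdge G pos → Fin N → ℕ) =>
      ∑ s, ∑ t, c s * c t * (linkWeight lam q.1 * linkWeight lam q.2 *
        moment U v (glue θ pos (posDegrees q.1 + a s) (posDegrees q.2 + a t))))
      (∑ s, ∑ t, c s * c t * halfForm U v lam θ pos (a s) (a t)) :=
    hasSum_sum fun s _ => hasSum_sum fun t _ => (summable_halfForm h hc hlam _ _).hasSum.mul_left _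
  have ht : Tendsto (fun F : Finset (PosEdge G pos → Fin N → ℕ) => F ×ˢ F) atTop atTop :=
    tendsto_finsetProd_atTop.comp (tendsto_id.prodMk tendsto_id |>.mono_right
      prod_atTop_atTop_eq.le)
  refine ge_of_tendsto' (hsum.comp ht) fun F => ?_
  have hk := moment_glue_kernel U h (fun p : F × S => posDegrees p.1.1 + a p.2)
    fun p => linkWeight lam p.1.1 * c p.2
  refine hk.trans_eq ?_
  simp only [Function.comp_apply, Finset.sum_product, Fintype.sum_prod_type,
    ← Finset.sum_coe_sort F]
  refine Finset.sum_congr rfl fun σ _ => ?_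
  rw [Finset.sum_comm]
  refine Finset.sum_congr rfl fun σ' _ => Finset.sum_congr rfl fun s _ =>
    Finset.sum_congr rfl fun t _ => by ring

/-- One link of each of the first two colours at a cross vertex. -/
def crossUnit (b : CrossVertex θ pos) : CrossVertex θ pos → Fin N → ℕ :=
  fun b' i => if b' = b ∧ (i : ℕ) < 2 then 1 else 0

lemma crossDegrees_add_unit (B : CrossVertex θ pos → Fin N → ℕ) (b : CrossVertex θ pos) :
    crossDegrees (B + crossUnit b) = crossDegrees B + insertion N b.1 := by
  funext x i
  simp only [crossDegrees, Pi.add_apply, insertion]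
  have : ∀ b' : CrossVertex θ pos, (if b'.1 = x then B b' i + crossUnit b b' i else 0) =
      (if b'.1 = x then B b' i else 0) + if b' = b then (if b.1 = x ∧ (i : ℕ) < 2 then 1 else 0)
        else 0 := by
    intro b'
    by_cases h1 : b' = b
    · subst h1; simp only [crossUnit, true_and, if_true]; split_ifs <;> simp_all
    · simp only [crossUnit, h1, false_and, if_false, add_zero]
  simp only [this, Finset.sum_add_distrib, Finset.sum_ite_eq', Finset.mem_univ, if_true]
  congr 1
  simp only [eq_comm]

lemma prod_two_colours {E : Type*} [Fintype E] [DecidableEq E] (hN : 1 < N) (b : E)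
    (X : E → Fin N → ℝ) :
    ∏ b', ∏ i : Fin N, (if b' = b ∧ (i : ℕ) < 2 then X b' i else 1) =
      X b ⟨0, by omega⟩ * X b ⟨1, hN⟩ := by
  rw [Finset.prod_eq_single b, ← Finset.prod_subset (Finset.subset_univ
    {(⟨0, by omega⟩ : Fin N), ⟨1, hN⟩}), Finset.prod_pair (by simp)]
  · simp
  · intro i _ hi
    simp only [Finset.mem_insert, Finset.mem_singleton, Fin.ext_iff, not_or] at hi
    rw [if_neg (by omega)]
  · intro b' _ hb'
    simp [hb']
  · intro h; exact absurd (Finset.mem_univ b) h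

lemma linkWeight_add_unit (hN : 1 < N) (lam : ℝ)
    (B : CrossVertex θ pos → Fin N → ℕ) (b : CrossVertex θ pos) :
    linkWeight lam (B + crossUnit b) *
      (((B b ⟨0, by omega⟩ + 1 : ℕ) : ℝ) * ((B b ⟨1, hN⟩ + 1 : ℕ) : ℝ)) =
    lam ^ 2 * linkWeight lam B := by
  rw [sq, ← prod_two_colours hN b fun b' i => ((B b' i + 1 : ℕ) : ℝ),
    ← prod_two_colours hN b fun _ _ => lam]
  simp only [linkWeight, ← Finset.prod_mul_distrib]
  refine Finset.prod_congr rfl fun b' _ => Finset.prod_congr rfl fun i _ => ?_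
  simp only [Pi.add_apply, crossUnit]
  split_ifs
  · rw [pow_succ, Nat.factorial_succ]
    have h1 : ((B b' i).factorial : ℝ) ≠ 0 := by positivity
    have h2 : ((B b' i + 1 : ℕ) : ℝ) ≠ 0 := by positivity
    push_cast at h2 ⊢
    field_simp
  · simp

/-- Differentiation of an exponential series: the factor `B₁ B₂` cancels against the factorials, and
the shift by one link of each of the two colours leaves `lam ^ 2`. Outside the range of the shift
one of the two link numbers is zero. -/
lemma hasSum_shift (hN : 1 < N) (b : CrossVertex θ pos)
    {f : (CrossVertex θ pos → Fin N → ℕ) → ℝ} {S : ℝ}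
    (hf : HasSum (fun B => linkWeight lam B * f (B + crossUnit b)) S) :
    HasSum (fun B : CrossVertex θ pos → Fin N → ℕ => linkWeight lam B *
      (((B b ⟨0, by omega⟩ : ℝ) * (B b ⟨1, hN⟩ : ℝ)) * f B)) (lam ^ 2 * S) := by
  have hinj : Function.Injective fun B : CrossVertex θ pos → Fin N → ℕ => B + crossUnit b :=
    fun B B' hB => add_right_cancel hB
  have hu : ∀ (B : CrossVertex θ pos → Fin N → ℕ) (i : Fin N), (i : ℕ) < 2 →
      (B + crossUnit b : CrossVertex θ pos → Fin N → ℕ) b i = B b i + 1 :=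
    fun B i hi => by simp [crossUnit, hi]
  rw [← hinj.hasSum_iff]
  · refine (hf.mul_left (lam ^ 2)).congr_fun fun B => ?_
    simp only [Function.comp_apply]
    rw [← mul_assoc, hu B ⟨0, by omega⟩ two_pos, hu B ⟨1, hN⟩ one_lt_two,
      linkWeight_add_unit hN, mul_assoc]
  · intro B hB
    by_contra hne
    refine hB ⟨B - crossUnit b, ?_⟩
    have h0 : B b ⟨0, by omega⟩ ≠ 0 := fun h => hne (by simp [h])
    have h1 : B b ⟨1, hN⟩ ≠ 0 := fun h => hne (by simp [h])
    funext b' i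
    simp only [Pi.add_apply, Pi.sub_apply, crossUnit]
    split_ifs with hb
    · obtain ⟨rfl, hi⟩ := hb
      have : B b' i ≠ 0 := by
        obtain ⟨_ | _ | i, hi'⟩ := i
        · exact h0
        · exact h1
        · exact absurd hi (by simp)
      omega
    · simp

/-- The operators whose quadratic form is considered: multiplication by the first two spin
components at a vertex, or differentiation with respect to them at a cross vertex. -/
abbrev HalfOp (θ : G ≃g G) (pos : V → Prop) : Type := {x : V // pos x} ⊕ CrossVertex θ pos

/-- The coefficients of the operators. -/
noncomputable def opCoeff (hN : 1 < N) (lam : ℝ) (r g : V → ℝ)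
    (B : CrossVertex θ pos → Fin N → ℕ) : HalfOp θ pos → ℝ
  | .inl x => lam * r x
  -- The product of link numbers arises from differentiating the crossing monomial in two
  -- components. After the factor `lam ^ 2` of `hasSum_shift`, the prefactor becomes `lam * g b`, on
  -- the same footing as the multiplication operators.
  | .inr b => g b * lam⁻¹ * ((B b ⟨0, by omega⟩ : ℝ) * (B b ⟨1, hN⟩ : ℝ))

/-- The monomials on the positive half produced by the operators. -/
def opMonomial (B : CrossVertex θ pos → Fin N → ℕ) : HalfOp θ pos → V → Fin N → ℕ
  | .inl x => crossDegrees B + insertion N x.1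
  | .inr b => crossDegrees (B - crossUnit b)

/-- The matrix elements of the operators. -/
noncomputable def opForm (hN : 1 < N) (U : ℕ → ℝ≥0) (v : V → V → ℝ) (lam : ℝ) (r g : V → ℝ) :
    HalfOp θ pos → HalfOp θ pos → ℝ
  | .inl x, .inl y =>
      lam ^ 2 * (r x * r y) * correlation G U v lam (insertion N x.1 + insertion N (θ y.1))
  | .inl x, .inr b =>
      lam ^ 2 * (r x * g b) * correlation G U v lam (insertion N x.1 + insertion N b.1)
  | .inr b, .inl x =>
      lam ^ 2 * (r x * g b) * correlation G U v lam (insertion N x.1 + insertion N b.1)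
  | .inr b, .inr b' =>
      lam ^ 2 * (g b * g b') * correlation G U v lam (insertion N b.1 + insertion N (θ b'.1)) +
        if b = b' then g b ^ 2 * (correlation G U v lam (0 : V → Fin N → ℕ) +
          2 * linkSum G U v lam (crossEdge b) (⟨0, by omega⟩ : Fin N)) else 0

omit [Fintype V] [DecidableRel G.Adj] in
lemma glue_insertion (hinv : ∀ x, θ (θ x) = x) {x y : V} (hx : pos x) (hy : pos y)
    (hneg : ∀ x, pos (θ x) ↔ ¬ pos x) :
    glue θ pos (insertion N x) (insertion N y) = insertion N x + insertion N (θ y) := by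
  funext z i
  simp only [glue, Pi.add_apply]
  by_cases hz : pos z
  · have h1 : z ≠ θ y := fun h => (hneg y).1 (h ▸ hz) hy
    simp [hz, insertion, h1]
  · have h1 : z ≠ x := fun h => hz (h ▸ hx)
    have h2 : θ z = y ↔ z = θ y := ⟨fun h => by rw [← h, hinv], fun h => by rw [h, hinv]⟩
    simp [hz, insertion, h1, h2]

lemma hasSum_cross_one (h : IsReflection v θ pos) (hc : Controlled U v) (hlam : 0 < lam)
    (a a' : V → Fin N → ℕ) :
    HasSum (fun B : CrossVertex θ pos → Fin N → ℕ => linkWeight lam B *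
        halfForm U v lam θ pos (crossDegrees B + a) (crossDegrees B + a'))
      (correlation G U v lam (glue θ pos a a')) := by
  have := hasSum_cross h hc hlam a a' (p := fun _ => 1) (C := 1) (R := 1)
    (fun _ => zero_le_one) le_rfl zero_le_one (by simp)
  simpa [correlation] using this

lemma hasSum_cross_link (h : IsReflection v θ pos) (hc : Controlled U v) (hlam : 0 < lam)
    (b : CrossVertex θ pos) (i : Fin N) :
    HasSum (fun B : CrossVertex θ pos → Fin N → ℕ => linkWeight lam B *
        ((B b i : ℝ) * halfForm U v lam θ pos (crossDegrees B) (crossDegrees B)))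
      (linkSum G U v lam (crossEdge b) i) := by
  have := hasSum_cross h hc hlam 0 0 (p := fun B => (B b i : ℝ)) (C := 1) (R := 2)
    (fun _ => Nat.cast_nonneg _) one_le_two zero_le_one fun B => by
      have h1 : B b i ≤ ∑ b, ∑ i, B b i :=
        (Finset.single_le_sum (f := fun i => B b i) (fun _ _ => Nat.zero_le _)
          (Finset.mem_univ i)).trans (Finset.single_le_sum (f := fun b => ∑ i, B b i)
          (fun _ _ => Nat.zero_le _) (Finset.mem_univ b))
      rw [one_mul]
      exact_mod_cast h1.trans Nat.lt_two_pow_self.le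
  have h0 : glue θ pos (0 : V → Fin N → ℕ) 0 = 0 := by
    funext x; simp [glue]
  simpa [linkSum, h0] using this

lemma _root_.HasSum.congr_value {β : Type*} {f : β → ℝ} {S S' : ℝ} (hf : HasSum f S)
    (h : S = S') : HasSum f S' := h ▸ hf

/-- Each derivative at a crossing vertex on one half is turned by `hasSum_shift` into an insertion
at that edge on the opposite half. A mixed term therefore has both insertions on the same half, and
two derivatives at different edges exchange their halves. Two derivatives at the same edge
interfere, since the first shift changes the link numbers that the second one sees. -/
lemma hasSum_opForm (h : IsReflection v θ pos) (hc : Controlled U v) (hlam : 0 < lam)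
    (hN : 1 < N) (r g : V → ℝ) (s t : HalfOp θ pos) :
    HasSum (fun B : CrossVertex θ pos → Fin N → ℕ => linkWeight lam B *
        (opCoeff hN lam r g B s * opCoeff hN lam r g B t *
          halfForm U v lam θ pos (opMonomial B s) (opMonomial B t)))
      (opForm hN U v lam r g s t) := by
  have hne : lam ≠ 0 := hlam.ne'
  have hglue0 : ∀ a : V → Fin N → ℕ, correlation G U v lam (glue θ pos 0 a) =
      correlation G U v lam (glue θ pos a 0) := by
    intro a
    rw [← correlation_map U lam θ h.inv]
    congr 1
    funext x
    simp only [glue, h.pos_iff, h.invol]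
    split_ifs <;> simp_all
  have hglue1 : ∀ x y, pos x → pos y → glue θ pos (insertion N x + insertion N y) 0 =
      insertion N x + insertion N y := by
    intro x y hx hy
    funext z i
    simp only [glue, Pi.add_apply]
    split_ifs with hz
    · rfl
    · have h1 : z ≠ x := fun h => hz (h ▸ hx)
      have h2 : z ≠ y := fun h => hz (h ▸ hy)
      simp [insertion, h1, h2]
  have hone := hasSum_cross_one (N := N) h hc hlam
  rcases s with x | b <;> rcases t with y | b' <;> simp only [opCoeff, opMonomial, opForm]
  · have h1 := (hone (insertion N x.1) (insertion N y.1)).mul_left (lam ^ 2 * (r x * r y))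
    rw [glue_insertion h.invol x.2 y.2 h.pos_iff] at h1
    exact h1.congr_fun fun B => by ring
  · have h1 := hone (insertion N x.1 + insertion N b'.1) 0
    rw [hglue1 x b' x.2 b'.2.1] at h1
    have h2 := (hasSum_shift hN b' (f := fun B => halfForm U v lam θ pos
      (crossDegrees B + insertion N x.1) (crossDegrees (B - crossUnit b'))) (h1.congr_fun fun B => by
        rw [add_tsub_cancel_right, crossDegrees_add_unit, add_zero, add_assoc,
          add_comm (insertion N b'.1)])).mul_left (r x * g b')
    have h3 := h2.congr_fun (g := fun B => linkWeight lam B * (lam * r x * (g b' * lam⁻¹ *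
      ((B b' ⟨0, by omega⟩ : ℝ) * (B b' ⟨1, hN⟩ : ℝ))) * halfForm U v lam θ pos
      (crossDegrees B + insertion N x.1) (crossDegrees (B - crossUnit b')))) fun B => by
        field_simp
    have hv : r x * g b' * (lam ^ 2 * correlation G U v lam
        (insertion N x.1 + insertion N b'.1)) = lam ^ 2 * (r x * g b') * correlation G U v lam
        (insertion N x.1 + insertion N b'.1) := by ring
    exact hv ▸ h3
  · have h1 := hone 0 (insertion N y.1 + insertion N b.1)
    rw [hglue0, hglue1 y b y.2 b.2.1] at h1
    have h2 := (hasSum_shift hN b (f := fun B => halfForm U v lam θ pos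
      (crossDegrees (B - crossUnit b)) (crossDegrees B + insertion N y.1)) (h1.congr_fun fun B => by
        rw [add_tsub_cancel_right, crossDegrees_add_unit, add_zero, add_assoc,
          add_comm (insertion N b.1)])).mul_left (r y * g b)
    have h3 := h2.congr_fun (g := fun B => linkWeight lam B * (g b * lam⁻¹ *
      ((B b ⟨0, by omega⟩ : ℝ) * (B b ⟨1, hN⟩ : ℝ)) * (lam * r y) * halfForm U v lam θ pos
      (crossDegrees (B - crossUnit b)) (crossDegrees B + insertion N y.1))) fun B => by
        field_simp
    have hv : r y * g b * (lam ^ 2 * correlation G U v lam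
        (insertion N y.1 + insertion N b.1)) = lam ^ 2 * (r y * g b) * correlation G U v lam
        (insertion N y.1 + insertion N b.1) := by ring
    exact hv ▸ h3
  · by_cases hb : b = b'
    · subst hb
      rw [if_pos rfl]
      have h1 := hone 0 0
      have h10 : glue θ pos (0 : V → Fin N → ℕ) 0 = 0 := by funext x; simp [glue]
      rw [h10] at h1
      have h2 := hone (insertion N b.1) (insertion N b.1)
      rw [glue_insertion h.invol b.2.1 b.2.1 h.pos_iff] at h2
      have h3 := hasSum_shift hN b (f := fun B => halfForm U v lam θ pos
        (crossDegrees B) (crossDegrees B)) (h2.congr_fun fun B => by rw [crossDegrees_add_unit])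
      -- The four terms of `(B₁ + 1)(B₂ + 1)`: the constant and the linear ones form the contact
      -- term, while `B₁ B₂` is shifted once more and gives the correlation.
      have h4 := ((h1.add (hasSum_cross_link h hc hlam b ⟨0, by omega⟩)).add
        (hasSum_cross_link h hc hlam b ⟨1, hN⟩)).add h3
      have h5 := (hasSum_shift hN b (f := fun B =>
        ((B b ⟨0, by omega⟩ : ℝ) * (B b ⟨1, hN⟩ : ℝ)) * halfForm U v lam θ pos
        (crossDegrees (B - crossUnit b)) (crossDegrees (B - crossUnit b)))
        (h4.congr_fun fun B => by
          have hu : ∀ (i : Fin N), (i : ℕ) < 2 →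
              (B + crossUnit b : CrossVertex θ pos → Fin N → ℕ) b i = B b i + 1 :=
            fun i hi => by simp [crossUnit, hi]
          rw [add_tsub_cancel_right, hu ⟨0, by omega⟩ two_pos, hu ⟨1, hN⟩ one_lt_two]
          push_cast
          simp only [add_zero]
          ring)).mul_left (g b * g b * (lam⁻¹) ^ 2)
      have h6 := h5.congr_fun (g := fun B => linkWeight lam B * (g b * lam⁻¹ *
        ((B b ⟨0, by omega⟩ : ℝ) * (B b ⟨1, hN⟩ : ℝ)) * (g b * lam⁻¹ *
        ((B b ⟨0, by omega⟩ : ℝ) * (B b ⟨1, hN⟩ : ℝ))) * halfForm U v lam θ pos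
        (crossDegrees (B - crossUnit b)) (crossDegrees (B - crossUnit b)))) fun B => by ring
      rw [linkSum_colour U v lam (crossEdge b) ⟨1, hN⟩ ⟨0, by omega⟩] at h6
      refine HasSum.congr_value h6 ?_
      field_simp
      ring
    · rw [if_neg hb, add_zero]
      -- The two shifts leave the vertices `b` and `b'` interchanged between the halves; reflection
      -- invariance of the correlation restores them.
      have h1 := hone (insertion N b'.1) (insertion N b.1)
      rw [glue_insertion h.invol b'.2.1 b.2.1 h.pos_iff, add_comm,
        ← correlation_insertion_map U lam θ h.inv, h.invol] at h1
      have h2 := hasSum_shift hN b' (f := fun B => halfForm U v lam θ pos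
        (crossDegrees B) (crossDegrees (B + crossUnit b - crossUnit b'))) (h1.congr_fun fun B => by
          rw [add_right_comm, add_tsub_cancel_right, crossDegrees_add_unit, crossDegrees_add_unit])
      have hu : ∀ (B : CrossVertex θ pos → Fin N → ℕ) (i : Fin N),
          (B + crossUnit b : CrossVertex θ pos → Fin N → ℕ) b' i = B b' i := fun B i => by simp [crossUnit, Ne.symm hb]
      have h3 := (hasSum_shift hN b (f := fun B =>
        ((B b' ⟨0, by omega⟩ : ℝ) * (B b' ⟨1, hN⟩ : ℝ)) * halfForm U v lam θ pos
        (crossDegrees (B - crossUnit b)) (crossDegrees (B - crossUnit b')))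
        (h2.congr_fun fun B => by rw [add_tsub_cancel_right, hu, hu])).mul_left
          (g b * g b' * (lam⁻¹) ^ 2)
      have h4 := h3.congr_fun (g := fun B => linkWeight lam B * (g b * lam⁻¹ *
        ((B b ⟨0, by omega⟩ : ℝ) * (B b ⟨1, hN⟩ : ℝ)) * (g b' * lam⁻¹ *
        ((B b' ⟨0, by omega⟩ : ℝ) * (B b' ⟨1, hN⟩ : ℝ))) * halfForm U v lam θ pos
        (crossDegrees (B - crossUnit b)) (crossDegrees (B - crossUnit b')))) fun B => by ring
      refine HasSum.congr_value h4 ?_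
      field_simp

/-- Reflection positivity for the model with the inserted operators. -/
theorem opForm_nonneg (h : IsReflection v θ pos) (hc : Controlled U v) (hlam : 0 < lam)
    (hN : 1 < N) (r g : V → ℝ) :
    0 ≤ ∑ s : HalfOp θ pos, ∑ t : HalfOp θ pos, opForm hN U v lam r g s t := by
  have hsum : HasSum (fun B : CrossVertex θ pos → Fin N → ℕ => ∑ s : HalfOp θ pos,
      ∑ t : HalfOp θ pos, linkWeight lam B *
        (opCoeff hN lam r g B s * opCoeff hN lam r g B t *
          halfForm U v lam θ pos (opMonomial B s) (opMonomial B t)))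
      (∑ s : HalfOp θ pos, ∑ t : HalfOp θ pos, opForm hN U v lam r g s t) :=
    hasSum_sum fun s _ => hasSum_sum fun t _ => hasSum_opForm h hc hlam hN r g s t
  refine hsum.nonneg fun B => ?_
  simp only [← Finset.mul_sum]
  exact mul_nonneg (linkWeight_nonneg hlam B) (halfForm_kernel h hc hlam _ _)

end Reflection

/-! ### Gaussian domination for quadratic forms -/

section Quadratic

variable {V : Type} [Fintype V] {G : SimpleGraph V} [DecidableRel G.Adj]

/-- The Laplacian of the graph. -/
def lap (G : SimpleGraph V) [DecidableRel G.Adj] (h : V → ℝ) (x : V) : ℝ :=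
  ∑ y, if G.Adj x y then h y - h x else 0

lemma lap_add (h h' : V → ℝ) : lap G (h + h') = lap G h + lap G h' := by
  funext x
  simp only [lap, Pi.add_apply, ← Finset.sum_add_distrib]
  refine Finset.sum_congr rfl fun y _ => ?_
  split_ifs <;> ring

lemma lap_comp (τ : G ≃g G) (h : V → ℝ) : lap G (h ∘ τ) = lap G h ∘ τ := by
  funext x
  simp only [lap, Function.comp_apply]
  symm
  rw [← Equiv.sum_comp τ.toEquiv]
  refine Finset.sum_congr rfl fun y _ => ?_
  have : G.Adj (τ x) (τ.toEquiv y) ↔ G.Adj x y := τ.map_adj_iff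
  by_cases hxy : G.Adj x y
  · rw [if_pos hxy, if_pos (this.2 hxy)]; rfl
  · rw [if_neg hxy, if_neg (mt this.1 hxy)]

/-- The difference of the form `⟨Δh, Γ Δh'⟩` and the Dirichlet form with conductances `c`. -/
noncomputable def quad (G : SimpleGraph V) [DecidableRel G.Adj] (Γ c : V → V → ℝ)
    (h h' : V → ℝ) : ℝ :=
  (∑ x, ∑ y, Γ x y * (lap G h x * lap G h' y)) -
    2⁻¹ * ∑ x, ∑ y, c x y * ((h x - h y) * (h' x - h' y))

variable {Γ c : V → V → ℝ}

lemma quad_add_left (h h' k : V → ℝ) :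
    quad G Γ c (h + h') k = quad G Γ c h k + quad G Γ c h' k := by
  simp only [quad, lap_add, Pi.add_apply]
  have h1 : ∀ x y, Γ x y * ((lap G h x + lap G h' x) * lap G k y) =
    Γ x y * (lap G h x * lap G k y) + Γ x y * (lap G h' x * lap G k y) := fun x y => by ring
  have h2 : ∀ x y, c x y * ((h x + h' x - (h y + h' y)) * (k x - k y)) =
    c x y * ((h x - h y) * (k x - k y)) + c x y * ((h' x - h' y) * (k x - k y)) :=
    fun x y => by ring
  simp only [h1, h2, Finset.sum_add_distrib]
  ring

lemma quad_sub_left (h h' k : V → ℝ) :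
    quad G Γ c (h - h') k = quad G Γ c h k - quad G Γ c h' k := by
  have := quad_add_left (G := G) (Γ := Γ) (c := c) (h - h') h' k
  rw [sub_add_cancel] at this
  linarith

lemma quad_comm (hΓ : ∀ x y, Γ x y = Γ y x) (h h' : V → ℝ) :
    quad G Γ c h h' = quad G Γ c h' h := by
  simp only [quad]
  congr 1
  · rw [Finset.sum_comm]
    refine Finset.sum_congr rfl fun x _ => Finset.sum_congr rfl fun y _ => ?_
    rw [hΓ y x]; ring
  · congr 1
    refine Finset.sum_congr rfl fun x _ => Finset.sum_congr rfl fun y _ => ?_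
    ring

lemma quad_comp (τ : G ≃g G) (hΓ : ∀ x y, Γ (τ x) (τ y) = Γ x y)
    (hc : ∀ x y, c (τ x) (τ y) = c x y) (h h' : V → ℝ) :
    quad G Γ c (h ∘ τ) (h' ∘ τ) = quad G Γ c h h' := by
  simp only [quad, lap_comp]
  congr 1
  · symm
    rw [← Equiv.sum_comp τ.toEquiv]
    refine Finset.sum_congr rfl fun x _ => ?_
    rw [← Equiv.sum_comp τ.toEquiv]
    refine Finset.sum_congr rfl fun y _ => ?_
    change Γ (τ x) (τ y) * _ = _
    rw [hΓ]; rfl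
  · congr 1
    symm
    rw [← Equiv.sum_comp τ.toEquiv]
    refine Finset.sum_congr rfl fun x _ => ?_
    rw [← Equiv.sum_comp τ.toEquiv]
    refine Finset.sum_congr rfl fun y _ => ?_
    change c (τ x) (τ y) * _ = _
    rw [hc]; rfl

/-- An involution of the graph through edges with respect to which the quadratic form is
reflection positive. -/
structure ReflectsForm (Γ c : V → V → ℝ) (θ : G ≃g G) (pos : V → Prop) : Prop where
  invol : ∀ x, θ (θ x) = x
  pos_iff : ∀ x, pos (θ x) ↔ ¬ pos x
  cross : ∀ x y, G.Adj x y → pos x → ¬ pos y → y = θ x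
  inv : ∀ x y, Γ (θ x) (θ y) = Γ x y
  conductance : ∀ x y, c (θ x) (θ y) = c x y
  -- On the positive half `H` is free, as the multiplication operators are. On the other half its
  -- values are forced by `g`, in the same way as those of the Laplacian of a function supported on
  -- the positive half.
  nonneg : ∀ (H g : V → ℝ), (∀ x, ¬ pos x → H x = if G.Adj x (θ x) then g (θ x) else 0) →
    (∀ x, ¬ pos x → g x = 0) →
    0 ≤ ∑ x, ∑ y, Γ x y * (H x * H (θ y)) + ∑ x, c x (θ x) * g x ^ 2

/-- A vertex outside the positive half has at most one neighbour inside, namely its mirror image,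
and `u` vanishes at all other neighbours. -/
lemma ReflectsForm.lap_eq {θ : G ≃g G} {pos : V → Prop} (h : ReflectsForm Γ c θ pos)
    (u : V → ℝ) (hu : ∀ x, ¬ pos x → u x = 0) (x : V) (hx : ¬ pos x) :
    lap G u x = if G.Adj x (θ x) then u (θ x) else 0 := by
  classical
  rw [lap]
  have h6 : ∀ y, (if G.Adj x y then u y - u x else 0) =
      if y = θ x then (if G.Adj x (θ x) then u (θ x) else 0) else 0 := by
    intro y
    rw [hu x hx, sub_zero]
    by_cases hy : y = θ x
    · subst hy; simp
    · rw [if_neg hy]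
      split_ifs with hadj
      · by_contra hne
        have hpy : pos y := by
          by_contra hny
          exact hne (hu y hny)
        have := h.cross y x hadj.symm hpy hx
        exact hy (by rw [this, h.invol])
      · rfl
  simp only [h6, Finset.sum_ite_eq', Finset.mem_univ, if_true]

/-- The supports of `u` and `u ∘ θ` are disjoint, so the Dirichlet form retains only products over
crossing edges. The conductances `c` need not be those of the reflection hypothesis, which allows a
small multiple of the graph to be added. -/
lemma ReflectsForm.quad_eq {θ : G ≃g G} {pos : V → Prop} {Γ' c' : V → V → ℝ}
    (h : ReflectsForm Γ' c' θ pos) (hc : ∀ x y, ¬ G.Adj x y → c x y = 0)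
    (hcs : ∀ x y, c x y = c y x) (u : V → ℝ) (hu : ∀ x, ¬ pos x → u x = 0) :
    quad G Γ c u (u ∘ θ) =
      ∑ x, ∑ y, Γ x y * (lap G u x * lap G u (θ y)) + ∑ x, c x (θ x) * u x ^ 2 := by
  classical
  simp only [quad, lap_comp, Function.comp_apply]
  rw [sub_eq_add_neg]
  congr 1
  have h2 : ∀ x, u x * u (θ x) = 0 := fun x => by
    by_cases hx : pos x
    · rw [hu (θ x) (by rw [h.pos_iff, not_not]; exact hx), mul_zero]
    · rw [hu x hx, zero_mul]
  have h3 : ∀ x y, c x y * ((u x - u y) * (u (θ x) - u (θ y))) =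
      - (c x y * (u x * u (θ y))) - c y x * (u y * u (θ x)) := fun x y => by
    rw [hcs y x]
    linear_combination c x y * h2 x + c x y * h2 y
  have h4 : ∑ x, ∑ y, c y x * (u y * u (θ x)) = ∑ x, ∑ y, c x y * (u x * u (θ y)) :=
    Finset.sum_comm
  simp only [h3, Finset.sum_sub_distrib, Finset.sum_neg_distrib, h4]
  have h5 : ∀ x, ∑ y, c x y * (u x * u (θ y)) = c x (θ x) * u x ^ 2 := by
    intro x
    rw [Finset.sum_eq_single (θ x)]
    · rw [h.invol]; ring
    · intro y _ hy
      by_cases hx : pos x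
      · by_cases hy' : pos (θ y)
        · rw [hc x y, zero_mul]
          intro hadj
          exact hy (h.cross x y hadj hx ((h.pos_iff y).1 hy'))
        · rw [hu _ hy']; ring
      · rw [hu x hx]; ring
    · intro hx; exact absurd (Finset.mem_univ _) hx
  simp only [h5]
  ring

/-- The additional conductance `δ` makes the positivity quantitative at one crossing vertex, which
is what rules out non-constant maximisers. -/
lemma ReflectsForm.quad_nonneg {θ : G ≃g G} {pos : V → Prop} (h : ReflectsForm Γ c θ pos)
    (hc : ∀ x y, ¬ G.Adj x y → c x y = 0) (hcs : ∀ x y, c x y = c y x) {δ : ℝ} (hδ : 0 ≤ δ)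
    (u : V → ℝ) (hu : ∀ x, ¬ pos x → u x = 0) {x : V} (hx : G.Adj x (θ x)) :
    δ * u x ^ 2 ≤ quad G Γ (fun x y => c x y + if G.Adj x y then δ else 0) u (u ∘ θ) := by
  rw [h.quad_eq (fun x y hxy => by simp [hc x y hxy, hxy])
    (fun x y => by simp only [hcs x y, G.adj_comm x y]) u hu]
  have h1 := h.nonneg (lap G u) u (h.lap_eq u hu) hu
  simp only [add_mul, Finset.sum_add_distrib]
  have h2 : δ * u x ^ 2 ≤ ∑ x, (if G.Adj x (θ x) then δ else 0) * u x ^ 2 := by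
    refine le_trans ?_ (Finset.single_le_sum (f := fun x =>
      (if G.Adj x (θ x) then δ else 0) * u x ^ 2) (fun z _ => ?_) (Finset.mem_univ x))
    · simp only [if_pos hx, le_refl]
    · split_ifs <;> positivity
  linarith

lemma quad_add_conductance (b : V → V → ℝ) (h h' : V → ℝ) :
    quad G Γ (fun x y => c x y + b x y) h h' = quad G Γ c h h' -
      2⁻¹ * ∑ x, ∑ y, b x y * ((h x - h y) * (h' x - h' y)) := by
  simp only [quad, add_mul, Finset.sum_add_distrib]
  ring

/-- A quadratic form that is reflection positive at all edges is non-positive. -/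
theorem quad_nonpos (hΓ : ∀ x y, Γ x y = Γ y x) (hc : ∀ x y, ¬ G.Adj x y → c x y = 0)
    (hcs : ∀ x y, c x y = c y x)
    (hrefl : ∀ x y, G.Adj x y → ∃ (θ : G ≃g G) (pos : V → Prop), ReflectsForm Γ c θ pos ∧
      pos x ∧ θ x = y) (h : V → ℝ) : quad G Γ c h h ≤ 0 := by
  classical
  have key : ∀ δ : ℝ, 0 < δ →
      quad G Γ (fun x y => c x y + if G.Adj x y then δ else 0) h h ≤ 0 := by
    intro δ hδ
    set c' : V → V → ℝ := fun x y => c x y + if G.Adj x y then δ else 0 with hc'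
    have hc'0 : ∀ x y, ¬ G.Adj x y → c' x y = 0 := fun x y hxy => by simp [hc', hc x y hxy, hxy]
    have hc's : ∀ x y, c' x y = c' y x := fun x y => by simp [hc', hcs x y, G.adj_comm x y]
    let Q : (V → ℝ) → ℝ := fun f => quad G Γ c' f f
    -- The maximum is taken over the finitely many functions with values in the range of `h`.
    -- Copying one half onto the other stays in this class.
    have : Finite (V → Set.range h) := Pi.finite
    have : Nonempty (V → Set.range h) := ⟨fun x => ⟨h x, x, rfl⟩⟩
    obtain ⟨f, hf⟩ := Finite.exists_max fun f : V → Set.range h => Q fun x => f x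
    have hmax : ∀ k : V → ℝ, (∀ x, k x ∈ Set.range h) → Q k ≤ Q fun x => f x :=
      fun k hk => hf fun x => ⟨k x, hk x⟩
    set F : V → ℝ := fun x => f x with hF
    have hFr : ∀ x, F x ∈ Set.range h := fun x => (f x).2
    have hconst : ∀ x y, G.Adj x y → F x = F y := by
      intro x y hxy
      by_contra hne
      obtain ⟨θ, pos, hθ, hx, rfl⟩ := hrefl x y hxy
      -- With this `u`, the function `F + u ∘ θ` copies the positive half of `F` onto the other
      -- half, and `F - u` does the opposite.
      let u : V → ℝ := fun z => if pos z then F z - F (θ z) else 0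
      have hu0 : ∀ z, ¬ pos z → u z = 0 := fun z hz => if_neg hz
      have hsub : F - F ∘ θ = u - u ∘ θ := by
        funext z
        simp only [Pi.sub_apply, Function.comp_apply, u, hθ.pos_iff, hθ.invol]
        split_ifs <;> simp_all
      have h1 : Q (F + u ∘ θ) ≤ Q F := by
        refine hmax _ fun z => ?_
        simp only [Pi.add_apply, Function.comp_apply, u, hθ.pos_iff, hθ.invol]
        split_ifs with hz
        · rw [add_zero]; exact hFr z
        · rw [add_sub_cancel]; exact hFr _
      have h2 : Q (F - u) ≤ Q F := by
        refine hmax _ fun z => ?_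
        simp only [Pi.sub_apply, u]
        split_ifs with hz
        · rw [sub_sub_cancel]; exact hFr _
        · rw [sub_zero]; exact hFr z
      have hcθ : ∀ x y, c' (θ x) (θ y) = c' x y := fun x y => by
        have : G.Adj (θ x) (θ y) ↔ G.Adj x y := θ.map_adj_iff
        simp only [hc', hθ.conductance, this]
      have hcomm := quad_comm (G := G) (c := c') hΓ
      have e1 : Q (F + u ∘ θ) = Q F + 2 * quad G Γ c' (u ∘ θ) F + Q u := by
        have : quad G Γ c' (u ∘ θ) (u ∘ θ) = quad G Γ c' u u :=
          quad_comp θ hθ.inv hcθ u u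
        simp only [Q]
        rw [quad_add_left, hcomm F, hcomm (u ∘ θ), quad_add_left, quad_add_left, this,
          hcomm F (u ∘ θ)]
        ring
      have e2 : Q (F - u) = Q F - 2 * quad G Γ c' u F + Q u := by
        simp only [Q]
        rw [quad_sub_left, hcomm F, hcomm u, quad_sub_left, quad_sub_left, hcomm F u]
        ring
      have e3 : quad G Γ c' (u ∘ θ) F = quad G Γ c' u (F ∘ θ) := by
        have := quad_comp (G := G) θ hθ.inv hcθ u (F ∘ θ)
        rw [← this]
        congr 1
        funext z; simp [hθ.invol]
      have e4 : quad G Γ c' u F - quad G Γ c' u (F ∘ θ) = Q u - quad G Γ c' u (u ∘ θ) := by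
        simp only [Q]
        rw [hcomm u F, hcomm u (F ∘ θ), ← quad_sub_left, hsub, quad_sub_left, hcomm (u ∘ θ) u]
      -- Together `e1` to `e4` say that `Q (F + u ∘ θ)` and `Q (F - u)` add up to `2 * Q F` plus
      -- twice this quantity, so one of them would exceed the maximum.
      have h3 : δ * u x ^ 2 ≤ quad G Γ c' u (u ∘ θ) :=
        hθ.quad_nonneg hc hcs hδ.le u hu0 hxy
      have hux : u x ≠ 0 := by
        simp only [u, if_pos hx]
        exact sub_ne_zero.2 hne
      have : 0 < δ * u x ^ 2 := by positivity
      linarith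
    have hQF : Q F = 0 := by
      have hl : lap G F = 0 := by
        funext x
        refine Finset.sum_eq_zero fun y _ => ?_
        split_ifs with hxy
        · rw [hconst x y hxy, sub_self]
        · rfl
      simp only [Q, quad, hl, Pi.zero_apply, mul_zero, Finset.sum_const_zero, zero_sub]
      rw [Finset.sum_eq_zero fun x _ => Finset.sum_eq_zero fun y _ => ?_, mul_zero, neg_zero]
      by_cases hxy : G.Adj x y
      · rw [hconst x y hxy]; ring
      · rw [hc'0 x y hxy]; ring
    exact (hmax h fun x => ⟨x, rfl⟩).trans hQF.le
  by_contra hlt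
  push Not at hlt
  set D := ∑ x, ∑ y, (if G.Adj x y then (1 : ℝ) else 0) * ((h x - h y) * (h x - h y)) with hD
  have hD0 : 0 ≤ D := Finset.sum_nonneg fun x _ => Finset.sum_nonneg fun y _ =>
    mul_nonneg (by split_ifs <;> norm_num) (mul_self_nonneg _)
  -- For this `δ` the added Dirichlet form is at most half of the value supposed to be positive.
  have h1 := key (quad G Γ c h h / (D + 1)) (by positivity)
  rw [quad_add_conductance] at h1
  have h2 : ∑ x, ∑ y, (if G.Adj x y then quad G Γ c h h / (D + 1) else 0) *
      ((h x - h y) * (h x - h y)) = quad G Γ c h h / (D + 1) * D := by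
    rw [hD, Finset.mul_sum]
    refine Finset.sum_congr rfl fun x _ => ?_
    rw [Finset.mul_sum]
    refine Finset.sum_congr rfl fun y _ => ?_
    split_ifs <;> ring
  rw [h2] at h1
  have h3 : quad G Γ c h h / (D + 1) * D ≤ quad G Γ c h h := by
    rw [div_mul_eq_mul_div, div_le_iff₀ (by positivity)]
    nlinarith
  linarith

end Quadratic

/-! ### The quadratic form of the random path model -/

section Model

variable {V : Type} [Fintype V] [DecidableEq V] {G : SimpleGraph V} [DecidableRel G.Adj] {N : ℕ}
  {v : V → V → ℝ} {U : ℕ → ℝ≥0} {lam : ℝ}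

lemma twoPoint_eq (hc : Controlled U v) (hlam : 0 < lam) (hN : 1 < N) (x y : V) :
    twoPoint G N U v lam x y = lam ^ 2 *
      (correlation G U v lam (insertion N x + insertion N y) /
        correlation G U v lam (0 : V → Fin N → ℕ)) := by
  rw [twoPoint, partitionDirected_eq hc hlam hN, partitionClosed_eq hlam]

lemma twoPoint_map (hc : Controlled U v) (hlam : 0 < lam) (hN : 1 < N) (τ : G ≃g G)
    (hv : ∀ x y, v (τ x) (τ y) = v x y) (x y : V) :
    twoPoint G N U v lam (τ x) (τ y) = twoPoint G N U v lam x y := by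
  rw [twoPoint_eq hc hlam hN, twoPoint_eq hc hlam hN, correlation_insertion_map U lam τ hv]

lemma twoPoint_comm (hc : Controlled U v) (hlam : 0 < lam) (hN : 1 < N) (x y : V) :
    twoPoint G N U v lam x y = twoPoint G N U v lam y x := by
  rw [twoPoint_eq hc hlam hN, twoPoint_eq hc hlam hN, add_comm]

lemma expectation_linkCount_eq (hlam : 0 < lam) (hN : 1 < N) {x y : V} (hxy : G.Adj x y) :
    expectation G N U v lam (fun w => (w.linkCount x y 1 : ℝ)) =
      linkSum G U v lam ⟨s(x, y), hxy⟩ (⟨0, by omega⟩ : Fin N) /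
        correlation G U v lam (0 : V → Fin N → ℕ) :=
  expectation_linkCount hlam hN hxy

lemma expectation_linkCount_map (hlam : 0 < lam) (hN : 1 < N) (τ : G ≃g G)
    (hv : ∀ x y, v (τ x) (τ y) = v x y) {x y : V} (hxy : G.Adj x y) :
    expectation G N U v lam (fun w => (w.linkCount (τ x) (τ y) 1 : ℝ)) =
      expectation G N U v lam (fun w => (w.linkCount x y 1 : ℝ)) := by
  rw [expectation_linkCount_eq hlam hN hxy, expectation_linkCount_eq hlam hN (τ.map_adj_iff.2 hxy),
    ← linkSum_map U lam τ hv 1 ⟨s(x, y), hxy⟩]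
  rfl

lemma expectation_linkCount_comm (hlam : 0 < lam) (hN : 1 < N) {x y : V} (hxy : G.Adj x y) :
    expectation G N U v lam (fun w => (w.linkCount x y 1 : ℝ)) =
      expectation G N U v lam (fun w => (w.linkCount y x 1 : ℝ)) := by
  rw [expectation_linkCount_eq hlam hN hxy, expectation_linkCount_eq hlam hN hxy.symm]
  have : (⟨s(x, y), hxy⟩ : G.edgeSet) = ⟨s(y, x), hxy.symm⟩ := Subtype.ext Sym2.eq_swap
  rw [this]

variable (G N U v lam) in
/-- The conductances of the Dirichlet form in the infrared bound. -/
noncomputable def conductance (x y : V) : ℝ :=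
  if G.Adj x y then 1 + 2 * expectation G N U v lam (fun w => (w.linkCount x y 1 : ℝ)) else 0

lemma conductance_map (hlam : 0 < lam) (hN : 1 < N) (τ : G ≃g G)
    (hv : ∀ x y, v (τ x) (τ y) = v x y) (x y : V) :
    conductance G N v U lam (τ x) (τ y) = conductance G N v U lam x y := by
  by_cases hxy : G.Adj x y
  · rw [conductance, conductance, if_pos hxy, if_pos (τ.map_adj_iff.2 hxy),
      expectation_linkCount_map hlam hN τ hv hxy]
  · rw [conductance, conductance, if_neg hxy, if_neg (mt τ.map_adj_iff.1 hxy)]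

lemma conductance_comm (hlam : 0 < lam) (hN : 1 < N) (x y : V) :
    conductance G N v U lam x y = conductance G N v U lam y x := by
  by_cases hxy : G.Adj x y
  · rw [conductance, conductance, if_pos hxy, if_pos hxy.symm,
      expectation_linkCount_comm hlam hN hxy]
  · rw [conductance, conductance, if_neg hxy, if_neg (fun h => hxy h.symm)]

variable {θ : G ≃g G} {pos : V → Prop} [DecidablePred pos]

omit [DecidableEq V] in
lemma sum_crossVertex (f : V → ℝ) :
    ∑ b : CrossVertex θ pos, f b.1 = ∑ x with pos x, if G.Adj x (θ x) then f x else 0 := by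
  rw [← Finset.sum_filter, Finset.filter_filter]
  exact (Finset.sum_subtype _ (fun x => by simp) f).symm

omit [DecidableEq V] in
lemma sum_pos (f : V → ℝ) : ∑ x : {x : V // pos x}, f x.1 = ∑ x with pos x, f x :=
  (Finset.sum_subtype _ (fun x => by simp) f).symm

/-- `opForm_nonneg` is used with multiplication coefficients `H` and derivative coefficients `g`.
The derivatives act as insertions at mirror vertices, so they supply the values of `H` on the other
half. After division by the partition function the contact term is the conductance of the crossing
edge. -/
theorem IsReflection.reflectsForm (h : IsReflection v θ pos) (hc : Controlled U v)
    (hlam : 0 < lam) (hN : 1 < N) (hZ : 0 < correlation G U v lam (0 : V → Fin N → ℕ)) :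
    ReflectsForm (G := G) (twoPoint G N U v lam) (conductance G N v U lam) θ pos where
  invol := h.invol
  pos_iff := h.pos_iff
  cross := h.cross
  inv := twoPoint_map hc hlam hN θ h.inv
  conductance := conductance_map hlam hN θ h.inv
  nonneg H g hH hg := by
    have h1 := opForm_nonneg (lam := lam) h hc hlam hN H g
    set Z := correlation G U v lam (0 : V → Fin N → ℕ) with hZdef
    set K : V → V → ℝ := fun x y => correlation G U v lam (insertion N x + insertion N y) with hK
    set a : V → ℝ := fun x => if G.Adj x (θ x) then g x else 0 with ha
    have hHa : ∀ x, pos x → H (θ x) = a x := fun x hx => by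
      have : G.Adj (θ x) x ↔ G.Adj x (θ x) := G.adj_comm _ _
      rw [hH (θ x) (by rw [h.pos_iff, not_not]; exact hx), h.invol]
      simp only [this, ha]
    have hKc : ∀ x y, K x y = K y x := fun x y => by simp only [hK, add_comm]
    have hKθ : ∀ x y, K (θ x) (θ y) = K x y := correlation_insertion_map U lam θ h.inv
    have hlink : ∀ b : CrossVertex θ pos, Z + 2 * linkSum G U v lam (crossEdge b)
        (⟨0, by omega⟩ : Fin N) = Z * conductance G N v U lam b.1 (θ b.1) := fun b => by
      rw [conductance, if_pos b.2.2, expectation_linkCount_eq hlam hN b.2.2]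
      change _ = Z * (1 + 2 * (linkSum G U v lam (crossEdge b) (⟨0, by omega⟩ : Fin N) / Z))
      field_simp
    have h2 : ∑ s : HalfOp θ pos, ∑ t : HalfOp θ pos, opForm hN U v lam H g s t =
        lam ^ 2 * (∑ x with pos x, ∑ y with pos y, (H x * H y * K x (θ y) +
          2 * (H x * a y * K x y) + a x * a y * K x (θ y))) +
          Z * ∑ x with pos x, conductance G N v U lam x (θ x) * g x ^ 2 := by
      simp only [Fintype.sum_sum_type, opForm, Finset.sum_add_distrib, Finset.sum_ite_eq,
        Finset.mem_univ, if_true]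
      have e1 : ∑ x : {x : V // pos x}, ∑ y : {x : V // pos x}, lam ^ 2 * (H x * H y) *
          K x.1 (θ y.1) = lam ^ 2 * ∑ x with pos x, ∑ y with pos y, H x * H y * K x (θ y) := by
        simp only [Finset.mul_sum]
        rw [sum_pos fun x => ∑ y : {x : V // pos x}, lam ^ 2 * (H x * H y) * K x (θ y.1)]
        refine Finset.sum_congr rfl fun x _ => ?_
        rw [sum_pos fun y => lam ^ 2 * (H x * H y) * K x (θ y)]
        exact Finset.sum_congr rfl fun y _ => by ring
      have e2 : ∑ x : {x : V // pos x}, ∑ y : CrossVertex θ pos, lam ^ 2 * (H x * g y) *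
          K x.1 y.1 = lam ^ 2 * ∑ x with pos x, ∑ y with pos y, H x * a y * K x y := by
        simp only [Finset.mul_sum]
        rw [sum_pos fun x => ∑ y : CrossVertex θ pos, lam ^ 2 * (H x * g y) * K x y.1]
        refine Finset.sum_congr rfl fun x _ => ?_
        rw [sum_crossVertex fun y => lam ^ 2 * (H x * g y) * K x y]
        refine Finset.sum_congr rfl fun y _ => ?_
        simp only [ha]; split_ifs <;> ring
      have e3 : ∑ x : CrossVertex θ pos, ∑ y : {x : V // pos x}, lam ^ 2 * (H y * g x) *
          K y.1 x.1 = lam ^ 2 * ∑ x with pos x, ∑ y with pos y, H x * a y * K x y := by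
        rw [Finset.sum_comm]; exact e2
      have e4 : ∑ x : CrossVertex θ pos, ∑ y : CrossVertex θ pos, lam ^ 2 * (g x * g y) *
          K x.1 (θ y.1) = lam ^ 2 * ∑ x with pos x, ∑ y with pos y, a x * a y * K x (θ y) := by
        simp only [Finset.mul_sum]
        rw [sum_crossVertex fun x => ∑ y : CrossVertex θ pos, lam ^ 2 * (g x * g y) * K x (θ y.1)]
        refine Finset.sum_congr rfl fun x _ => ?_
        simp only [ha]
        split_ifs with hx
        · rw [sum_crossVertex fun y => lam ^ 2 * (g x * g y) * K x (θ y)]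
          refine Finset.sum_congr rfl fun y _ => ?_
          split_ifs <;> ring
        · simp
      have e6 : ∑ b : CrossVertex θ pos, g b ^ 2 * (Z + 2 * linkSum G U v lam (crossEdge b)
          (⟨0, by omega⟩ : Fin N)) = _ :=
        (Finset.sum_congr rfl fun b _ => by rw [hlink]).trans
          (sum_crossVertex fun x => g x ^ 2 * (Z * conductance G N v U lam x (θ x)))
      have e5 : (∑ x with pos x, if G.Adj x (θ x) then g x ^ 2 * (Z * conductance G N v U lam x
          (θ x)) else 0) = Z * ∑ x with pos x, conductance G N v U lam x (θ x) * g x ^ 2 := by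
        rw [Finset.mul_sum]
        refine Finset.sum_congr rfl fun x _ => ?_
        split_ifs with hx
        · ring
        · rw [conductance, if_neg hx]; ring
      refine (congrArg₂ (· + ·) (congrArg₂ (· + ·) e1 e3) (congrArg₂ (· + ·) e2
        (congrArg₂ (· + ·) e4 (e6.trans e5)))).trans ?_
      simp only [← Finset.mul_sum]
      ring
    have h3 : ∑ x, ∑ y, twoPoint G N U v lam x y * (H x * H (θ y)) = lam ^ 2 / Z *
        (∑ x with pos x, ∑ y with pos y, (H x * H y * K x (θ y) +
          2 * (H x * a y * K x y) + a x * a y * K x (θ y))) := by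
      have hswap : ∑ x with pos x, ∑ y with pos y, a x * H y * K x y =
          ∑ x with pos x, ∑ y with pos y, H x * a y * K x y := by
        rw [Finset.sum_comm]
        refine Finset.sum_congr rfl fun x _ => Finset.sum_congr rfl fun y _ => ?_
        rw [hKc]; ring
      have e0 : ∑ x, ∑ y, twoPoint G N U v lam x y * (H x * H (θ y)) =
          lam ^ 2 / Z * ∑ x, ∑ y, K x y * (H x * H (θ y)) := by
        simp only [Finset.mul_sum]
        refine Finset.sum_congr rfl fun x _ => Finset.sum_congr rfl fun y _ => ?_
        rw [twoPoint_eq hc hlam hN]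
        simp only [hK, ← hZdef]; ring
      rw [e0]
      congr 1
      simp only [sum_split h, Finset.sum_add_distrib, h.invol, hKθ, two_mul]
      conv_rhs => rw [← hswap]
      have f1 : ∑ x with pos x, ∑ y with pos y, K x y * (H x * H (θ y)) =
          ∑ x with pos x, ∑ y with pos y, H x * a y * K x y :=
        Finset.sum_congr rfl fun x _ => Finset.sum_congr rfl fun y hy => by
          rw [hHa y (Finset.mem_filter.1 hy).2]; ring
      have f2 : ∑ x with pos x, ∑ y with pos y, K x (θ y) * (H x * H y) =
          ∑ x with pos x, ∑ y with pos y, H x * H y * K x (θ y) :=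
        Finset.sum_congr rfl fun x _ => Finset.sum_congr rfl fun y hy => by ring
      have f3 : ∑ x with pos x, ∑ y with pos y, K (θ x) y * (H (θ x) * H (θ y)) =
          ∑ x with pos x, ∑ y with pos y, a x * a y * K x (θ y) :=
        Finset.sum_congr rfl fun x hx => Finset.sum_congr rfl fun y hy => by
          rw [hHa y (Finset.mem_filter.1 hy).2, hHa x (Finset.mem_filter.1 hx).2,
            ← hKθ (θ x) y, h.invol]; ring
      have f4 : ∑ x with pos x, ∑ y with pos y, K x y * (H (θ x) * H y) =
          ∑ x with pos x, ∑ y with pos y, a x * H y * K x y :=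
        Finset.sum_congr rfl fun x hx => Finset.sum_congr rfl fun y _ => by
          rw [hHa x (Finset.mem_filter.1 hx).2]; ring
      rw [f1, f2, f3, f4, hswap]
      ring
    have h4 : ∑ x, conductance G N v U lam x (θ x) * g x ^ 2 =
        ∑ x with pos x, conductance G N v U lam x (θ x) * g x ^ 2 := by
      symm
      refine Finset.sum_filter_of_ne fun x _ hne => ?_
      by_contra hx
      exact hne (by rw [hg x hx]; ring)
    rw [h3, h4]
    rw [h2] at h1
    have h5 := div_nonneg h1 hZ.le
    rw [add_div, mul_div_right_comm, mul_div_cancel_left₀ _ hZ.ne'] at h5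
    exact h5

end Model

/-! ### Transport of reflections -/

section Transport

variable {V : Type} [Fintype V] {G : SimpleGraph V} {v : V → V → ℝ} {θ : G ≃g G} {pos : V → Prop}

/-- With translations as `τ`, this moves the reflection next to the origin to an arbitrary edge. -/
lemma IsReflection.conj (h : IsReflection v θ pos) (τ : G ≃g G)
    (hτ : ∀ x y, v (τ x) (τ y) = v x y) :
    IsReflection v ((τ.symm.trans θ).trans τ) (fun x => pos (τ.symm x)) where
  invol x := by simp [h.invol]
  pos_iff x := by simp [h.pos_iff]
  cross x y hxy hx hy := by
    have := h.cross (τ.symm x) (τ.symm y) (τ.symm.map_adj_iff.2 hxy) hx hy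
    simp [← this]
  inv x y := by simp [hτ, h.inv, ← hτ (τ.symm x) (τ.symm y)]
  symm := h.symm
  neg c hc := by
    have h1 := h.neg (fun x => c (τ x)) fun x hx => hc _ (by simpa using hx)
    rw [← Equiv.sum_comp τ.toEquiv]
    refine le_trans (le_of_eq (Finset.sum_congr rfl fun x _ => ?_)) h1
    rw [← Equiv.sum_comp τ.toEquiv]
    refine Finset.sum_congr rfl fun y _ => ?_
    change c (τ x) * c (τ y) * v (τ x) (τ (θ (τ.symm (τ y)))) = _
    rw [hτ, RelIso.symm_apply_apply]

/-- Exchanging the halves allows either endpoint of an edge to be the positive one. -/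
lemma IsReflection.compl (h : IsReflection v θ pos) : IsReflection v θ (fun x => ¬ pos x) where
  invol := h.invol
  pos_iff x := by rw [h.pos_iff]
  cross x y hxy hx hy := by
    rw [h.cross y x hxy.symm (not_not.1 hy) hx, h.invol]
  inv := h.inv
  symm := h.symm
  neg c hc := by
    have h1 := h.neg (fun x => c (θ x)) fun x hx => hc _ (by rw [not_not, h.pos_iff]; exact hx)
    rw [← Equiv.sum_comp θ.toEquiv]
    refine le_trans (le_of_eq (Finset.sum_congr rfl fun x _ => ?_)) h1
    rw [← Equiv.sum_comp θ.toEquiv]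
    refine Finset.sum_congr rfl fun y _ => ?_
    change c (θ x) * c (θ y) * v (θ x) (θ (θ y)) = _
    rw [h.inv]

end Transport

/-! ### Symmetries of the torus -/

section Torus

variable {d L : ℕ}

lemma torus_adj (hL : 1 < L) {x y : Torus d L} : (torusGraph d L).Adj x y ↔
    (∃ j, y = x + unitVec d L j) ∨ ∃ j, x = y + unitVec d L j := by
  have : Fact (1 < L) := ⟨hL⟩
  simp only [torusGraph, SimpleGraph.fromRel_adj, and_iff_right_iff_imp]
  have hne : ∀ (x : Torus d L) j, x + unitVec d L j ≠ x := fun x j h => by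
    have := congr_fun (add_eq_left.1 h) j
    simp [unitVec] at this
  rintro (⟨j, rfl⟩ | ⟨j, rfl⟩)
  · exact (hne x j).symm
  · exact hne y j

/-- An automorphism of the torus from a bijection that preserves adjacency. -/
def torusIso (hL : 1 < L) (e : Torus d L ≃ Torus d L)
    (he : ∀ x j, (torusGraph d L).Adj (e x) (e (x + unitVec d L j)))
    (he' : ∀ x j, (torusGraph d L).Adj (e.symm x) (e.symm (x + unitVec d L j))) :
    torusGraph d L ≃g torusGraph d L where
  toEquiv := e
  map_rel_iff' := by
    intro x y
    constructor
    · intro h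
      rcases (torus_adj hL).1 h with ⟨j, hj⟩ | ⟨j, hj⟩
      · have := he' (e x) j
        rwa [← hj, e.symm_apply_apply, e.symm_apply_apply] at this
      · have := he' (e y) j
        rw [← hj, e.symm_apply_apply, e.symm_apply_apply] at this
        exact this.symm
    · intro h
      rcases (torus_adj hL).1 h with ⟨j, rfl⟩ | ⟨j, rfl⟩
      · exact he x j
      · exact (he y j).symm

/-- Translations of the torus. -/
def translation (hL : 1 < L) (a : Torus d L) : torusGraph d L ≃g torusGraph d L :=
  torusIso hL (Equiv.addRight a)
    (fun x j => (torus_adj hL).2 (.inl ⟨j, by simp [add_right_comm]⟩))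
    (fun x j => (torus_adj hL).2 (.inl ⟨j, by simp [add_right_comm]⟩))

lemma translation_apply (hL : 1 < L) (a x : Torus d L) : translation hL a x = x + a := rfl

lemma translation_symm_apply (hL : 1 < L) (a x : Torus d L) :
    (translation hL a).symm x = x - a := (sub_eq_add_neg x a).symm

lemma reflect_reflect (i : Fin d) (x : Torus d L) : reflect i (reflect i x) = x := by
  funext k
  by_cases hk : k = i
  · subst hk; simp [reflect]
  · simp [reflect, hk]

lemma reflect_add_unitVec (i j : Fin d) (x : Torus d L) :
    reflect i (x + unitVec d L j) =
      if j = i then reflect i x - unitVec d L j else reflect i x + unitVec d L j := by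
  funext k
  by_cases hj : j = i
  · subst hj
    rw [if_pos rfl]
    by_cases hk : k = j
    · subst hk; simp [reflect, unitVec]
    · simp [reflect, unitVec, hk]
  · rw [if_neg hj]
    by_cases hk : k = i
    · subst hk; simp [reflect, unitVec, Ne.symm hj]
    · simp [reflect, unitVec, hk]

/-- The reflections of the torus as automorphisms. -/
def reflection (hL : 1 < L) (i : Fin d) : torusGraph d L ≃g torusGraph d L :=
  torusIso hL ⟨reflect i, reflect i, reflect_reflect i, reflect_reflect i⟩
    (fun x j => by
      change (torusGraph d L).Adj (reflect i x) (reflect i (x + unitVec d L j))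
      rw [reflect_add_unitVec, torus_adj hL]
      split_ifs
      · exact .inr ⟨j, by simp⟩
      · exact .inl ⟨j, rfl⟩)
    (fun x j => by
      change (torusGraph d L).Adj (reflect i x) (reflect i (x + unitVec d L j))
      rw [reflect_add_unitVec, torus_adj hL]
      split_ifs
      · exact .inr ⟨j, by simp⟩
      · exact .inl ⟨j, rfl⟩)

lemma reflection_apply (hL : 1 < L) (i : Fin d) (x : Torus d L) :
    reflection hL i x = reflect i x := rfl

lemma unitVec_comp (σ : Equiv.Perm (Fin d)) (j : Fin d) :
    (fun i => unitVec d L j (σ i)) = unitVec d L (σ.symm j) := by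
  funext i
  simp [unitVec, Pi.single_apply, Equiv.eq_symm_apply]

/-- Permutations of the coordinates of the torus as automorphisms. -/
def coordPerm (hL : 1 < L) (σ : Equiv.Perm (Fin d)) : torusGraph d L ≃g torusGraph d L :=
  torusIso hL (σ.symm.arrowCongr (Equiv.refl _))
    (fun x j => (torus_adj hL).2 (.inl ⟨σ.symm j, by rw [← unitVec_comp]; rfl⟩))
    (fun x j => (torus_adj hL).2 (.inl ⟨σ j, by
      rw [← σ.symm_symm, σ.symm_symm, ← Equiv.symm_symm σ, ← unitVec_comp]; rfl⟩))

lemma coordPerm_apply (hL : 1 < L) (σ : Equiv.Perm (Fin d)) (x : Torus d L) (i : Fin d) :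
    coordPerm hL σ x i = x (σ i) := rfl

/-! ### The periodised potential -/

variable {v : (Fin d → ℤ) → ℝ}

lemma exists_lattice_shift (a b : Fin d → ℤ) (h : ∀ i, (a i : ZMod L) = b i) :
    ∃ c : Fin d → ℤ, ∀ i, a i = b i + L * c i := by
  have : ∀ i, ∃ c : ℤ, a i = b i + L * c := fun i => by
    obtain ⟨c, hc⟩ := (ZMod.intCast_eq_intCast_iff_dvd_sub _ _ _).1 (h i).symm
    exact ⟨c, by linarith⟩
  choose c hc using this
  exact ⟨c, hc⟩

lemma tsum_lattice_congr (f : (Fin d → ℤ) → ℝ) (a b : Fin d → ℤ)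
    (h : ∀ i, (a i : ZMod L) = b i) :
    ∑' z : Fin d → ℤ, f (fun i => a i + L * z i) = ∑' z : Fin d → ℤ, f fun i => b i + L * z i := by
  obtain ⟨c, hc⟩ := exists_lattice_shift a b h
  rw [← (Equiv.addRight c).tsum_eq fun z : Fin d → ℤ => f fun i => b i + L * z i]
  refine tsum_congr fun z => congrArg f (funext fun i => ?_)
  simp [hc]; ring

/-- Changing the representative of `y - x` by a lattice vector only relabels the sum, so any
representative `a` will do. -/
lemma periodic_eq (f : (Fin d → ℤ) → ℝ) (x y : Torus d L) (a : Fin d → ℤ)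
    (h : ∀ i, (a i : ZMod L) = y i - x i) :
    periodic d L f x y = ∑' z : Fin d → ℤ, f fun i => a i + L * z i := by
  rw [← tsum_lattice_congr (L := L) f (fun i => (y i).valMinAbs - (x i).valMinAbs) a
    fun i => by simp [h, ZMod.coe_valMinAbs]]
  refine tsum_congr fun z => congrArg f (funext fun i => ?_)
  ring

lemma periodic_congr {x y x' y' : Torus d L} (h : y - x = y' - x') :
    periodic d L v x y = periodic d L v x' y' := by
  have h1 : ∀ i, ((((y i).valMinAbs - (x i).valMinAbs : ℤ)) : ZMod L) = y i - x i := fun i => by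
    simp [ZMod.coe_valMinAbs]
  rw [periodic_eq v x y _ h1, periodic_eq v x' y' _ fun i => (h1 i).trans (congr_fun h i)]

lemma periodic_comm (hv : ∀ x, v (-x) = v x) (x y : Torus d L) :
    periodic d L v x y = periodic d L v y x := by
  have h1 : ∀ (x y : Torus d L) i, ((((y i).valMinAbs - (x i).valMinAbs : ℤ)) : ZMod L) =
      y i - x i := fun x y i => by simp [ZMod.coe_valMinAbs]
  rw [periodic_eq v x y _ (h1 x y), periodic_eq v y x _ (h1 y x),
    ← (Equiv.neg (Fin d → ℤ)).tsum_eq]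
  refine tsum_congr fun z => ?_
  rw [← hv]
  refine congrArg v (funext fun i => ?_)
  simp only [Pi.neg_apply, Equiv.neg_apply]
  ring

lemma periodic_translation (hL : 1 < L) (a x y : Torus d L) :
    periodic d L v (translation hL a x) (translation hL a y) = periodic d L v x y :=
  periodic_congr (by simp [translation_apply])

lemma periodic_coordPerm (hL : 1 < L) (hv : PermInvariant v) (σ : Equiv.Perm (Fin d))
    (x y : Torus d L) :
    periodic d L v (coordPerm hL σ x) (coordPerm hL σ y) = periodic d L v x y := by
  simp only [periodic, coordPerm_apply]
  rw [← (σ.symm.arrowCongr (Equiv.refl ℤ)).tsum_eq]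
  refine tsum_congr fun z => ?_
  exact hv σ fun i => (y i).valMinAbs + L * z i - (x i).valMinAbs

/-! ### Reflection positivity of separable potentials -/

/-- For even `L` the integers in `(-L/2, L/2]` are preserved by `t ↦ 1 - t`, so no reduction modulo
`L` is needed. -/
lemma valMinAbs_one_sub [NeZero L] (hL : Even L) (a : ZMod L) :
    (1 - a).valMinAbs = 1 - a.valMinAbs := by
  have h := ZMod.valMinAbs_mem_Ioc a
  have h2 : (0 : ℕ) < L := NeZero.pos L
  obtain ⟨m, hm⟩ := hL
  rw [ZMod.valMinAbs_spec]
  refine ⟨by simp [ZMod.coe_valMinAbs], ?_⟩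
  simp only [Set.mem_Ioc] at h ⊢
  constructor <;> omega

/-- On a half, `-w x (reflect i y)` is an integral of the Gram kernels `∑ α_j(x) conj(α_j(y))`. It
is thus Hermitian, and symmetric because it is real; its quadratic form is an integral of squared
moduli. -/
lemma separable_kernel {w : Torus d L → Torus d L → ℝ} {i : Fin d} [NeZero L] (hL : Even L)
    (hw : SeparableDir w i) :
    (∀ x y, 0 < (x i).valMinAbs → 0 < (y i).valMinAbs →
      w x (reflect i y) = w y (reflect i x)) ∧
    ∀ c : Torus d L → ℝ, (∀ x, ¬ 0 < (x i).valMinAbs → c x = 0) →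
      ∑ x, ∑ y, c x * c y * w x (reflect i y) ≤ 0 := by
  obtain ⟨k, T, _, ν, α, α', hν, hα, hα', ⟨B, hB⟩, hint, hconj⟩ := hw
  have hrep : ∀ x y : Torus d L, 0 < (x i).valMinAbs → 0 < (y i).valMinAbs →
      -(w x (reflect i y) : ℂ) = ∫ t, ∑ j : Fin k, α t x j * starRingEnd ℂ (α t y j) ∂ν := by
    intro x y hx hy
    rw [hint x (reflect i y) hx]
    · refine integral_congr_ae ?_
      filter_upwards [hconj (reflect i y)] with t ht
      simp only [ht, reflect_reflect]
    · simp only [reflect, Function.update_self, valMinAbs_one_sub hL]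
      omega
  have hI : ∀ x y j, Integrable (fun t => α t x j * starRingEnd ℂ (α t y j)) ν := by
    intro x y j
    refine Integrable.of_bound (C := B * B) ?_ (ae_of_all _ fun t => ?_)
    · exact ((hα x j).mul (Complex.continuous_conj.measurable.comp (hα y j))).aestronglyMeasurable
    · rw [norm_mul, RCLike.norm_conj]
      exact mul_le_mul (hB t x j).1 (hB t y j).1 (norm_nonneg _)
        ((norm_nonneg _).trans (hB t x j).1)
  constructor
  · intro x y hx hy
    have h1 := hrep x y hx hy
    have h2 := hrep y x hy hx
    have h3 : (w x (reflect i y) : ℂ) = w y (reflect i x) := by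
      have h4 := congrArg (starRingEnd ℂ) h1
      rw [← integral_conj] at h4
      simp only [map_sum, map_mul, Complex.conj_conj, map_neg, Complex.conj_ofReal] at h4
      rw [← neg_inj, h4, h2]
      refine integral_congr_ae (ae_of_all _ fun t => Finset.sum_congr rfl fun j _ => ?_)
      ring
    exact_mod_cast h3
  · intro c hc
    have h1 : (-(∑ x, ∑ y, c x * c y * w x (reflect i y) : ℝ) : ℂ) =
        ∫ t, ∑ x, ∑ y, ∑ j : Fin k, (c x * c y : ℂ) * (α t x j * starRingEnd ℂ (α t y j)) ∂ν := by
      rw [integral_finsetSum _ fun x _ => integrable_finsetSum _ fun y _ =>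
        integrable_finsetSum _ fun j _ => (hI x y j).const_mul _]
      push_cast
      rw [← Finset.sum_neg_distrib]
      refine Finset.sum_congr rfl fun x _ => ?_
      rw [integral_finsetSum _ fun y _ =>
        integrable_finsetSum _ fun j _ => (hI x y j).const_mul _, ← Finset.sum_neg_distrib]
      refine Finset.sum_congr rfl fun y _ => ?_
      by_cases hx : 0 < (x i).valMinAbs
      · by_cases hy : 0 < (y i).valMinAbs
        · simp only [← Finset.mul_sum]
          rw [integral_const_mul, ← hrep x y hx hy]
          ring
        · simp [hc y hy]
      · simp [hc x hx]
    have h2 : ∀ t, ∑ x, ∑ y, ∑ j : Fin k, (c x * c y : ℂ) * (α t x j * starRingEnd ℂ (α t y j)) =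
        ((∑ j : Fin k, Complex.normSq (∑ x, c x * α t x j) : ℝ) : ℂ) := by
      intro t
      push_cast
      simp only [← Complex.mul_conj, map_sum, map_mul, Complex.conj_ofReal, Finset.sum_mul_sum]
      refine ((Finset.sum_congr rfl fun x _ => Finset.sum_comm).trans Finset.sum_comm).trans ?_
      refine Finset.sum_congr rfl fun j _ => ?_
      refine Finset.sum_congr rfl fun x _ => ?_
      refine Finset.sum_congr rfl fun y _ => ?_
      ring
    simp only [h2] at h1
    rw [integral_complex_ofReal] at h1
    have h3 : -(∑ x, ∑ y, c x * c y * w x (reflect i y)) =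
      ∫ t, ∑ j : Fin k, Complex.normSq (∑ x, c x * α t x j) ∂ν := by exact_mod_cast h1
    have h4 : 0 ≤ ∫ t, ∑ j : Fin k, Complex.normSq (∑ x, c x * α t x j) ∂ν :=
      integral_nonneg fun t => Finset.sum_nonneg fun j _ => Complex.normSq_nonneg _
    linarith

end Torus

/-! ### Reflections through arbitrary edges, bounds on weights and positivity on the torus -/

section Torus

variable {d L N : ℕ} {v : (Fin d → ℤ) → ℝ}

/-- Every nonzero residue is the difference between a reflected positive coordinate `1 - b` and a
positive coordinate `a`: `L + 1 - s` lies between `2` and `L`, and its two halves lie between `1`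
and `L / 2`. -/
lemma exists_pos_add [NeZero L] (hL : Even L) (s : ZMod L) (hs : s ≠ 0) :
    ∃ a b : ZMod L, 0 < a.valMinAbs ∧ 0 < b.valMinAbs ∧ s = 1 - b - a := by
  have h1 : s.val < L := ZMod.val_lt s
  have h2 : 0 < s.val := Nat.pos_of_ne_zero fun h => hs ((ZMod.val_eq_zero s).1 h)
  obtain ⟨m, hm⟩ := hL
  refine ⟨(((L + 1 - s.val) / 2 : ℕ) : ZMod L), ((L + 1 - s.val - (L + 1 - s.val) / 2 : ℕ) : ZMod L),
    ?_, ?_, ?_⟩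
  · rw [ZMod.valMinAbs_natCast_of_le_half (by omega)]; omega
  · rw [ZMod.valMinAbs_natCast_of_le_half (by omega)]; omega
  · rw [Nat.cast_sub (by omega), Nat.cast_sub (by omega)]
    simp
    ring

/-- Reflection invariance is not assumed but follows from separability. The symmetry in
`separable_kernel` says that, when the `i`-th coordinate of the difference is nonzero, the others
may be reversed together; with evenness this reverses the `i`-th alone. If that coordinate vanishes,
the reflection does not change the difference. -/
lemma periodic_reflect [NeZero L] (hL : Even L) (hv : ∀ x, v (-x) = v x) (hsep : Separable L v)
    (i : Fin d) (x y : Torus d L) :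
    periodic d L v (reflect i x) (reflect i y) = periodic d L v x y := by
  by_cases hs : y i - x i = 0
  · refine periodic_congr (funext fun k => ?_)
    by_cases hk : k = i
    · subst hk
      simp only [reflect, Pi.sub_apply, Function.update_self]
      linear_combination -hs - hs
    · simp [reflect, hk]
  · obtain ⟨a, b, ha, hb, hab⟩ := exists_pos_add hL _ hs
    have h := (separable_kernel hL (hsep i)).1 (Function.update 0 i a)
      (Function.update (y - x) i b) (by simpa using ha) (by simpa using hb)
    rw [periodic_comm hv]
    refine Eq.trans ?_ (h.symm.trans ?_)
    · refine periodic_congr (funext fun k => ?_)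
      by_cases hk : k = i
      · subst hk
        simp only [reflect, Pi.sub_apply, Function.update_self]
        linear_combination hab
      · simp [reflect, hk]
    · refine periodic_congr (funext fun k => ?_)
      by_cases hk : k = i
      · subst hk
        simp only [reflect, Pi.sub_apply, Function.update_self]
        linear_combination -hab
      · simp [reflect, hk]

lemma pos_reflect [NeZero L] (hL : Even L) (i : Fin d) (x : Torus d L) :
    0 < (reflect i x i).valMinAbs ↔ ¬ 0 < (x i).valMinAbs := by
  simp only [reflect, Function.update_self, valMinAbs_one_sub hL]
  omega

lemma valMinAbs_add_one [NeZero L] (a : ZMod L) (ha : 2 * a.valMinAbs + 2 ≤ L) :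
    (a + 1).valMinAbs = a.valMinAbs + 1 := by
  have h := ZMod.valMinAbs_mem_Ioc a
  rw [ZMod.valMinAbs_spec]
  refine ⟨by simp [ZMod.coe_valMinAbs], ?_⟩
  simp only [Set.mem_Ioc] at h ⊢
  constructor <;> omega

lemma isReflection_reflection [NeZero L] (hL : Even L) (hL2 : 2 < L) (hv : ∀ x, v (-x) = v x)
    (hsep : Separable L v) (i : Fin d) :
    IsReflection (periodic d L v) (reflection (by omega : 1 < L) i)
      (fun x => 0 < (x i).valMinAbs) where
  invol := reflect_reflect i
  pos_iff x := pos_reflect hL i x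
  cross x y hxy hx hy := by
    rw [reflection_apply]
    -- The sign changes between `a` and `a + 1` only at `a = 0` and, by wrapping around, at `a = L /
    -- 2`. In both cases `2 * a = 0`, so the same reflection exchanges the endpoints.
    have key : ∀ a : ZMod L, (0 < a.valMinAbs ∧ ¬ 0 < (a + 1).valMinAbs) ∨
        (¬ 0 < a.valMinAbs ∧ 0 < (a + 1).valMinAbs) → a + 1 = 1 - a := by
      intro a ha
      have h := ZMod.valMinAbs_mem_Ioc a
      simp only [Set.mem_Ioc] at h
      obtain ⟨m, hm⟩ := hL
      have h2 : (2 : ZMod L) * a = 0 := by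
        rw [← ZMod.coe_valMinAbs a]
        by_cases hle : 2 * a.valMinAbs + 2 ≤ L
        · rw [valMinAbs_add_one a hle] at ha
          have : a.valMinAbs = 0 := by omega
          simp [this]
        · have : 2 * a.valMinAbs = L := by omega
          have h3 : ((2 * a.valMinAbs : ℤ) : ZMod L) = 0 := by rw [this]; simp
          exact_mod_cast h3
      linear_combination h2
    have key2 : ∀ (x : Torus d L) j, (0 < (x i).valMinAbs ∧
        ¬ 0 < ((x + unitVec d L j) i).valMinAbs) ∨
        (¬ 0 < (x i).valMinAbs ∧ 0 < ((x + unitVec d L j) i).valMinAbs) →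
        x + unitVec d L j = reflect i x := by
      intro x j hxj
      by_cases hj : j = i
      · subst hj
        have h1 := key (x j) (by simpa [unitVec] using hxj)
        funext k
        by_cases hk : k = j
        · subst hk; simpa [unitVec, reflect] using h1
        · simp [unitVec, reflect, hk]
      · exfalso
        have : (x + unitVec d L j) i = x i := by simp [unitVec, Ne.symm hj]
        rw [this] at hxj
        omega
    rcases (torus_adj (by omega)).1 hxy with ⟨j, rfl⟩ | ⟨j, rfl⟩
    · exact key2 x j (.inl ⟨hx, hy⟩)
    · rw [key2 y j (.inr ⟨hy, hx⟩), reflect_reflect]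
  inv := periodic_reflect hL hv hsep i
  symm := periodic_comm hv
  neg := (separable_kernel hL (hsep i)).2

/-- Translate the lower endpoint of the edge to the origin, which the basic reflection exchanges
with a unit vector, and exchange the halves if necessary. -/
lemma exists_isReflection [NeZero L] (hL : Even L) (hL2 : 2 < L) (hv : ∀ x, v (-x) = v x)
    (hsep : Separable L v) {x y : Torus d L} (hxy : (torusGraph d L).Adj x y) :
    ∃ (θ : torusGraph d L ≃g torusGraph d L) (pos : Torus d L → Prop),
      IsReflection (periodic d L v) θ pos ∧ pos x ∧ θ x = y := by
  have hL1 : 1 < L := by omega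
  have key : ∀ (x : Torus d L) (i : Fin d), ∃ (θ : torusGraph d L ≃g torusGraph d L)
      (pos : Torus d L → Prop), IsReflection (periodic d L v) θ pos ∧ ¬ pos x ∧
        θ x = x + unitVec d L i := by
    intro x i
    refine ⟨_, _, (isReflection_reflection hL hL2 hv hsep i).conj (translation hL1 x)
      (periodic_translation hL1 x), ?_, ?_⟩
    · simp [translation_symm_apply]
    · simp only [RelIso.trans_apply, translation_symm_apply, sub_self, translation_apply,
        reflection_apply]
      rw [add_comm]
      congr 1
      funext k
      by_cases hk : k = i
      · subst hk; simp [reflect, unitVec]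
      · simp [reflect, unitVec, hk]
  rcases (torus_adj hL1).1 hxy with ⟨i, rfl⟩ | ⟨i, rfl⟩
  · obtain ⟨θ, pos, h, hx, hθ⟩ := key x i
    exact ⟨θ, _, h.compl, hx, hθ⟩
  · obtain ⟨θ, pos, h, hx, hθ⟩ := key y i
    refine ⟨θ, pos, h, ?_, by rw [← hθ, h.invol]⟩
    rw [← hθ, h.pos_iff]; exact hx

/-! ### Control of the vertex weights -/

/-- Integer vectors are sums of a vector in the fundamental cell and a vector of the lattice. -/
noncomputable def latticeEquiv (d L : ℕ) [NeZero L] :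
    (Torus d L × (Fin d → ℤ)) ≃ (Fin d → ℤ) :=
  Equiv.ofBijective (fun p i => (p.1 i).valMinAbs + L * p.2 i) <| by
    constructor
    · rintro ⟨s, z⟩ ⟨s', z'⟩ h
      have hs : s = s' := funext fun i => by
        have := congrArg (Int.cast : ℤ → ZMod L) (congr_fun h i)
        simpa [ZMod.coe_valMinAbs] using this
      subst hs
      refine Prod.ext rfl (funext fun i => ?_)
      have := congr_fun h i
      simpa [NeZero.ne L] using this
    · intro a
      obtain ⟨c, hc⟩ := exists_lattice_shift (L := L) a
        (fun i => ((a i : ZMod L)).valMinAbs) fun i => by simp [ZMod.coe_valMinAbs]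
      exact ⟨(fun i => (a i : ZMod L), c), funext fun i => (hc i).symm⟩

/-- Keep `v 0` on the diagonal and the negative part `m` of `v`, discarding the rest. Since `m ≤ 0`,
the inequality `2 n_x n_y ≤ n_x² + n_y²` bounds the interaction below by row sums, and every row of
the periodised `m` sums to the total of `m` over the lattice. -/
lemma vbar_mul_sum_sq_le [NeZero L] (hv : ∀ x, v (-x) = v x) (ht : Tempered v)
    (n : Torus d L → ℝ) (hn : ∀ x, 0 ≤ n x) :
    vbar v * ∑ x, n x ^ 2 ≤ ∑ x, ∑ y, periodic d L v x y * n x * n y := by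
  set m : (Fin d → ℤ) → ℝ := fun a => if v a < 0 then v a else 0 with hm
  have hm0 : ∀ a, m a ≤ 0 := fun a => by simp only [hm]; split_ifs with h <;> linarith
  have hms : Summable m := by
    refine Summable.of_norm_bounded ht.2 fun a => ?_
    simp only [hm]
    split_ifs
    · exact le_rfl
    · simp
  have hvs : Summable v := ht.2.of_abs
  have hmneg : ∀ x, m (-x) = m x := fun x => by simp only [hm, hv]
  set p : Torus d L → Torus d L → ℝ := periodic d L m with hp
  have hp0 : ∀ x y, p x y ≤ 0 := fun x y => tsum_nonpos fun z => hm0 _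
  have hsl : ∀ {f : (Fin d → ℤ) → ℝ}, Summable f → ∀ a : Fin d → ℤ,
      Summable fun z : Fin d → ℤ => f fun i => a i + L * z i := by
    intro f hf a
    refine hf.comp_injective (i := fun z : Fin d → ℤ => fun i => a i + L * z i) fun z z' h => ?_
    funext i
    have := congr_fun h i
    simpa [NeZero.ne L] using this
  have hrow : ∀ x, ∑ y, p x y = ∑' a, m a := by
    intro x
    rw [← (latticeEquiv d L).tsum_eq, Summable.tsum_prod (f := fun c => m (latticeEquiv d L c))
      ((latticeEquiv d L).summable_iff.2 hms),
      tsum_fintype, ← Equiv.sum_comp (Equiv.addRight x)]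
    refine Finset.sum_congr rfl fun s _ => ?_
    exact periodic_eq m x (s + x) (fun i => (s i).valMinAbs) fun i => by
      simp [ZMod.coe_valMinAbs]
  have hge : ∀ x y, (if y = x then v 0 else 0) + p x y ≤ periodic d L v x y := by
    intro x y
    have ha : ∀ i, ((((y i).valMinAbs - (x i).valMinAbs : ℤ)) : ZMod L) = y i - x i := fun i => by
      simp [ZMod.coe_valMinAbs]
    have hpt : ∀ a : Fin d → ℤ, m a ≤ v a := fun a => by
      simp only [hm]; split_ifs with h
      · exact le_rfl
      · exact not_lt.1 h
    split_ifs with hyx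
    · subst hyx
      rw [hp, periodic_eq m y y 0 (by simp), periodic_eq v y y 0 (by simp),
        ← tsum_ite_eq (0 : Fin d → ℤ) fun _ => v 0, ← Summable.tsum_add
          (hasSum_ite_eq (0 : Fin d → ℤ) (v 0)).summable (hsl hms 0)]
      refine Summable.tsum_le_tsum (fun z => ?_) ((hasSum_ite_eq (0 : Fin d → ℤ) (v 0)).summable.add
        (hsl hms 0)) (hsl hvs 0)
      split_ifs with hz
      · subst hz
        simp only [Pi.zero_apply, mul_zero, add_zero]
        have h1 := hm0 fun _ => 0
        -- If `v 0` is negative it is counted twice, both here and in `vbar`, which only lowers the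
        -- left-hand side.
        change v 0 + _ ≤ v 0
        linarith
      · rw [zero_add]; exact hpt _
    · rw [zero_add, hp, periodic_eq m x y _ ha, periodic_eq v x y _ ha]
      exact Summable.tsum_le_tsum (fun z => hpt _) (hsl hms _) (hsl hvs _)
  calc vbar v * ∑ x, n x ^ 2
      = v 0 * ∑ x, n x ^ 2 + (∑ x, ∑ y, p x y * (n x ^ 2 / 2) +
          ∑ x, ∑ y, p x y * (n y ^ 2 / 2)) := by
        have h1 : ∑ x, ∑ y, p x y * (n x ^ 2 / 2) = (∑' a, m a) * ∑ x, n x ^ 2 / 2 := by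
          rw [Finset.mul_sum]
          refine Finset.sum_congr rfl fun x _ => ?_
          rw [← Finset.sum_mul, hrow]
        have h2 : ∑ x, ∑ y, p x y * (n y ^ 2 / 2) = (∑' a, m a) * ∑ x, n x ^ 2 / 2 := by
          rw [Finset.sum_comm, ← h1]
          refine Finset.sum_congr rfl fun x _ => Finset.sum_congr rfl fun y _ => ?_
          rw [hp, periodic_comm hmneg]
        rw [h1, h2, vbar, ← Finset.sum_div]
        ring
    _ ≤ ∑ x, ∑ y, ((if y = x then v 0 else 0) + p x y) * n x * n y := by
        have h1 : v 0 * ∑ x, n x ^ 2 = ∑ x, ∑ y, (if y = x then v 0 else 0) * n x * n y := by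
          rw [Finset.mul_sum]
          refine Finset.sum_congr rfl fun x _ => ?_
          rw [Finset.sum_eq_single x]
          · rw [if_pos rfl]; ring
          · intro y _ hy; rw [if_neg hy]; ring
          · intro h; exact absurd (Finset.mem_univ x) h
        rw [h1, ← Finset.sum_add_distrib, ← Finset.sum_add_distrib]
        refine Finset.sum_le_sum fun x _ => ?_
        rw [← Finset.sum_add_distrib, ← Finset.sum_add_distrib]
        refine Finset.sum_le_sum fun y _ => ?_
        nlinarith [hp0 x y, sq_nonneg (n x - n y),
          mul_nonneg (neg_nonneg.2 (hp0 x y)) (sq_nonneg (n x - n y))]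
    _ ≤ _ := by
        refine Finset.sum_le_sum fun x _ => Finset.sum_le_sum fun y _ => ?_
        exact mul_le_mul_of_nonneg_right (mul_le_mul_of_nonneg_right (hge x y) (hn x)) (hn y)

/-- By `vbar_mul_sum_sq_le` the vertex weight is at most the product of the reduced weights `Ub`,
and goodness makes each application of the recursion gain a factor of order `1 / n`. -/
lemma controlled_periodic [NeZero L] {U : ℕ → ℝ≥0} (hv : ∀ x, v (-x) = v x) (ht : Tempered v)
    (hg : Good v U) : Controlled U (periodic d L v) := by
  obtain ⟨M, hM⟩ := hg
  set Ub : ℕ → ℝ := fun n => (U n : ℝ) * Real.exp (-vbar v * (n : ℝ) ^ 2) with hUb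
  have hUb0 : ∀ n, 0 ≤ Ub n := fun n => by simp only [hUb]; positivity
  set K := max M 1 with hK
  have hK1 : 1 ≤ K := le_max_right _ _
  set C := Ub 0 + Ub 1 with hC
  have hC0 : 0 ≤ C := add_nonneg (hUb0 0) (hUb0 1)
  -- The base is `2 * K` because goodness divides by `n` while the factorial asks for `n + 1 ≤ 2 *
  -- n`. The recursion is empty at `n = 0`, so `Ub 1` enters the constant `C`.
  have hb : ∀ n, Ub n ≤ C * (2 * K) ^ n / (n.factorial : ℝ) := by
    intro n
    induction n with
    | zero => simpa [hC] using hUb0 1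
    | succ n ih =>
      rcases Nat.eq_zero_or_pos n with rfl | hn
      · have : Ub 1 ≤ C := by simpa [hC] using hUb0 0
        simp only [zero_add, pow_one, Nat.factorial_one, Nat.cast_one, div_one]
        nlinarith
      · have hn' : (0 : ℝ) < n := by exact_mod_cast hn
        have hn1 : (1 : ℝ) ≤ n := by exact_mod_cast hn
        have h1 : (n : ℝ) * Ub (n + 1) ≤ K * Ub n :=
          (hM n).trans (mul_le_mul_of_nonneg_right (le_max_left _ _) (hUb0 n))
        have h2 : K * Ub n ≤ K * (C * (2 * K) ^ n / (n.factorial : ℝ)) :=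
          mul_le_mul_of_nonneg_left ih (by linarith)
        have hf : (0 : ℝ) < n.factorial := by positivity
        rw [Nat.factorial_succ, pow_succ]
        push_cast
        rw [le_div_iff₀ (by positivity)]
        have h3 : (n : ℝ) * Ub (n + 1) * n.factorial ≤ K * (C * (2 * K) ^ n) := by
          have := mul_le_mul_of_nonneg_right (h1.trans h2) hf.le
          refine this.trans_eq ?_
          field_simp
        have h4 : 0 ≤ Ub (n + 1) * n.factorial := mul_nonneg (hUb0 _) hf.le
        nlinarith
  refine ⟨C, 2 * K, hC0, by linarith, fun n => ?_⟩
  have h1 := vbar_mul_sum_sq_le (L := L) hv ht (fun x => (n x : ℝ)) fun x => Nat.cast_nonneg _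
  calc vertexWeight U (periodic d L v) n
      ≤ (∏ x, (U (n x) : ℝ)) * Real.exp (-(vbar v * ∑ x, (n x : ℝ) ^ 2)) := by
        unfold vertexWeight
        gcongr
    _ = ∏ x, Ub (n x) := by
        simp only [hUb, Finset.prod_mul_distrib]
        rw [← Real.exp_sum, Finset.mul_sum, ← Finset.sum_neg_distrib]
        congr 2
        exact Finset.sum_congr rfl fun x _ => by ring
    _ ≤ _ := Finset.prod_le_prod (fun x _ => hUb0 _) fun x _ => hb _

/-! ### Positivity of the partition function -/

/-- If `U 1` were zero, goodness would propagate the zero to all larger arguments, and the range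
could not reach two. -/
lemma weight_one_pos {U : ℕ → ℝ≥0} (hg : Good v U) (hrange : 2 ≤ weightRange U) : 0 < U 1 := by
  by_contra h
  have h1 : U 1 = 0 := by simpa using h
  obtain ⟨M, hM⟩ := hg
  have h0 : ∀ n, U (n + 1) = 0 := by
    intro n
    induction n with
    | zero => exact h1
    | succ n ih =>
      have := hM (n + 1)
      rw [ih] at this
      simp only [NNReal.coe_zero, zero_mul, mul_zero] at this
      by_contra hne
      have hpos : 0 < (U (n + 1 + 1) : ℝ) := by
        have := pos_iff_ne_zero.2 hne
        exact_mod_cast this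
      have : 0 < ((n + 1 : ℕ) : ℝ) * ((U (n + 1 + 1) : ℝ) *
          Real.exp (-vbar v * ((n + 1 + 1 : ℕ) : ℝ) ^ 2)) := by positivity
      linarith
  have : weightRange U ≤ 0 := by
    refine iSup₂_le fun n hn => ?_
    cases n with
    | zero => simp
    | succ n => rw [h0 n] at hn; exact absurd hn (lt_irrefl _)
  exact absurd (hrange.trans this) (by norm_num)

/-- One nonzero term suffices: one link of the first colour on each edge in direction `0`. Then
every vertex has degree two and carries exactly one pairing, with weight `U 1 > 0`. -/
lemma correlation_zero_pos [NeZero d] [NeZero L] (hL : 2 < L) {U : ℕ → ℝ≥0}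
    (hc : Controlled U (periodic d L v)) (hU : 0 < U 1) {lam : ℝ} (hlam : 0 < lam) (hN : 1 < N) :
    0 < correlation (torusGraph d L) U (periodic d L v) lam (0 : Torus d L → Fin N → ℕ) := by
  classical
  have hL1 : 1 < L := by omega
  let E : Torus d L → (torusGraph d L).edgeSet := fun y =>
    ⟨s(y, y + unitVec d L 0), (torus_adj hL1).2 (.inl ⟨0, rfl⟩)⟩
  let M : (torusGraph d L).edgeSet → Fin N → ℕ := fun e i =>
    if (i : ℕ) = 0 then ∑ y, if e = E y then 1 else 0 else 0
  have hdeg : ∀ x i, degrees M x i = if (i : ℕ) = 0 then 2 else 0 := by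
    intro x i
    rw [degrees_eq]
    by_cases hi : (i : ℕ) = 0
    · simp only [M, if_pos hi]
      have h1 : ∀ e : (torusGraph d L).edgeSet,
          (if x ∈ (e : Sym2 (Torus d L)) then ∑ y, (if e = E y then 1 else 0) else 0) =
          ∑ y, if e = E y then (if x ∈ (E y : Sym2 (Torus d L)) then 1 else 0) else 0 := by
        intro e
        split_ifs with hx
        · refine Finset.sum_congr rfl fun y _ => ?_
          split_ifs with h2 h3
          · rfl
          · exact absurd (h2 ▸ hx) h3
          · rfl
        · symm
          refine Finset.sum_eq_zero fun y _ => ?_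
          split_ifs with h2 h3
          · exact absurd (h2 ▸ h3) hx
          · rfl
          · rfl
      rw [Finset.sum_congr rfl fun e _ => h1 e, Finset.sum_comm]
      simp only [Finset.sum_ite_eq', Finset.mem_univ, if_true]
      have h2 : ∀ y, (if x ∈ (E y : Sym2 (Torus d L)) then 1 else 0) =
          (if y = x then 1 else 0) + if y = x - unitVec d L 0 then 1 else 0 := by
        intro y
        have h3 : x ∈ (E y : Sym2 (Torus d L)) ↔ x = y ∨ x = y + unitVec d L 0 := Sym2.mem_iff
        have h4 : x = y + unitVec d L 0 ↔ y = x - unitVec d L 0 :=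
          ⟨fun h => by rw [h, add_sub_cancel_right], fun h => by rw [h, sub_add_cancel]⟩
        rw [h4, eq_comm (a := x)] at h3
        by_cases h5 : y = x
        · have h6 : y ≠ x - unitVec d L 0 := by
            intro h6
            have h7 : (torusGraph d L).Adj y x :=
              (torus_adj hL1).2 (.inl ⟨0, by rw [h6, sub_add_cancel]⟩)
            exact h7.ne h5
          rw [if_pos (h3.2 (.inl h5)), if_pos h5, if_neg h6]
        · simp [h3, h5]
      simp only [h2, Finset.sum_add_distrib, Finset.sum_ite_eq', Finset.mem_univ, if_true]
    · simp only [M, if_neg hi, ite_self, Finset.sum_const_zero]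
  have hs := summable_correlation (G := torusGraph d L) hc hlam (0 : Torus d L → Fin N → ℕ)
    (p := fun _ => 1) (C := 1) (R := 1) (fun _ => zero_le_one) le_rfl (by simp)
  simp only [one_mul] at hs
  refine hs.tsum_pos (fun M => mul_nonneg (linkWeight_nonneg hlam M) (moment_nonneg _ _ _)) M ?_
  refine mul_pos ?_ ?_
  · exact Finset.prod_pos fun e _ => Finset.prod_pos fun i _ => by positivity
  · rw [add_zero]
    have hsum : ∀ x, ∑ i, degrees M x i = 2 := by
      intro x
      rw [Finset.sum_eq_single (⟨0, by omega⟩ : Fin N)]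
      · simp [hdeg]
      · intro i _ hi
        rw [hdeg, if_neg]
        intro h; exact hi (Fin.ext h)
      · intro h; exact absurd (Finset.mem_univ _) h
    unfold moment vertexWeight
    simp only [hsum]
    refine mul_pos ?_ (mul_pos (Finset.prod_pos fun x _ => ?_) (Real.exp_pos _))
    · norm_cast
      refine Finset.prod_pos fun x _ => Finset.prod_pos fun i _ => ?_
      rw [hdeg]
      split_ifs <;> simp [pairings]
    · exact_mod_cast hU

/-- The quadratic form of the infrared bound on the torus is non-positive. -/
theorem quad_torus_nonpos [NeZero L] (hL : Even L) (hL2 : 2 < L)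
    (hv : ∀ x, v (-x) = v x) (hsep : Separable L v) {U : ℕ → ℝ≥0}
    (hc : Controlled U (periodic d L v)) {lam : ℝ} (hlam : 0 < lam) (hN : 1 < N)
    (hZ : 0 < correlation (torusGraph d L) U (periodic d L v) lam (0 : Torus d L → Fin N → ℕ))
    (h : Torus d L → ℝ) :
    quad (torusGraph d L) (twoPoint (torusGraph d L) N U (periodic d L v) lam)
      (conductance (torusGraph d L) N (periodic d L v) U lam) h h ≤ 0 := by
  classical
  refine quad_nonpos (twoPoint_comm hc hlam hN) (fun x y hxy => if_neg hxy)
    (conductance_comm hlam hN) (fun x y hxy => ?_) h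
  obtain ⟨θ, pos, hθ, hx, hy⟩ := exists_isReflection hL hL2 hv hsep hxy
  exact ⟨θ, pos, hθ.reflectsForm hc hlam hN hZ, hx, hy⟩

end Torus

/-! ### Fourier analysis on the torus and the infrared bound -/

section Fourier

variable {d L : ℕ}

/-- The characters of the torus. -/
noncomputable def torusChar [NeZero L] (a x : Torus d L) : ℂ := ZMod.stdAddChar (∑ i, a i * x i)

variable [NeZero L]

lemma torusChar_add (a x y : Torus d L) : torusChar a (x + y) = torusChar a x * torusChar a y := by
  simp only [torusChar, Pi.add_apply, mul_add, Finset.sum_add_distrib, AddChar.map_add_eq_mul]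

lemma torusChar_zero (a : Torus d L) : torusChar a 0 = 1 := by
  simp [torusChar]

lemma torusChar_neg (a x : Torus d L) : torusChar a (-x) = starRingEnd ℂ (torusChar a x) := by
  simp only [torusChar, Pi.neg_apply, mul_neg, Finset.sum_neg_distrib]
  exact AddChar.map_neg_eq_conj _ _

lemma torusChar_mul_conj (a x : Torus d L) : torusChar a x * starRingEnd ℂ (torusChar a x) = 1 := by
  rw [← torusChar_neg, ← torusChar_add, add_neg_cancel, torusChar_zero]

lemma torusChar_unitVec (a : Torus d L) (j : Fin d) :
    torusChar a (unitVec d L j) = ZMod.stdAddChar (a j) := by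
  simp [torusChar, unitVec, Pi.single_apply]

lemma stdAddChar_re (s : ZMod L) :
    (ZMod.stdAddChar s : ℂ).re = Real.cos (2 * Real.pi / L * s.valMinAbs) := by
  conv_lhs => rw [← ZMod.coe_valMinAbs s, ZMod.stdAddChar_coe]
  have : (2 * Real.pi * Complex.I * (s.valMinAbs : ℤ) / L : ℂ) =
      ((2 * Real.pi / L * s.valMinAbs : ℝ) : ℂ) * Complex.I := by
    push_cast; ring
  rw [this, Complex.exp_ofReal_mul_I_re]

lemma torusChar_eq_prod (a s : Torus d L) :
    torusChar a s = ∏ i, (ZMod.stdAddChar (a i * s i) : ℂ) := by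
  have : ∀ F : Finset (Fin d), (ZMod.stdAddChar (∑ i ∈ F, a i * s i) : ℂ) =
      ∏ i ∈ F, (ZMod.stdAddChar (a i * s i) : ℂ) := by
    intro F
    induction F using Finset.induction_on with
    | empty => simp
    | insert i F hi ih => rw [Finset.sum_insert hi, Finset.prod_insert hi,
        AddChar.map_add_eq_mul, ih]
  exact this Finset.univ

lemma sum_torusChar (s : Torus d L) :
    ∑ a, torusChar a s = if s = 0 then (L : ℂ) ^ d else 0 := by
  have h1 : ∀ a : Torus d L, torusChar a s = ∏ i, (ZMod.stdAddChar (a i * s i) : ℂ) := fun a =>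
    torusChar_eq_prod a s
  simp only [h1]
  rw [← Fintype.piFinset_univ, ← Finset.prod_univ_sum (fun _ => Finset.univ)
    fun i (t : ZMod L) => (ZMod.stdAddChar (t * s i) : ℂ)]
  simp only [AddChar.sum_mulShift _ (ZMod.isPrimitive_stdAddChar L), ZMod.card]
  split_ifs with h
  · subst h; simp
  · obtain ⟨i, hi⟩ := Function.ne_iff.1 h
    exact Finset.prod_eq_zero (Finset.mem_univ i) (by
      have hi' : s i ≠ 0 := hi
      rw [if_neg hi', Nat.cast_zero])

lemma sum_torusChar_re (s : Torus d L) :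
    ∑ a, (torusChar a s).re = if s = 0 then (L : ℝ) ^ d else 0 := by
  rw [← Complex.re_sum, sum_torusChar]
  split_ifs
  · norm_cast
  · rfl

/-- The eigenvalues of the Laplacian of the torus. -/
noncomputable def torusEpsilon (a : Torus d L) : ℝ := ∑ j, (2 - 2 * (torusChar a (unitVec d L j)).re)

/-- For `L > 2` the `2 d` points `x ± e_j` are distinct, so no neighbour is counted twice. -/
lemma sum_neighbours (hL : 2 < L) (x : Torus d L) (f : Torus d L → ℝ) :
    (∑ y, if (torusGraph d L).Adj x y then f y else 0) =
      ∑ j, (f (x + unitVec d L j) + f (x - unitVec d L j)) := by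
  have hL1 : 1 < L := by omega
  have : Fact (1 < L) := ⟨hL1⟩
  have h2 : (1 : ZMod L) ≠ -1 := by
    intro h
    have h3 : ((2 : ℕ) : ZMod L) = 0 := by push_cast; linear_combination h
    rw [ZMod.natCast_eq_zero_iff] at h3
    exact absurd (Nat.le_of_dvd two_pos h3) (by omega)
  let φ : Fin d ⊕ Fin d → Torus d L := Sum.elim (fun j => x + unitVec d L j)
    fun j => x - unitVec d L j
  have hφ : Function.Injective φ := by
    rintro (j | j) (k | k) h <;> simp only [φ, Sum.elim_inl, Sum.elim_inr, sub_eq_add_neg,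
      add_right_inj, neg_inj] at h <;> by_cases hjk : j = k
    · rw [hjk]
    · have := congr_fun h j; simp [unitVec, hjk] at this
    · have := congr_fun h j; subst hjk; simp [unitVec] at this; exact absurd this h2
    · have := congr_fun h j; simp [unitVec, hjk] at this
    · have := congr_fun h j; subst hjk; simp [unitVec] at this; exact absurd this.symm h2
    · have := congr_fun h j; simp [unitVec, hjk] at this
    · rw [hjk]
    · have := congr_fun h j; simp [unitVec, hjk] at this
  have h3 : Finset.univ.filter (fun y => (torusGraph d L).Adj x y) = Finset.univ.map ⟨φ, hφ⟩ := by
    ext y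
    simp only [Finset.mem_filter, Finset.mem_univ, true_and, Finset.mem_map, Sum.exists,
      Function.Embedding.coeFn_mk, torus_adj hL1, φ, Sum.elim_inl, Sum.elim_inr]
    refine or_congr (exists_congr fun j => eq_comm) (exists_congr fun j => ?_)
    rw [sub_eq_iff_eq_add]
  rw [← Finset.sum_filter, h3, Finset.sum_map, Fintype.sum_sum_type, Finset.sum_add_distrib]
  rfl

/-- The factor `z` covers the real part (`z = 1`) and the imaginary part (`z = -I`) of a character
at once, as real eigenfunctions. -/
lemma lap_torusChar (hL : 2 < L) (a : Torus d L) (z : ℂ) :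
    lap (torusGraph d L) (fun x => (z * torusChar a x).re) =
      fun x => -torusEpsilon a * (z * torusChar a x).re := by
  funext x
  rw [lap, sum_neighbours hL x fun y => (z * torusChar a y).re - (z * torusChar a x).re,
    torusEpsilon, ← Finset.sum_neg_distrib, Finset.sum_mul]
  refine Finset.sum_congr rfl fun j _ => ?_
  rw [sub_eq_add_neg x, torusChar_add, torusChar_add, torusChar_neg]
  simp only [Complex.mul_re, Complex.mul_im, Complex.conj_re, Complex.conj_im]
  ring

lemma torusEpsilon_eq (a : Torus d L) :
    torusEpsilon a = epsilon (dualPoint L fun i => (a i).valMinAbs) := by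
  simp only [torusEpsilon, epsilon, torusChar_unitVec, stdAddChar_re, dualPoint, Finset.mul_sum]
  exact Finset.sum_congr rfl fun j _ => by ring

lemma one_sub_cos_pos {n : ℤ} (h : n * 2 ∈ Set.Ioc (-(L : ℤ)) L) (hn : n ≠ 0) :
    0 < 1 - Real.cos (2 * Real.pi / L * n) := by
  have hL : (0 : ℝ) < L := by exact_mod_cast NeZero.pos L
  have h1 : Real.cos (2 * Real.pi / L * n) ≠ 1 := by
    intro h1
    have hn1 : -(L : ℝ) < n * 2 := by exact_mod_cast h.1
    have hn2 : (n : ℝ) * 2 ≤ L := by exact_mod_cast h.2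
    have h2 : -(2 * Real.pi) < 2 * Real.pi / L * n := by
      rw [div_mul_eq_mul_div, lt_div_iff₀ hL]
      nlinarith [Real.pi_pos]
    have h3 : 2 * Real.pi / L * n < 2 * Real.pi := by
      rw [div_mul_eq_mul_div, div_lt_iff₀ hL]
      nlinarith [Real.pi_pos]
    have h4 := (Real.cos_eq_one_iff_of_lt_of_lt h2 h3).1 h1
    have h5 : (2 * Real.pi / L : ℝ) ≠ 0 := by positivity
    exact hn (by exact_mod_cast (mul_eq_zero.1 h4).resolve_left h5)
  have := lt_of_le_of_ne (Real.cos_le_one _) h1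
  linarith

lemma torusEpsilon_pos {a : Torus d L} (ha : a ≠ 0) : 0 < torusEpsilon a := by
  obtain ⟨i, hi⟩ := Function.ne_iff.1 ha
  refine Finset.sum_pos' (fun j _ => ?_) ⟨i, Finset.mem_univ i, ?_⟩
  · rw [torusChar_unitVec, stdAddChar_re]
    linarith [Real.cos_le_one (2 * Real.pi / L * (a j).valMinAbs)]
  · rw [torusChar_unitVec, stdAddChar_re]
    have := one_sub_cos_pos (ZMod.valMinAbs_mem_Ioc (a i)) fun h =>
      hi ((ZMod.valMinAbs_eq_zero _).1 h)
    linarith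

lemma dualIndex_sum (f : (Fin d → ℤ) → ℝ) :
    ∑ n ∈ (dualIndex d L).erase 0, f n =
      ∑ a ∈ (Finset.univ : Finset (Torus d L)).erase 0, f fun i => (a i).valMinAbs := by
  symm
  have hmem : ∀ n : Fin d → ℤ, n ∈ dualIndex d L ↔ ∀ i, n i * 2 ∈ Set.Ioc (-(L : ℤ)) L := by
    intro n
    simp only [dualIndex, Fintype.mem_piFinset, Finset.mem_filter, Finset.mem_Ioc, Set.mem_Ioc]
    refine forall_congr' fun i => ?_
    have := NeZero.pos L
    constructor
    · rintro ⟨-, h1, h2⟩; constructor <;> omega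
    · rintro ⟨h1, h2⟩; refine ⟨⟨?_, ?_⟩, ?_, ?_⟩ <;> omega
  have hv : ∀ n : Fin d → ℤ, n ∈ dualIndex d L → ∀ i, ((n i : ZMod L)).valMinAbs = n i :=
    fun n hn i => (ZMod.valMinAbs_spec _ _).2 ⟨rfl, (hmem n).1 hn i⟩
  refine Finset.sum_bij' (fun a _ => fun i => (a i).valMinAbs) (fun n _ => fun i => (n i : ZMod L))
    ?_ ?_ ?_ ?_ ?_
  · intro a ha
    rw [Finset.mem_erase] at ha ⊢
    refine ⟨fun h => ha.1 (funext fun i => ?_), (hmem _).2 fun i => ZMod.valMinAbs_mem_Ioc _⟩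
    exact (ZMod.valMinAbs_eq_zero _).1 (congr_fun h i)
  · intro n hn
    rw [Finset.mem_erase] at hn
    refine Finset.mem_erase.2 ⟨fun h => hn.1 (funext fun i => ?_), Finset.mem_univ _⟩
    have := congr_fun h i
    rw [← hv n hn.2 i, this]
    simp
  · intro a _; funext i; simp [ZMod.coe_valMinAbs]
  · intro n hn; funext i; exact hv n (Finset.mem_of_mem_erase hn) i
  · intro a _; rfl

/-- The half-angle formula rewrites `cos²(k_1 / 2)` as half of the weight `1 + cos k_1` produced by
Fourier inversion. -/
lemma fourierSum_eq [NeZero d] : fourierSum d L = 1 / (L : ℝ) ^ d *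
    ∑ a ∈ (Finset.univ : Finset (Torus d L)).erase 0,
      (1 + (torusChar a (unitVec d L 0)).re) / (2 * torusEpsilon a) := by
  rw [fourierSum, dualIndex_sum fun n => Real.cos (dualPoint L n 0 / 2) ^ 2 / epsilon (dualPoint L n)]
  congr 1
  refine Finset.sum_congr rfl fun a _ => ?_
  rw [torusEpsilon_eq, torusChar_unitVec, stdAddChar_re, Real.cos_sq]
  have : 2 * (dualPoint L (fun i => (a i).valMinAbs) 0 / 2) =
      2 * Real.pi / L * (a 0).valMinAbs := by simp only [dualPoint]; ring
  rw [this]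
  ring

/-- The infrared bound. -/
lemma infrared_bound (hL : 2 < L) {Γ c : Torus d L → Torus d L → ℝ} {g : Torus d L → ℝ} {cmax : ℝ}
    (hΓ : ∀ x y, Γ x y = g (y - x)) (hc0 : ∀ x y, ¬ (torusGraph d L).Adj x y → c x y = 0)
    (hc : ∀ x y, (torusGraph d L).Adj x y → c x y ≤ cmax)
    (hq : ∀ h, quad (torusGraph d L) Γ c h h ≤ 0) {a : Torus d L} (ha : a ≠ 0) :
    ∑ s, g s * (torusChar a s).re ≤ cmax / torusEpsilon a := by
  set ε := torusEpsilon a with hε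
  have hε0 : 0 < ε := torusEpsilon_pos ha
  -- Neither the real nor the imaginary part alone gives a translation-invariant product; the two
  -- inequalities are added to obtain the real part of the character at `y - x`.
  have hre : ∀ x y : Torus d L, (1 * torusChar a x).re * (1 * torusChar a y).re +
      (-Complex.I * torusChar a x).re * (-Complex.I * torusChar a y).re =
        (torusChar a (y - x)).re := by
    intro x y
    rw [sub_eq_add_neg, torusChar_add, torusChar_neg]
    simp [Complex.mul_re]
    ring
  have h1 := add_nonpos (hq fun x => (1 * torusChar a x).re)
    (hq fun x => (-Complex.I * torusChar a x).re)
  simp only [quad, lap_torusChar hL] at h1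
  have e1 : (∑ x, ∑ y, Γ x y * (-torusEpsilon a * (1 * torusChar a x).re *
        (-torusEpsilon a * (1 * torusChar a y).re))) +
      (∑ x, ∑ y, Γ x y * (-torusEpsilon a * (-Complex.I * torusChar a x).re *
        (-torusEpsilon a * (-Complex.I * torusChar a y).re))) =
      ε ^ 2 * ((L : ℝ) ^ d * ∑ s, g s * (torusChar a s).re) := by
    rw [← Finset.sum_add_distrib]
    have : ∀ x : Torus d L, (∑ y, Γ x y * (-torusEpsilon a * (1 * torusChar a x).re *
        (-torusEpsilon a * (1 * torusChar a y).re))) +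
      (∑ y, Γ x y * (-torusEpsilon a * (-Complex.I * torusChar a x).re *
        (-torusEpsilon a * (-Complex.I * torusChar a y).re))) =
      ε ^ 2 * ∑ s, g s * (torusChar a s).re := by
      intro x
      rw [← Finset.sum_add_distrib, ← Equiv.sum_comp (Equiv.addRight x), Finset.mul_sum]
      refine Finset.sum_congr rfl fun y _ => ?_
      simp only [Equiv.coe_addRight]
      have h2 := hre x (y + x)
      rw [hΓ, add_sub_cancel_right] at *
      rw [← h2]
      ring
    simp only [this, Finset.sum_const, Finset.card_univ, nsmul_eq_mul, Fintype.card_fun,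
      ZMod.card, Fintype.card_fin]
    push_cast
    ring
  have e2 : (∑ x, ∑ y, c x y * (((1 * torusChar a x).re - (1 * torusChar a y).re) *
        ((1 * torusChar a x).re - (1 * torusChar a y).re))) +
      (∑ x, ∑ y, c x y * (((-Complex.I * torusChar a x).re - (-Complex.I * torusChar a y).re) *
        ((-Complex.I * torusChar a x).re - (-Complex.I * torusChar a y).re))) ≤
      cmax * (2 * (L : ℝ) ^ d * ε) := by
    rw [← Finset.sum_add_distrib]
    have : ∀ x : Torus d L, (∑ y, c x y * (((1 * torusChar a x).re - (1 * torusChar a y).re) *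
        ((1 * torusChar a x).re - (1 * torusChar a y).re))) +
      (∑ y, c x y * (((-Complex.I * torusChar a x).re - (-Complex.I * torusChar a y).re) *
        ((-Complex.I * torusChar a x).re - (-Complex.I * torusChar a y).re))) ≤
        cmax * (2 * ε) := by
      intro x
      have h2 : ∑ y, (if (torusGraph d L).Adj x y then
          cmax * (2 - 2 * (torusChar a (y - x)).re) else 0) = cmax * (2 * ε) := by
        rw [sum_neighbours hL x fun y => cmax * (2 - 2 * (torusChar a (y - x)).re), hε, torusEpsilon,
          Finset.mul_sum, Finset.mul_sum]
        refine Finset.sum_congr rfl fun j _ => ?_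
        rw [add_sub_cancel_left, sub_sub_cancel_left, torusChar_neg, Complex.conj_re]
        ring
      rw [← h2, ← Finset.sum_add_distrib]
      refine Finset.sum_le_sum fun y _ => ?_
      have h3 := hre x y
      have h4 := hre x x
      have h5 := hre y y
      rw [sub_self, torusChar_zero, Complex.one_re] at h4 h5
      split_ifs with hxy
      · have h6 : 0 ≤ 2 - 2 * (torusChar a (y - x)).re := by
          nlinarith [sq_nonneg ((1 * torusChar a x).re - (1 * torusChar a y).re),
            sq_nonneg ((-Complex.I * torusChar a x).re - (-Complex.I * torusChar a y).re)]
        refine le_trans (le_of_eq ?_) (mul_le_mul_of_nonneg_right (hc x y hxy) h6)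
        linear_combination c x y * (h4 + h5 - 2 * h3)
      · rw [hc0 x y hxy]; simp
    refine (Finset.sum_le_sum fun x _ => this x).trans (le_of_eq ?_)
    simp only [Finset.sum_const, Finset.card_univ, nsmul_eq_mul, Fintype.card_fun,
      ZMod.card, Fintype.card_fin]
    push_cast
    ring
  have hLd : (0 : ℝ) < (L : ℝ) ^ d := by
    have : (0 : ℝ) < L := by exact_mod_cast NeZero.pos L
    positivity
  have h2 : ε ^ 2 * ((L : ℝ) ^ d * ∑ s, g s * (torusChar a s).re) ≤ cmax * ((L : ℝ) ^ d * ε) := by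
    linarith
  rw [le_div_iff₀ hε0]
  have h3 : (ε * (L : ℝ) ^ d) * ((∑ s, g s * (torusChar a s).re) * ε) ≤ (ε * (L : ℝ) ^ d) * cmax := by
    linarith
  exact le_of_mul_le_mul_left h3 (by positivity)

/-- After the product-to-sum formula, orthogonality leaves `s = e` and `s = -e`, which contribute
equally because `g` is even. -/
lemma fourier_inversion {g : Torus d L → ℝ} (hg : ∀ x, g (-x) = g x) (e : Torus d L) :
    ∑ a, (torusChar a e).re * ∑ s, g s * (torusChar a s).re = (L : ℝ) ^ d * g e := by
  have h1 : ∀ a s : Torus d L, (torusChar a e).re * (g s * (torusChar a s).re) =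
      g s / 2 * (torusChar a (s + e)).re + g s / 2 * (torusChar a (s - e)).re := by
    intro a s
    rw [sub_eq_add_neg, torusChar_add, torusChar_add, torusChar_neg]
    simp only [Complex.mul_re, Complex.conj_re, Complex.conj_im]
    ring
  simp only [Finset.mul_sum, h1]
  rw [Finset.sum_comm]
  simp only [Finset.sum_add_distrib, ← Finset.mul_sum, sum_torusChar_re]
  have h2 : ∀ s : Torus d L, s + e = 0 ↔ s = -e := fun s => eq_neg_iff_add_eq_zero.symm
  simp only [h2, sub_eq_zero, mul_ite, mul_zero, Finset.sum_ite_eq', Finset.mem_univ, if_true, hg]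
  ring

/-- Add the inversion formulas at `0` and at the unit vector. The zero mode gives `2 * ∑ g`, and the
other modes carry `1 + cos k_1`. This weight is non-negative, so the infrared bound can be inserted
term by term. -/
lemma average_lower_bound [NeZero d] (hL : 2 < L) {Γ c : Torus d L → Torus d L → ℝ}
    {g : Torus d L → ℝ} {cmax : ℝ} (hg : ∀ x, g (-x) = g x)
    (hΓ : ∀ x y, Γ x y = g (y - x)) (hc0 : ∀ x y, ¬ (torusGraph d L).Adj x y → c x y = 0)
    (hc : ∀ x y, (torusGraph d L).Adj x y → c x y ≤ cmax)
    (hq : ∀ h, quad (torusGraph d L) Γ c h h ≤ 0) :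
    (g (unitVec d L 0) + g 0) / 2 - cmax * fourierSum d L ≤
      1 / (Fintype.card (Torus d L) : ℝ) * ∑ x, g x := by
  have hLd : (0 : ℝ) < (L : ℝ) ^ d := by
    have : (0 : ℝ) < L := by exact_mod_cast NeZero.pos L
    positivity
  have h1 := fourier_inversion hg (unitVec d L 0)
  have h2 := fourier_inversion hg 0
  have h3 : (L : ℝ) ^ d * (g (unitVec d L 0) + g 0) =
      2 * ∑ x, g x + ∑ a ∈ (Finset.univ : Finset (Torus d L)).erase 0,
        (1 + (torusChar a (unitVec d L 0)).re) * ∑ s, g s * (torusChar a s).re := by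
    rw [mul_add, ← h1, ← h2, ← Finset.sum_add_distrib, ← Finset.add_sum_erase _ _
      (Finset.mem_univ (0 : Torus d L))]
    congr 1
    · simp [torusChar]; ring
    · refine Finset.sum_congr rfl fun a _ => ?_
      rw [torusChar_zero, Complex.one_re]; ring
  have h4 : ∑ a ∈ (Finset.univ : Finset (Torus d L)).erase 0,
        (1 + (torusChar a (unitVec d L 0)).re) * ∑ s, g s * (torusChar a s).re ≤
      2 * cmax * ((L : ℝ) ^ d * fourierSum d L) := by
    rw [fourierSum_eq, ← mul_assoc ((L : ℝ) ^ d), mul_one_div_cancel hLd.ne', one_mul,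
      Finset.mul_sum]
    refine Finset.sum_le_sum fun a ha => ?_
    have h5 := infrared_bound hL hΓ hc0 hc hq (Finset.ne_of_mem_erase ha)
    have h6 : 0 ≤ 1 + (torusChar a (unitVec d L 0)).re := by
      rw [torusChar_unitVec, stdAddChar_re]
      linarith [Real.neg_one_le_cos (2 * Real.pi / L * (a 0).valMinAbs)]
    refine (mul_le_mul_of_nonneg_left h5 h6).trans_eq ?_
    have := (torusEpsilon_pos (Finset.ne_of_mem_erase ha)).ne'
    field_simp
  have h7 : (Fintype.card (Torus d L) : ℝ) = (L : ℝ) ^ d := by simp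
  rw [h7, one_div, inv_mul_eq_div, le_div_iff₀ hLd]
  linarith

end Fourier

/-! ### The lower bound for the two-point function -/

section Bounds

variable {d N L : ℕ} [NeZero d] [NeZero L] {v : (Fin d → ℤ) → ℝ} {U : ℕ → ℝ≥0} {lam : ℝ}

omit [NeZero d] [NeZero L] in
lemma adj_unitVec (hL : 1 < L) (j : Fin d) : (torusGraph d L).Adj 0 (unitVec d L j) :=
  (torus_adj hL).2 (.inl ⟨j, (zero_add _).symm⟩)

omit [NeZero d] in
lemma conductance_torus_le (hL : 1 < L) (hlam : 0 < lam) (hN : 1 < N) {e : ℝ}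
    (he : ∀ j, expectedLinks d L N U v lam j ≤ e) {x y : Torus d L}
    (hxy : (torusGraph d L).Adj x y) :
    conductance (torusGraph d L) N (periodic d L v) U lam x y ≤ 1 + 2 * e := by
  have key : ∀ (x : Torus d L) j, conductance (torusGraph d L) N (periodic d L v) U lam x
      (x + unitVec d L j) ≤ 1 + 2 * e := by
    intro x j
    have h := conductance_map (U := U) (N := N) hlam hN (translation hL x)
      (periodic_translation (v := v) hL x) 0 (unitVec d L j)
    rw [translation_apply, translation_apply, zero_add, add_comm] at h
    rw [h, conductance, if_pos (adj_unitVec hL j)]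
    have := he j
    rw [expectedLinks] at this
    linarith
  rcases (torus_adj hL).1 hxy with ⟨j, rfl⟩ | ⟨j, rfl⟩
  · exact key x j
  · rw [conductance_comm hlam hN]; exact key y j

lemma expectedLinks_perm (hL : 1 < L) (hlam : 0 < lam) (hN : 1 < N) (hv : PermInvariant v)
    (j : Fin d) : expectedLinks d L N U v lam j = expectedLinks d L N U v lam 0 := by
  have h := expectation_linkCount_map (U := U) (N := N) hlam hN (coordPerm hL (Equiv.swap 0 j))
    (periodic_coordPerm (v := v) hL hv _) (adj_unitVec hL 0)
  have h0 : coordPerm hL (Equiv.swap 0 j) (0 : Torus d L) = 0 := rfl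
  have h1 : coordPerm hL (Equiv.swap 0 j) (unitVec d L 0) = unitVec d L j := by
    have := unitVec_comp (L := L) (Equiv.swap 0 j) (0 : Fin d)
    rw [Equiv.symm_swap, Equiv.swap_apply_left] at this
    exact this
  rw [h0, h1] at h
  exact h

/-- Any common bound `e` on the expected link numbers serves: their maximum in general, and a single
one of them if the potential is permutation invariant. -/
lemma average_twoPoint_ge (hL : Even L) (hL2 : 2 < L) (hlam : 0 < lam) (hN : 1 < N)
    (hv : ∀ x, v (-x) = v x) (hsep : Separable L v) (hc : Controlled U (periodic d L v))
    (hZ : 0 < correlation (torusGraph d L) U (periodic d L v) lam (0 : Torus d L → Fin N → ℕ))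
    {e : ℝ} (he : ∀ j, expectedLinks d L N U v lam j ≤ e) :
    (torusTwoPoint d L N U v lam 0 (unitVec d L 0) + torusTwoPoint d L N U v lam 0 0) / 2
        - (1 + 2 * e) * fourierSum d L
      ≤ 1 / (Fintype.card (Torus d L) : ℝ) * ∑ x : Torus d L, torusTwoPoint d L N U v lam 0 x := by
  have hL1 : 1 < L := by omega
  have hΓ : ∀ x y, twoPoint (torusGraph d L) N U (periodic d L v) lam x y =
      torusTwoPoint d L N U v lam 0 (y - x) := by
    intro x y
    have h := twoPoint_map hc hlam hN (translation hL1 x) (periodic_translation hL1 x) 0 (y - x)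
    rw [translation_apply, translation_apply, zero_add, sub_add_cancel] at h
    exact h
  refine average_lower_bound hL2 (fun x => ?_) hΓ (fun x y hxy => if_neg hxy)
    (fun x y hxy => conductance_torus_le hL1 hlam hN he hxy)
    (quad_torus_nonpos hL hL2 hv hsep hc hlam hN hZ)
  rw [← zero_sub, ← hΓ x 0, twoPoint_comm hc hlam hN]
  rfl

lemma fourierSum_nonneg (L : ℕ) : 0 ≤ fourierSum d L := by
  refine mul_nonneg (by positivity) (Finset.sum_nonneg fun n _ => ?_)
  refine div_nonneg (sq_nonneg _) (mul_nonneg zero_le_two (Finset.sum_nonneg fun j _ => ?_))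
  linarith [Real.cos_le_one (dualPoint L n j)]

end Bounds

/-! ### Riemann sums of functions with an integrable singularity -/

section Riemann

lemma integrable_abs_rpow {r : ℝ} (hr : -1 < r) (a : ℝ) :
    Integrable (Set.indicator (Set.Icc (-a) a) fun t : ℝ => |t| ^ r) := by
  rw [integrable_indicator_iff measurableSet_Icc]
  have h1 : IntervalIntegrable (fun t : ℝ => |t| ^ r) volume 0 |a| := by
    refine (intervalIntegral.intervalIntegrable_rpow' hr (a := 0) (b := |a|)).congr ?_
    intro t ht
    rw [Set.uIoc_of_le (abs_nonneg a)] at ht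
    simp only [abs_of_pos ht.1]
  have h2 : IntervalIntegrable (fun t : ℝ => |t| ^ r) volume (-|a|) 0 := by
    have := (IntervalIntegrable.iff_comp_neg).1 h1
    simpa using this.symm
  have h3 := (intervalIntegrable_iff_integrableOn_Icc_of_le (by
    linarith [abs_nonneg a])).1 (h2.trans h1)
  exact h3.mono_set (Set.Icc_subset_Icc (by linarith [le_abs_self a]) (le_abs_self a))

variable {d : ℕ}

/-- In the supremum norm `|y i| ≤ ‖y‖`, so the power `-2` can be shared equally among the `d`
coordinates. The bound is a product of functions of one variable. -/
lemma inv_norm_sq_le (hd : 0 < d) {y : Fin d → ℝ} (hy : ∀ i, y i ≠ 0) :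
    1 / ‖y‖ ^ 2 ≤ ∏ i, |y i| ^ (-(2 / d : ℝ)) := by
  have hpos : 0 < ‖y‖ := by
    refine norm_pos_iff.2 fun h => hy ⟨0, hd⟩ ?_
    rw [h]; rfl
  have hd' : (0 : ℝ) < d := by exact_mod_cast hd
  have h1 : 1 / ‖y‖ ^ 2 = ∏ _i : Fin d, ‖y‖ ^ (-(2 / d : ℝ)) := by
    rw [Finset.prod_const, Finset.card_univ, Fintype.card_fin, ← Real.rpow_mul_natCast hpos.le,
      neg_mul, div_mul_cancel₀ _ hd'.ne', Real.rpow_neg hpos.le, one_div]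
    norm_cast
  rw [h1]
  refine Finset.prod_le_prod (fun i _ => by positivity) fun i _ => ?_
  refine Real.rpow_le_rpow_of_nonpos (abs_pos.2 (hy i)) (norm_le_pi_norm y i) ?_
  rw [neg_nonpos]; positivity

/-- An integrable function dominating the inverse square of the norm. -/
noncomputable def singularBound (d : ℕ) (y : Fin d → ℝ) : ℝ :=
  ∏ i, Set.indicator (Set.Icc (-2) 2) (fun t : ℝ => |t| ^ (-(2 / d : ℝ))) (y i)

/-- Here `d > 2` enters: the exponent `-(2 / d)` is above `-1`, so each factor is integrable. -/
lemma integrable_singularBound (hd : 2 < d) : Integrable (singularBound d) := by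
  refine Integrable.fintype_prod (f := fun _ : Fin d =>
    Set.indicator (Set.Icc (-2) 2) fun t : ℝ => |t| ^ (-(2 / d : ℝ))) fun i => ?_
  refine integrable_abs_rpow ?_ 2
  have hd' : (2 : ℝ) < d := by exact_mod_cast hd
  rw [neg_lt_neg_iff, div_lt_one (by linarith)]
  exact hd'

lemma inv_norm_sq_le_singularBound (hd : 0 < d) {y : Fin d → ℝ} (hy : ∀ i, y i ≠ 0)
    (hy2 : ‖y‖ ≤ 2) : 1 / ‖y‖ ^ 2 ≤ singularBound d y := by
  refine (inv_norm_sq_le hd hy).trans_eq (Finset.prod_congr rfl fun i _ => ?_)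
  rw [Set.indicator_of_mem]
  have := (norm_le_pi_norm y i).trans hy2
  exact abs_le.1 this

lemma ae_coord_ne (i : Fin d) (t : ℝ) : ∀ᵐ y : Fin d → ℝ, y i ≠ t :=
  compl_mem_ae_iff.2 (Measure.pi_hyperplane (fun _ : Fin d => (volume : Measure ℝ)) i t)

/-- The half-open cube of side length `1 / L` with upper corner `n / L`. -/
def cell (L : ℕ) (n : Fin d → ℤ) : Set (Fin d → ℝ) :=
  Set.univ.pi fun i => Set.Ioc ((n i - 1 : ℝ) / L) (n i / L)

lemma mem_cell {L : ℕ} (hL : 0 < L) {n : Fin d → ℤ} {y : Fin d → ℝ} :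
    y ∈ cell L n ↔ n = fun i => ⌈L * y i⌉ := by
  have hL' : (0 : ℝ) < L := by exact_mod_cast hL
  simp only [cell, Set.mem_univ_pi, Set.mem_Ioc, div_lt_iff₀ hL', le_div_iff₀ hL', funext_iff]
  refine forall_congr' fun i => ?_
  rw [eq_comm, Int.ceil_eq_iff, mul_comm (L : ℝ)]

lemma volume_cell {L : ℕ} (hL : 0 < L) (n : Fin d → ℤ) :
    volume.real (cell L n) = 1 / (L : ℝ) ^ d := by
  have hL' : (0 : ℝ) < L := by exact_mod_cast hL
  rw [Measure.real, cell, volume_pi_pi]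
  simp only [Real.volume_Ioc, ENNReal.toReal_prod]
  have : ∀ i : Fin d, ((n i : ℝ) / L - (n i - 1) / L) = 1 / L := fun i => by ring
  simp only [this, ENNReal.toReal_ofReal (one_div_pos.2 hL').le, Finset.prod_const,
    Finset.card_univ, Fintype.card_fin, one_div_pow]

/-- The step function with the values of `f` at the points `n / L`, where `n ∈ K`. -/
noncomputable def stepFun (L : ℕ) (K : Finset (Fin d → ℤ)) (f : (Fin d → ℝ) → ℝ)
    (y : Fin d → ℝ) : ℝ :=
  ∑ n ∈ K, (cell L n).indicator (fun _ => f fun i => n i / L) y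

lemma measurableSet_cell (L : ℕ) (n : Fin d → ℤ) : MeasurableSet (cell L n) :=
  MeasurableSet.univ_pi fun _ => measurableSet_Ioc

lemma volume_cell_lt_top (L : ℕ) (n : Fin d → ℤ) : volume (cell L n) < ⊤ := by
  rw [cell, volume_pi_pi]
  exact ENNReal.prod_lt_top fun i _ => by simp

lemma integral_stepFun {L : ℕ} (hL : 0 < L) (K : Finset (Fin d → ℤ)) (f : (Fin d → ℝ) → ℝ) :
    ∫ y, stepFun L K f y = 1 / (L : ℝ) ^ d * ∑ n ∈ K, f fun i => n i / L := by
  simp only [stepFun]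
  rw [integral_finsetSum, Finset.mul_sum]
  · refine Finset.sum_congr rfl fun n _ => ?_
    rw [integral_indicator (measurableSet_cell L n), setIntegral_const, volume_cell hL, smul_eq_mul]
  · intro n _
    rw [integrable_indicator_iff (measurableSet_cell L n)]
    exact integrableOn_const (volume_cell_lt_top L n).ne

lemma stepFun_apply {L : ℕ} (hL : 0 < L) (K : Finset (Fin d → ℤ)) (f : (Fin d → ℝ) → ℝ)
    (y : Fin d → ℝ) : stepFun L K f y =
      if (fun i => ⌈L * y i⌉) ∈ K then f (fun i => ⌈L * y i⌉ / L) else 0 := by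
  classical
  have h : ∀ n : Fin d → ℤ, (cell L n).indicator (fun _ => f fun i => n i / L) y =
      if n = (fun i => ⌈L * y i⌉) then f (fun i => n i / L) else 0 := fun n => by
    by_cases hn : y ∈ cell L n
    · rw [Set.indicator_of_mem hn, if_pos ((mem_cell hL).1 hn)]
    · rw [Set.indicator_of_notMem hn, if_neg (mt (mem_cell hL).2 hn)]
  simp only [stepFun, h, Finset.sum_ite_eq']

lemma measurable_stepFun (L : ℕ) (K : Finset (Fin d → ℤ)) (f : (Fin d → ℝ) → ℝ) :
    Measurable (stepFun L K f) :=
  Finset.measurable_fun_sum _ fun n _ => measurable_const.indicator (measurableSet_cell L n)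

lemma mem_dualIndex {L : ℕ} (n : Fin d → ℤ) :
    n ∈ dualIndex d L ↔ ∀ i, -(L : ℤ) < 2 * n i ∧ 2 * n i ≤ L := by
  simp only [dualIndex, Fintype.mem_piFinset, Finset.mem_filter, Finset.mem_Ioc]
  refine forall_congr' fun i => ?_
  constructor
  · exact fun h => h.2
  · rintro ⟨h1, h2⟩; refine ⟨⟨?_, ?_⟩, ?_, ?_⟩ <;> omega

/-- The open unit cube. -/
def unitBox (d : ℕ) : Set (Fin d → ℝ) := Set.univ.pi fun _ => Set.Ioo (-1 / 2) (1 / 2)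

lemma measurableSet_unitBox : MeasurableSet (unitBox d) :=
  MeasurableSet.univ_pi fun _ => measurableSet_Ioo

lemma tendsto_ceil_div (t : ℝ) : Tendsto (fun L : ℕ => (⌈L * t⌉ : ℝ) / L) atTop (𝓝 t) := by
  have h1 : Tendsto (fun L : ℕ => t + 1 / (L : ℝ)) atTop (𝓝 (t + 0)) :=
    tendsto_const_nhds.add tendsto_one_div_atTop_nhds_zero_nat
  rw [add_zero] at h1
  refine tendsto_of_tendsto_of_tendsto_of_le_of_le' tendsto_const_nhds h1 ?_ ?_
  · filter_upwards [eventually_gt_atTop 0] with L hL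
    have hL' : (0 : ℝ) < L := by exact_mod_cast hL
    rw [le_div_iff₀ hL', mul_comm]
    exact Int.le_ceil _
  · filter_upwards [eventually_gt_atTop 0] with L hL
    have hL' : (0 : ℝ) < L := by exact_mod_cast hL
    rw [div_le_iff₀ hL', add_mul, one_div_mul_cancel hL'.ne', mul_comm t]
    exact (Int.ceil_lt_add_one _).le

lemma dualIndex_norm_le {L : ℕ} (hL : 0 < L) {n : Fin d → ℤ} (hn : n ∈ dualIndex d L) (i : Fin d) :
    |(n i : ℝ) / L| ≤ 1 / 2 := by
  have hL' : (0 : ℝ) < L := by exact_mod_cast hL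
  have h := (mem_dualIndex n).1 hn i
  have h1 : -(L : ℝ) < 2 * n i := by exact_mod_cast h.1
  have h2 : 2 * (n i : ℝ) ≤ L := by exact_mod_cast h.2
  rw [abs_le, le_div_iff₀ hL', div_le_iff₀ hL']
  constructor <;> linarith

/-- A sampling point `z = n / L` with `n ≠ 0` has norm at least `1 / L`, and every `y` in its cell
is within `1 / L` of it. Hence `‖y‖ ≤ 2 ‖z‖`, and the bound at `z` passes to `y` at the cost of a
factor four, uniformly in `L`. -/
lemma stepFun_le (hd : 0 < d) {L : ℕ} (hL : 0 < L) {f : (Fin d → ℝ) → ℝ} {C : ℝ}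
    (hf : ∀ y, y ≠ 0 → (∀ i, |y i| ≤ 1 / 2) → |f y| ≤ C * (1 / ‖y‖ ^ 2))
    {y : Fin d → ℝ} (hy : ∀ i, y i ≠ 0) :
    ‖stepFun L ((dualIndex d L).erase 0) f y‖ ≤ 4 * |C| * singularBound d y := by
  have hL' : (0 : ℝ) < L := by exact_mod_cast hL
  have hs : 0 ≤ singularBound d y :=
    Finset.prod_nonneg fun i _ => Set.indicator_nonneg (fun t _ => by positivity) _
  rw [stepFun_apply hL]
  split_ifs with hn
  · set n : Fin d → ℤ := fun i => ⌈L * y i⌉ with hndef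
    set z : Fin d → ℝ := fun i => (n i : ℝ) / L with hz
    rw [Finset.mem_erase] at hn
    have hzb := fun i => dualIndex_norm_le hL hn.2 i
    obtain ⟨j, hj⟩ := Function.ne_iff.1 hn.1
    have hzj : 1 / (L : ℝ) ≤ ‖z‖ := by
      refine le_trans ?_ (norm_le_pi_norm z j)
      rw [hz, Real.norm_eq_abs, abs_div, abs_of_pos hL']
      have : (1 : ℝ) ≤ |(n j : ℝ)| := by exact_mod_cast Int.one_le_abs hj
      gcongr
    have hz0 : 0 < ‖z‖ := lt_of_lt_of_le (by positivity) hzj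
    have hzn : ‖z‖ ≤ 1 / 2 := (pi_norm_le_iff_of_nonneg (by norm_num)).2 hzb
    have hyz : ‖y - z‖ ≤ 1 / L := by
      refine (pi_norm_le_iff_of_nonneg (by positivity)).2 fun i => ?_
      have h1 := Int.le_ceil (L * y i)
      have h2 := (Int.ceil_lt_add_one (L * y i)).le
      rw [Pi.sub_apply, Real.norm_eq_abs, abs_le]
      have h3 : z i = (⌈L * y i⌉ : ℝ) / L := rfl
      have h4 : y i = L * y i / L := by field_simp
      rw [h3, h4, ← sub_div, ← neg_div]
      rw [mul_div_cancel_left₀ _ hL'.ne']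
      constructor
      · gcongr; linarith
      · gcongr; linarith
    have hy2 : ‖y‖ ≤ 2 * ‖z‖ := by
      have : ‖y‖ ≤ ‖y - z‖ + ‖z‖ := by simpa using norm_add_le (y - z) z
      linarith
    have hy0 : 0 < ‖y‖ := norm_pos_iff.2 fun h => hy ⟨0, hd⟩ (by rw [h]; rfl)
    calc ‖f z‖ ≤ C * (1 / ‖z‖ ^ 2) := hf z (norm_pos_iff.1 hz0) hzb
      _ ≤ |C| * (1 / ‖z‖ ^ 2) := by gcongr; exact le_abs_self C
      _ ≤ |C| * (4 * (1 / ‖y‖ ^ 2)) := by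
          gcongr
          rw [mul_one_div, div_le_div_iff₀ (by positivity) (by positivity)]
          nlinarith
      _ = 4 * |C| * (1 / ‖y‖ ^ 2) := by ring
      _ ≤ _ := by
          gcongr
          exact inv_norm_sq_le_singularBound hd hy (by linarith)
  · rw [norm_zero]; positivity

/-- The sampling points of the cells around `y` converge to `y`. Inside the open cube they are
eventually admissible, and outside the closed cube eventually not; the boundary hyperplanes are
excluded by hypothesis. -/
lemma tendsto_stepFun {f : (Fin d → ℝ) → ℝ} (hd : 0 < d)
    (hf : ∀ y, y ≠ 0 → y ∈ unitBox d → ContinuousAt f y) {y : Fin d → ℝ} (hy : ∀ i, y i ≠ 0)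
    (hy1 : ∀ i, y i ≠ 1 / 2) (hy2 : ∀ i, y i ≠ -1 / 2) :
    Tendsto (fun L : ℕ => stepFun L ((dualIndex d L).erase 0) f y) atTop
      (𝓝 ((unitBox d).indicator f y)) := by
  have hlim : Tendsto (fun L : ℕ => fun i => (⌈L * y i⌉ : ℝ) / L) atTop (𝓝 y) :=
    tendsto_pi_nhds.2 fun i => tendsto_ceil_div (y i)
  by_cases hbox : y ∈ unitBox d
  · have hy0 : y ≠ 0 := fun h => hy ⟨0, hd⟩ (by rw [h]; rfl)
    rw [Set.indicator_of_mem hbox]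
    have h1 : ∀ᶠ L : ℕ in atTop, (fun i => ⌈L * y i⌉) ∈ (dualIndex d L).erase 0 := by
      have h2 : ∀ᶠ L : ℕ in atTop, (fun i => (⌈L * y i⌉ : ℝ) / L) ∈ unitBox d :=
        hlim.eventually ((isOpen_set_pi Set.finite_univ fun _ _ => isOpen_Ioo).mem_nhds hbox)
      have h3 : ∀ᶠ L : ℕ in atTop, (fun i => (⌈L * y i⌉ : ℝ) / L) ≠ 0 := hlim.eventually_ne hy0
      filter_upwards [h2, h3, eventually_gt_atTop 0] with L h2 h3 hL
      have hL' : (0 : ℝ) < L := by exact_mod_cast hL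
      refine Finset.mem_erase.2 ⟨fun h => h3 (funext fun i => ?_), (mem_dualIndex _).2 fun i => ?_⟩
      · have := congr_fun h i
        simp only [Pi.zero_apply] at this
        simp [this]
      · have h4 := h2 i (Set.mem_univ i)
        simp only [Set.mem_Ioo, lt_div_iff₀ hL', div_lt_iff₀ hL'] at h4
        constructor
        · have : -(L : ℝ) < 2 * (⌈L * y i⌉ : ℝ) := by linarith
          exact_mod_cast this
        · have : 2 * (⌈L * y i⌉ : ℝ) ≤ L := by linarith
          exact_mod_cast this
    refine ((hf y hy0 hbox).tendsto.comp hlim).congr' ?_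
    filter_upwards [h1, eventually_gt_atTop 0] with L h1 hL
    rw [stepFun_apply hL, if_pos h1]
    rfl
  · rw [Set.indicator_of_notMem hbox]
    refine tendsto_const_nhds.congr' ?_
    have hex : ∃ i, 1 / 2 < |y i| := by
      by_contra hne
      push Not at hne
      refine hbox fun i _ => ?_
      have := abs_le.1 (hne i)
      exact ⟨lt_of_le_of_ne (by linarith) (hy2 i).symm, lt_of_le_of_ne this.2 (hy1 i)⟩
    obtain ⟨i, hi⟩ := hex
    have h1 : ∀ᶠ L : ℕ in atTop, 1 / 2 < |(⌈L * y i⌉ : ℝ) / L| :=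
      ((tendsto_ceil_div (y i)).abs).eventually (lt_mem_nhds hi)
    filter_upwards [h1, eventually_gt_atTop 0] with L h1 hL
    rw [stepFun_apply hL, if_neg]
    intro h
    exact absurd (dualIndex_norm_le hL (Finset.mem_of_mem_erase h) i) (not_le.2 h1)

/-- Convergence of Riemann sums. -/
theorem tendsto_riemannSum (hd : 2 < d) {f : (Fin d → ℝ) → ℝ} {C : ℝ}
    (hc : ∀ y, y ≠ 0 → y ∈ unitBox d → ContinuousAt f y)
    (hf : ∀ y, y ≠ 0 → (∀ i, |y i| ≤ 1 / 2) → |f y| ≤ C * (1 / ‖y‖ ^ 2)) :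
    Tendsto (fun L : ℕ => 1 / (L : ℝ) ^ d * ∑ n ∈ (dualIndex d L).erase 0, f fun i => n i / L)
      atTop (𝓝 (∫ y in unitBox d, f y)) := by
  rw [← integral_indicator measurableSet_unitBox]
  refine (tendsto_integral_filter_of_dominated_convergence
    (F := fun L : ℕ => stepFun L ((dualIndex d L).erase 0) f)
    (fun y => 4 * |C| * singularBound d y) ?_ ?_ ?_ ?_).congr' ?_
  · exact Eventually.of_forall fun L => (measurable_stepFun _ _ _).aestronglyMeasurable
  · filter_upwards [eventually_gt_atTop 0] with L hL
    filter_upwards [ae_all_iff.2 fun i : Fin d => ae_coord_ne i 0] with y hy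
    exact stepFun_le (by omega) hL hf hy
  · exact (integrable_singularBound hd).const_mul _
  · filter_upwards [ae_all_iff.2 fun i : Fin d => ae_coord_ne i 0,
      ae_all_iff.2 fun i : Fin d => ae_coord_ne i (1 / 2),
      ae_all_iff.2 fun i : Fin d => ae_coord_ne i (-1 / 2)] with y h0 h1 h2
    exact tendsto_stepFun (by omega) hc h0 h1 h2
  · filter_upwards [eventually_gt_atTop 0] with L hL
    exact integral_stepFun hL _ _

end Riemann

/-! ### Simple random walk -/

section Walk

variable {d : ℕ}

/-- The characteristic function of a step of simple random walk, in units of `2π`. -/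
noncomputable def walkSymbol (y : Fin d → ℝ) : ℝ := (∑ j, Real.cos (2 * Real.pi * y j)) / d

lemma continuous_walkSymbol : Continuous (walkSymbol (d := d)) := by
  unfold walkSymbol; fun_prop

lemma abs_walkSymbol_le (y : Fin d → ℝ) : |walkSymbol y| ≤ 1 := by
  rw [walkSymbol, abs_div, Nat.abs_cast]
  refine div_le_one_of_le₀ ?_ (Nat.cast_nonneg d)
  refine (Finset.abs_sum_le_sum_abs _ _).trans ?_
  refine (Finset.sum_le_sum fun j _ => Real.abs_cos_le_one _).trans ?_
  simp

lemma norm_sq_le_sum (y : Fin d → ℝ) : ‖y‖ ^ 2 ≤ ∑ j, y j ^ 2 := by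
  have h : ‖y‖ ≤ Real.sqrt (∑ j, y j ^ 2) := by
    refine (pi_norm_le_iff_of_nonneg (Real.sqrt_nonneg _)).2 fun i => ?_
    rw [Real.norm_eq_abs]
    refine Real.abs_le_sqrt ?_
    exact Finset.single_le_sum (f := fun j => y j ^ 2) (fun j _ => sq_nonneg _) (Finset.mem_univ i)
  calc ‖y‖ ^ 2 ≤ Real.sqrt (∑ j, y j ^ 2) ^ 2 := by gcongr
    _ = _ := Real.sq_sqrt (Finset.sum_nonneg fun j _ => sq_nonneg _)

/-- The bound `cos t ≤ 1 - 2 t² / π²` for `|t| ≤ π`, taken at `t = 2π y_j`, gives the term `8 y_j²`.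
-/
lemma one_sub_walkSymbol_ge (hd : 0 < d) {y : Fin d → ℝ} (hy : ∀ i, |y i| ≤ 1 / 2) :
    8 / d * ‖y‖ ^ 2 ≤ 1 - walkSymbol y := by
  have hd' : (0 : ℝ) < d := by exact_mod_cast hd
  have h1 : ∀ j, Real.cos (2 * Real.pi * y j) ≤ 1 - 8 * y j ^ 2 := by
    intro j
    have h := Real.cos_le_one_sub_mul_cos_sq (x := 2 * Real.pi * y j) (by
      rw [abs_mul, abs_of_pos (by positivity)]
      nlinarith [Real.pi_pos, hy j])
    refine h.trans (le_of_eq ?_)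
    have := Real.pi_ne_zero
    field_simp
    ring
  have h2 : ∑ j, Real.cos (2 * Real.pi * y j) ≤ d - 8 * ∑ j, y j ^ 2 := by
    refine (Finset.sum_le_sum fun j _ => h1 j).trans ?_
    rw [Finset.sum_sub_distrib, ← Finset.mul_sum]
    simp
  have h3 := norm_sq_le_sum y
  rw [walkSymbol, div_mul_eq_mul_div, div_le_iff₀ hd', sub_mul, div_mul_cancel₀ _ hd'.ne']
  linarith

lemma one_sub_walkSymbol_pos (hd : 0 < d) {y : Fin d → ℝ} (hy : ∀ i, |y i| ≤ 1 / 2)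
    (hy0 : y ≠ 0) : 0 < 1 - walkSymbol y := by
  have hd' : (0 : ℝ) < d := by exact_mod_cast hd
  have : 0 < ‖y‖ := norm_pos_iff.2 hy0
  exact lt_of_lt_of_le (by positivity) (one_sub_walkSymbol_ge hd hy)

lemma inv_one_sub_walkSymbol_le (hd : 0 < d) {y : Fin d → ℝ} (hy : ∀ i, |y i| ≤ 1 / 2)
    (hy0 : y ≠ 0) : 1 / (1 - walkSymbol y) ≤ d / 8 * (1 / ‖y‖ ^ 2) := by
  have hd' : (0 : ℝ) < d := by exact_mod_cast hd
  have hpos : 0 < ‖y‖ := norm_pos_iff.2 hy0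
  refine (one_div_le_one_div_of_le (by positivity) (one_sub_walkSymbol_ge hd hy)).trans_eq ?_
  field_simp

lemma mem_unitBox_abs {y : Fin d → ℝ} (hy : y ∈ unitBox d) (i : Fin d) : |y i| ≤ 1 / 2 := by
  have := hy i (Set.mem_univ i)
  rw [abs_le]
  constructor <;> linarith [this.1, this.2]

/-- The step of the walk on the torus. -/
def stepTorus (L : ℕ) (s : Fin d × Bool) : Torus d L := fun i => (walkStep s i : ZMod L)

lemma stepTorus_true (L : ℕ) (j : Fin d) : stepTorus L (j, true) = unitVec d L j := by
  funext i
  by_cases h : i = j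
  · subst h; simp [stepTorus, walkStep, unitVec]
  · simp [stepTorus, walkStep, unitVec, h]

lemma stepTorus_false (L : ℕ) (j : Fin d) : stepTorus L (j, false) = -unitVec d L j := by
  funext i
  by_cases h : i = j
  · subst h; simp [stepTorus, walkStep, unitVec]
  · simp [stepTorus, walkStep, unitVec, h]

lemma integral_uniformOn_univ {Ω : Type*} [Fintype Ω] [Nonempty Ω] [MeasurableSpace Ω]
    [MeasurableSingletonClass Ω] (f : Ω → ℂ) :
    ∫ s, f s ∂(uniformOn (Set.univ : Set Ω)) = (∑ s, f s) / Fintype.card Ω := by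
  rw [uniformOn, ProbabilityTheory.cond, Measure.restrict_univ, integral_smul_measure, integral_count,
    Measure.count_univ, ENat.card_eq_coe_fintype_card]
  simp [div_eq_inv_mul]

lemma integral_prod_walkLaw [NeZero d] (F : Fin d × Bool → ℂ) (n : ℕ) :
    ∫ ω, ∏ i ∈ Finset.range n, F (ω i) ∂(walkLaw d) =
      ((∑ s, F s) / Fintype.card (Fin d × Bool)) ^ n := by
  have : IsProbabilityMeasure (uniformOn (Set.univ : Set (Fin d × Bool))) :=
    isProbabilityMeasure_uniformOn Set.finite_univ Set.univ_nonempty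
  have h1 : ∀ ω : ℕ → Fin d × Bool, ∏ i ∈ Finset.range n, F (ω i) =
      ∏ i : Finset.range n, F ((Finset.range n).restrict ω i) := fun ω =>
    (Finset.prod_coe_sort (Finset.range n) fun i => F (ω i)).symm
  have h2 := integral_map (μ := walkLaw d) (φ := (Finset.range n).restrict)
    (f := fun y : (Finset.range n) → Fin d × Bool => ∏ i, F (y i))
    (Finset.measurable_restrict _).aemeasurable (measurable_of_finite _).aestronglyMeasurable
  simp only [h1]
  rw [walkLaw] at h2 ⊢
  rw [← h2, Measure.infinitePi_map_restrict, integral_fintype_prod_eq_prod (fun _ => F)]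
  simp only [integral_uniformOn_univ, Finset.prod_const, Finset.card_univ, Fintype.card_coe,
    Finset.card_range]

lemma abs_walkPos_le (ω : ℕ → Fin d × Bool) (n : ℕ) (i : Fin d) : |walkPos ω n i| ≤ n := by
  rw [walkPos, Finset.sum_apply]
  refine (Finset.abs_sum_le_sum_abs _ _).trans ?_
  have : ∀ s : Fin d × Bool, |walkStep s i| ≤ 1 := by
    intro s
    by_cases h : i = s.1
    · simp only [walkStep, h, Pi.single_eq_same]; split_ifs <;> simp
    · simp [walkStep, h]
  refine (Finset.sum_le_sum fun k _ => this (ω k)).trans ?_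
  simp

lemma measurable_walkPos (n : ℕ) : Measurable fun ω : ℕ → Fin d × Bool => walkPos ω n :=
  Finset.measurable_fun_sum _ fun i _ => (measurable_of_finite walkStep).comp (measurable_pi_apply i)

lemma measurableSet_return (n : ℕ) : MeasurableSet {ω : ℕ → Fin d × Bool | walkPos ω n = 0} :=
  measurable_walkPos n (measurableSet_singleton 0)

lemma sum_torusChar_step {L : ℕ} [NeZero L] (a : Torus d L) :
    (∑ s, torusChar a (stepTorus L s)) / (Fintype.card (Fin d × Bool) : ℂ) =
      (walkSymbol fun i => ((a i).valMinAbs : ℝ) / L : ℝ) := by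
  rw [Fintype.sum_prod_type]
  have h : ∀ j, ∑ b, torusChar a (stepTorus L (j, b)) =
      ((2 * Real.cos (2 * Real.pi * ((a j).valMinAbs / L)) : ℝ) : ℂ) := by
    intro j
    rw [Fintype.sum_bool, stepTorus_true, stepTorus_false, torusChar_neg, Complex.add_conj,
      torusChar_unitVec, stdAddChar_re]
    congr 3
    ring
  simp only [h, walkSymbol, Fintype.card_prod, Fintype.card_fin, Fintype.card_bool]
  rw [← Complex.ofReal_sum, ← Finset.mul_sum]
  push_cast
  rw [mul_comm (d : ℂ) 2, mul_div_mul_left _ _ two_ne_zero]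

/-- In fewer than `L` steps the walk cannot wind around the torus, so returning to the origin is the
same on the torus as on the lattice. There it is detected by orthogonality of characters, whose
expectations factorise over the independent steps. -/
lemma return_eq_sum [NeZero d] {L n : ℕ} [NeZero L] (hn : n < L) :
    (walkLaw d).real {ω | walkPos ω n = 0} =
      1 / (L : ℝ) ^ d * ∑ a : Torus d L, walkSymbol (fun i => ((a i).valMinAbs : ℝ) / L) ^ n := by
  have : IsProbabilityMeasure (uniformOn (Set.univ : Set (Fin d × Bool))) :=
    isProbabilityMeasure_uniformOn Set.finite_univ Set.univ_nonempty
  have : IsProbabilityMeasure (walkLaw d) := by unfold walkLaw; infer_instance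
  have hL : (L : ℂ) ^ d ≠ 0 := pow_ne_zero _ (by exact_mod_cast NeZero.ne L)
  have h0 : ∀ ω : ℕ → Fin d × Bool, (∑ i ∈ Finset.range n, stepTorus L (ω i)) = 0 ↔
      walkPos ω n = 0 := by
    intro ω
    have h1 : (∑ i ∈ Finset.range n, stepTorus L (ω i)) =
        fun i => ((walkPos ω n i : ℤ) : ZMod L) := by
      funext i
      simp [stepTorus, walkPos, Finset.sum_apply]
    rw [h1]
    constructor
    · intro h
      funext i
      have h2 := congr_fun h i
      simp only [Pi.zero_apply, ZMod.intCast_zmod_eq_zero_iff_dvd] at h2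
      have h3 := abs_walkPos_le ω n i
      refine Int.eq_zero_of_abs_lt_dvd h2 ?_
      omega
    · intro h; rw [h]; funext i; simp
  have h1 : ∀ ω : ℕ → Fin d × Bool, {ω | walkPos ω n = 0}.indicator (fun _ => (1 : ℂ)) ω =
      1 / (L : ℂ) ^ d * ∑ a : Torus d L, ∏ i ∈ Finset.range n, torusChar a (stepTorus L (ω i)) := by
    intro ω
    have h2 : ∀ a : Torus d L, ∏ i ∈ Finset.range n, torusChar a (stepTorus L (ω i)) =
        torusChar a (∑ i ∈ Finset.range n, stepTorus L (ω i)) := by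
      intro a
      induction Finset.range n using Finset.induction_on with
      | empty => simp [torusChar_zero]
      | insert i F hi ih => rw [Finset.sum_insert hi, Finset.prod_insert hi, torusChar_add, ih]
    simp only [h2, sum_torusChar, h0, Set.indicator_apply, Set.mem_ofPred_eq]
    split_ifs
    · rw [one_div_mul_cancel hL]
    · rw [mul_zero]
  have h2 : ((walkLaw d).real {ω | walkPos ω n = 0} : ℂ) =
      ∫ ω, {ω | walkPos ω n = 0}.indicator (fun _ => (1 : ℂ)) ω ∂(walkLaw d) := by
    rw [integral_indicator_const _ (measurableSet_return n)]
    simp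
  simp only [h1] at h2
  rw [integral_const_mul, integral_finsetSum] at h2
  · rw [Finset.sum_congr rfl fun a _ => (integral_prod_walkLaw (fun s =>
      torusChar a (stepTorus L s)) n).trans (by rw [sum_torusChar_step])] at h2
    refine Complex.ofReal_injective (h2.trans ?_)
    rw [Complex.ofReal_mul, Complex.ofReal_sum]
    simp only [Complex.ofReal_div, Complex.ofReal_pow, Complex.ofReal_one, Complex.ofReal_natCast]
  · intro a _
    refine Integrable.of_bound (C := 1) ?_ (ae_of_all _ fun ω => ?_)
    · refine (Finset.measurable_fun_prod _ fun i _ => ?_).aestronglyMeasurable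
      exact (measurable_of_finite fun s => torusChar a (stepTorus L s)).comp (measurable_pi_apply i)
    · rw [norm_prod]
      refine Finset.prod_le_one (fun _ _ => norm_nonneg _) fun i _ => ?_
      have := torusChar_mul_conj a (stepTorus L (ω i))
      rw [Complex.mul_conj'] at this
      have h3 : ‖torusChar a (stepTorus L (ω i))‖ ^ 2 = 1 := by exact_mod_cast this
      nlinarith [norm_nonneg (torusChar a (stepTorus L (ω i)))]

/-- The formula of `return_eq_sum` is exact for all `L > n`, so its Riemann sums are eventually
constant and their limit is the integral. -/
lemma return_eq_integral [NeZero d] (hd : 2 < d) (n : ℕ) :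
    (walkLaw d).real {ω | walkPos ω n = 0} = ∫ y in unitBox d, walkSymbol y ^ n := by
  have h1 := tendsto_riemannSum hd (f := fun y => walkSymbol y ^ n) (C := 1)
    (fun y _ _ => (continuous_walkSymbol.pow n).continuousAt) (fun y hy0 hy => by
      have h2 : |walkSymbol y ^ n| ≤ 1 := by
        rw [abs_pow]; exact pow_le_one₀ (abs_nonneg _) (abs_walkSymbol_le y)
      have h3 : ‖y‖ ≤ 1 / 2 := (pi_norm_le_iff_of_nonneg (by norm_num)).2 hy
      have h4 : 0 < ‖y‖ := norm_pos_iff.2 hy0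
      rw [one_mul]
      refine h2.trans ((one_le_div (by positivity)).2 ?_)
      nlinarith)
  -- The zero frequency is missing from the Riemann sums; it contributes `(1 / L) ^ d`.
  have h2 : Tendsto (fun L : ℕ => (1 / (L : ℝ)) ^ d) atTop (𝓝 0) := by
    have := (tendsto_one_div_atTop_nhds_zero_nat (𝕜 := ℝ)).pow d
    rwa [zero_pow (by omega)] at this
  have h3 := h1.add h2
  rw [add_zero] at h3
  refine tendsto_nhds_unique (tendsto_const_nhds.congr' ?_) h3
  filter_upwards [eventually_gt_atTop n] with L hL
  have : NeZero L := ⟨by omega⟩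
  rw [return_eq_sum hL, dualIndex_sum fun n' => walkSymbol (fun i => (n' i : ℝ) / L) ^ n,
    ← Finset.add_sum_erase _ _ (Finset.mem_univ (0 : Torus d L))]
  have h4 : walkSymbol (fun i => (((0 : Torus d L) i).valMinAbs : ℝ) / L) = 1 := by
    have : (d : ℝ) ≠ 0 := by exact_mod_cast NeZero.ne d
    simp [walkSymbol, this]
  rw [h4, one_pow, one_div_pow]
  ring

lemma integrableOn_inv_one_sub (hd : 2 < d) :
    IntegrableOn (fun y : Fin d → ℝ => 1 / (1 - walkSymbol y)) (unitBox d) := by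
  refine Integrable.mono' (((integrable_singularBound hd).const_mul (d / 8 : ℝ)).integrableOn) ?_ ?_
  · exact (measurable_const.div (measurable_const.sub
      continuous_walkSymbol.measurable)).aestronglyMeasurable
  · filter_upwards [ae_restrict_mem measurableSet_unitBox,
      ae_restrict_of_ae (ae_all_iff.2 fun i : Fin d => ae_coord_ne i 0)] with y hy hy0
    have hb := mem_unitBox_abs hy
    have hne : y ≠ 0 := fun h => hy0 ⟨0, by omega⟩ (by rw [h]; rfl)
    rw [Real.norm_of_nonneg (one_div_pos.2 (one_sub_walkSymbol_pos (by omega) hb hne)).le]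
    refine (inv_one_sub_walkSymbol_le (by omega) hb hne).trans ?_
    gcongr
    refine inv_norm_sq_le_singularBound (by omega) hy0 ?_
    exact (pi_norm_le_iff_of_nonneg (by norm_num)).2 fun i => (hb i).trans (by norm_num)

lemma volume_unitBox_lt_top : volume (unitBox d) < ⊤ := by
  rw [unitBox, volume_pi_pi]
  exact ENNReal.prod_lt_top fun i _ => by simp

/-- Sum the geometric series under the integral. Its partial sums `(1 - φ^N) / (1 - φ)` are
dominated by `2 / (1 - φ)`, which is integrable for `d > 2`. -/
lemma hasSum_return [NeZero d] (hd : 2 < d) :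
    HasSum (fun n => (walkLaw d).real {ω | walkPos ω n = 0})
      (∫ y in unitBox d, 1 / (1 - walkSymbol y)) := by
  rw [hasSum_iff_tendsto_nat_of_nonneg fun n => measureReal_nonneg]
  simp only [return_eq_integral hd]
  have hint : ∀ n, IntegrableOn (fun y : Fin d → ℝ => walkSymbol y ^ n) (unitBox d) := fun n =>
    Measure.integrableOn_of_bounded (M := 1) volume_unitBox_lt_top.ne
      (continuous_walkSymbol.pow n).aestronglyMeasurable (ae_of_all _ fun y => by
        rw [Real.norm_eq_abs, abs_pow]; exact pow_le_one₀ (abs_nonneg _) (abs_walkSymbol_le y))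
  have hne : ∀ᵐ y ∂volume.restrict (unitBox d), 0 < 1 - walkSymbol y := by
    filter_upwards [ae_restrict_mem measurableSet_unitBox,
      ae_restrict_of_ae (ae_coord_ne (⟨0, by omega⟩ : Fin d) 0)] with y hy hy0
    exact one_sub_walkSymbol_pos (by omega) (mem_unitBox_abs hy) fun h => hy0 (by rw [h]; rfl)
  have hlt : ∀ᵐ y ∂volume.restrict (unitBox d), |walkSymbol y| < 1 := by
    filter_upwards [hne, ae_restrict_mem measurableSet_unitBox,
      ae_restrict_of_ae (ae_coord_ne (⟨0, by omega⟩ : Fin d) 0)] with y hy hyb hy0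
    rw [abs_lt]
    refine ⟨?_, by linarith⟩
    -- In the open cube no coordinate reaches `±1/2`, so the symbol does not attain `-1`, where the
    -- geometric series would fail to converge.
    have hcos : -1 < Real.cos (2 * Real.pi * y ⟨0, by omega⟩) := by
      have h1 := hyb ⟨0, by omega⟩ (Set.mem_univ _)
      refine lt_of_le_of_ne (Real.neg_one_le_cos _) fun h => ?_
      rw [← Real.cos_abs] at h
      have h2 : |2 * Real.pi * y ⟨0, by omega⟩| < Real.pi := by
        rw [abs_mul, abs_of_pos (by positivity)]
        have : |y ⟨0, by omega⟩| < 1 / 2 := abs_lt.2 ⟨by linarith [h1.1], h1.2⟩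
        nlinarith [Real.pi_pos]
      have := Real.cos_lt_cos_of_nonneg_of_le_pi (abs_nonneg _) le_rfl h2
      rw [Real.cos_pi] at this
      linarith
    have hd' : (0 : ℝ) < d := by exact_mod_cast (by omega : 0 < d)
    rw [walkSymbol, lt_div_iff₀ hd']
    have h3 : ∑ _j : Fin d, (-1 : ℝ) < ∑ j, Real.cos (2 * Real.pi * y j) :=
      Finset.sum_lt_sum (fun j _ => Real.neg_one_le_cos _) ⟨_, Finset.mem_univ _, hcos⟩
    simpa using h3
  have hsum : ∀ N, ∑ n ∈ Finset.range N, ∫ y in unitBox d, walkSymbol y ^ n =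
      ∫ y in unitBox d, ∑ n ∈ Finset.range N, walkSymbol y ^ n := fun N =>
    (integral_finsetSum _ fun n _ => hint n).symm
  simp only [hsum]
  refine tendsto_integral_of_dominated_convergence (fun y => 2 * (1 / (1 - walkSymbol y))) ?_ ?_ ?_ ?_
  · exact fun N => (continuous_finsetSum _ fun n _ =>
      continuous_walkSymbol.pow n).aestronglyMeasurable
  · exact (integrableOn_inv_one_sub hd).const_mul 2
  · intro N
    filter_upwards [hne] with y hy
    have h1 : (∑ n ∈ Finset.range N, walkSymbol y ^ n) = (1 - walkSymbol y ^ N) / (1 - walkSymbol y) := by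
      rw [eq_div_iff hy.ne', geom_sum_mul_neg]
    rw [h1, norm_div, Real.norm_of_nonneg hy.le, mul_one_div]
    gcongr
    refine (norm_sub_le _ _).trans ?_
    rw [norm_one, norm_pow, Real.norm_eq_abs]
    have := pow_le_one₀ (n := N) (abs_nonneg _) (abs_walkSymbol_le y)
    linarith
  · filter_upwards [hlt] with y hy
    have := (hasSum_geometric_of_abs_lt_one hy).tendsto_sum_nat
    rwa [← one_div] at this

lemma expectedVisits_eq [NeZero d] (hd : 2 < d) :
    expectedVisits d 0 = ENNReal.ofReal (∫ y in unitBox d, 1 / (1 - walkSymbol y)) := by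
  classical
  have : IsProbabilityMeasure (uniformOn (Set.univ : Set (Fin d × Bool))) :=
    isProbabilityMeasure_uniformOn Set.finite_univ Set.univ_nonempty
  have : IsProbabilityMeasure (walkLaw d) := by unfold walkLaw; infer_instance
  have h := hasSum_return (d := d) hd
  rw [← h.tsum_eq, ENNReal.ofReal_tsum_of_nonneg (fun n => measureReal_nonneg) h.summable,
    expectedVisits]
  have h1 : ∀ n, (fun ω : ℕ → Fin d × Bool => if walkPos ω n = 0 then (1 : ℝ≥0∞) else 0) =
      {ω | walkPos ω n = 0}.indicator 1 := fun n => by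
    funext ω
    simp only [Set.indicator_apply, Set.mem_ofPred_eq, Pi.one_apply]
  rw [lintegral_tsum fun n => by
    have := h1 n
    refine Measurable.aemeasurable ?_
    convert measurable_one.indicator (measurableSet_return n) using 1]
  refine tsum_congr fun n => ?_
  rw [ofReal_measureReal, ← lintegral_indicator_one (measurableSet_return n)]
  refine lintegral_congr fun ω => ?_
  simp only [Set.indicator_apply, Set.mem_ofPred_eq, Pi.one_apply]

theorem expectedVisits_ne_top [NeZero d] (hd : 2 < d) : expectedVisits d 0 ≠ ⊤ := by
  rw [expectedVisits_eq hd]; exact ENNReal.ofReal_ne_top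

lemma toReal_expectedVisits [NeZero d] (hd : 2 < d) :
    (expectedVisits d 0).toReal = ∫ y in unitBox d, 1 / (1 - walkSymbol y) := by
  rw [expectedVisits_eq hd, ENNReal.toReal_ofReal]
  exact (hasSum_return hd).nonneg fun n => measureReal_nonneg

/-! ### The limit of the Fourier sums -/

lemma epsilon_dualPoint [NeZero d] (L : ℕ) (n : Fin d → ℤ) :
    epsilon (dualPoint L n) = 2 * d * (1 - walkSymbol fun i => (n i : ℝ) / L) := by
  have hd : (d : ℝ) ≠ 0 := by exact_mod_cast NeZero.ne d
  have h : ∀ j, dualPoint L n j = 2 * Real.pi * ((n j : ℝ) / L) := fun j => by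
    simp only [dualPoint]; ring
  simp only [epsilon, h, walkSymbol, Finset.sum_sub_distrib, Finset.sum_const, Finset.card_univ,
    Fintype.card_fin, nsmul_eq_mul, mul_one]
  field_simp

lemma sum_dualIndex_perm (L : ℕ) (σ : Equiv.Perm (Fin d)) (f : (Fin d → ℤ) → ℝ) :
    ∑ n ∈ (dualIndex d L).erase 0, f (fun i => n (σ i)) = ∑ n ∈ (dualIndex d L).erase 0, f n := by
  refine Finset.sum_equiv (σ.symm.arrowCongr (Equiv.refl ℤ)) (fun n => ?_) fun n _ => rfl
  have h : (σ.symm.arrowCongr (Equiv.refl ℤ)) n = fun i => n (σ i) := rfl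
  rw [Finset.mem_erase, Finset.mem_erase, h, mem_dualIndex, mem_dualIndex]
  refine and_congr (not_congr ⟨fun h => ?_, fun h => ?_⟩) ⟨fun h i => h (σ i), fun h i => ?_⟩
  · rw [h]; rfl
  · funext i
    have := congr_fun h (σ.symm i)
    simpa using this
  · simpa using h (σ.symm i)

/-- After the half-angle formula, symmetry of the index set allows `cos k_1` to be replaced by its
average `φ` over the coordinates. Then `φ / (1 - φ) = 1 / (1 - φ) - 1`, and the subtracted ones are
counted by the `L^d - 1` nonzero frequencies. -/
lemma fourierSum_eq_walkSymbol [NeZero d] {L : ℕ} [NeZero L] :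
    fourierSum d L = (2 * (1 / (L : ℝ) ^ d * ∑ n ∈ (dualIndex d L).erase 0,
      1 / (1 - walkSymbol fun i => (n i : ℝ) / L)) - (1 - (1 / (L : ℝ)) ^ d)) / (4 * d) := by
  have hd : (d : ℝ) ≠ 0 := by exact_mod_cast NeZero.ne d
  have hdpos : 0 < d := NeZero.pos d
  have hL : (L : ℝ) ≠ 0 := by exact_mod_cast NeZero.ne L
  set K := (dualIndex d L).erase 0 with hK
  set φ : (Fin d → ℤ) → ℝ := fun n => walkSymbol fun i => (n i : ℝ) / L with hφ
  have hpos : ∀ n ∈ K, 0 < 1 - φ n := by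
    intro n hn
    rw [hK, Finset.mem_erase] at hn
    refine one_sub_walkSymbol_pos hdpos (fun i => dualIndex_norm_le (NeZero.pos L) hn.2 i) ?_
    intro h
    refine hn.1 (funext fun i => ?_)
    have := congr_fun h i
    simpa [hL] using this
  have hperm : ∀ (σ : Equiv.Perm (Fin d)) n, φ (fun i => n (σ i)) = φ n := by
    intro σ n
    simp only [hφ, walkSymbol]
    rw [Equiv.sum_comp σ fun j => Real.cos (2 * Real.pi * ((n j : ℝ) / L))]
  have hsymm : ∀ j, ∑ n ∈ K, Real.cos (2 * Real.pi * (n j / L)) / (1 - φ n) =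
      ∑ n ∈ K, Real.cos (2 * Real.pi * (n 0 / L)) / (1 - φ n) := by
    intro j
    rw [← sum_dualIndex_perm L (Equiv.swap 0 j) fun n =>
      Real.cos (2 * Real.pi * (n j / L)) / (1 - φ n)]
    simp only [hperm, Equiv.swap_apply_right]
    rfl
  have hcos : ∑ n ∈ K, Real.cos (2 * Real.pi * (n 0 / L)) / (1 - φ n) =
      ∑ n ∈ K, φ n / (1 - φ n) := by
    have h1 : (d : ℝ) * ∑ n ∈ K, Real.cos (2 * Real.pi * (n 0 / L)) / (1 - φ n) =
        d * ∑ n ∈ K, φ n / (1 - φ n) := by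
      calc _ = ∑ j : Fin d, ∑ n ∈ K, Real.cos (2 * Real.pi * (n j / L)) / (1 - φ n) := by
            rw [Finset.sum_congr rfl fun j _ => hsymm j]; simp
        _ = _ := by
            rw [Finset.sum_comm, Finset.mul_sum]
            refine Finset.sum_congr rfl fun n _ => ?_
            rw [← Finset.sum_div, ← mul_div_assoc]
            congr 1
            simp only [hφ, walkSymbol]
            field_simp
    exact mul_left_cancel₀ hd h1
  have hcard : ∑ n ∈ K, (1 : ℝ) = (L : ℝ) ^ d - 1 := by
    rw [hK, dualIndex_sum (L := L) fun _ => (1 : ℝ)]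
    rw [Finset.sum_const, Finset.card_erase_of_mem (Finset.mem_univ _), Finset.card_univ,
      nsmul_eq_mul, mul_one, Nat.cast_sub Fintype.card_pos]
    simp
  have hterm : ∀ n ∈ K, Real.cos (dualPoint L n 0 / 2) ^ 2 / epsilon (dualPoint L n) =
      (1 / (1 - φ n) + Real.cos (2 * Real.pi * (n 0 / L)) / (1 - φ n)) / (4 * d) := by
    intro n hn
    have h1 : 2 * (dualPoint L n 0 / 2) = 2 * Real.pi * (n 0 / L) := by
      simp only [dualPoint]; ring
    have h2 := (hpos n hn).ne'
    rw [epsilon_dualPoint, Real.cos_sq, h1]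
    change _ / (2 * d * (1 - φ n)) = _
    field_simp
    ring
  have hφ1 : ∑ n ∈ K, φ n / (1 - φ n) = ∑ n ∈ K, 1 / (1 - φ n) - ((L : ℝ) ^ d - 1) := by
    rw [← hcard, ← Finset.sum_sub_distrib]
    refine Finset.sum_congr rfl fun n hn => ?_
    have h2 := (hpos n hn).ne'
    field_simp
    ring
  rw [fourierSum, Finset.sum_congr rfl hterm, ← Finset.sum_div, Finset.sum_add_distrib, hcos, hφ1]
  have hLd : (1 / (L : ℝ)) ^ d * (L : ℝ) ^ d = 1 := by rw [← mul_pow, one_div_mul_cancel hL, one_pow]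
  rw [← one_div_pow]
  linear_combination -(1 / (4 * d : ℝ)) * hLd

theorem tendsto_fourierSum [NeZero d] (hd : 2 < d) :
    Tendsto (fun L : ℕ => fourierSum d L) atTop
      (𝓝 ((2 * (expectedVisits d 0).toReal - 1) / (4 * d))) := by
  have h1 := tendsto_riemannSum hd (f := fun y => 1 / (1 - walkSymbol y)) (C := d / 8)
    (fun y hy0 hy => continuousAt_const.div (continuous_const.sub
      continuous_walkSymbol).continuousAt
        (one_sub_walkSymbol_pos (by omega) (mem_unitBox_abs hy) hy0).ne')
    (fun y hy0 hy => by
      rw [abs_of_pos (one_div_pos.2 (one_sub_walkSymbol_pos (by omega) hy hy0))]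
      exact inv_one_sub_walkSymbol_le (by omega) hy hy0)
  have h2 : Tendsto (fun L : ℕ => (1 / (L : ℝ)) ^ d) atTop (𝓝 0) := by
    have := (tendsto_one_div_atTop_nhds_zero_nat (𝕜 := ℝ)).pow d
    rwa [zero_pow (by omega)] at this
  have h3 := ((h1.const_mul 2).sub (h2.const_sub 1)).div_const (4 * d : ℝ)
  rw [sub_zero, ← toReal_expectedVisits hd] at h3
  refine h3.congr' ?_
  filter_upwards [eventually_gt_atTop 0] with L hL
  have : NeZero L := ⟨by omega⟩
  exact fourierSum_eq_walkSymbol.symm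

end Walk

end RPM

theorem theorem7 (d N L : ℕ) [NeZero d] [NeZero L] (hd : 2 < d) (hN : 1 < N)
    (hL : Even L) (hL2 : 2 < L) (lam : ℝ) (hlam : 0 < lam)
    (v : (Fin d → ℤ) → ℝ) (hsymm : ∀ x, v (-x) = v x)
    (htemp : RPM.Tempered v) (hsep : RPM.Separable L v)
    (U : ℕ → ℝ≥0) (hgood : RPM.Good v U) (hrange : 2 ≤ RPM.weightRange U) :
    -- the partition function, the two-point function and the expectations are well defined
    (0 < RPM.partitionClosed (RPM.torusGraph d L) N U (RPM.periodic d L v) lam ∧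
      Summable (fun w : RPM.Config (RPM.torusGraph d L) N =>
        RPM.weight U (RPM.periodic d L v) lam w) ∧
      ∀ j : Fin d, Summable (fun w : RPM.Config (RPM.torusGraph d L) N =>
        RPM.weight U (RPM.periodic d L v) lam w *
          (w.linkCount 0 (RPM.unitVec d L j) 1 : ℝ))) ∧
    -- the bound for potentials that are invariant under permutations of the coordinates
    (RPM.PermInvariant v →
      (RPM.torusTwoPoint d L N U v lam 0 (RPM.unitVec d L 0) +
          RPM.torusTwoPoint d L N U v lam 0 0) / 2
        - (1 + 2 * RPM.expectedLinks d L N U v lam 0) * RPM.fourierSum d L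
      ≤ 1 / (Fintype.card (RPM.Torus d L) : ℝ) *
          ∑ x : RPM.Torus d L, RPM.torusTwoPoint d L N U v lam 0 x) ∧
    -- the bound for arbitrary potentials
    ((RPM.torusTwoPoint d L N U v lam 0 (RPM.unitVec d L 0) +
          RPM.torusTwoPoint d L N U v lam 0 0) / 2
        - (1 + 2 * ⨆ j : Fin d, RPM.expectedLinks d L N U v lam j) * RPM.fourierSum d L
      ≤ 1 / (Fintype.card (RPM.Torus d L) : ℝ) *
          ∑ x : RPM.Torus d L, RPM.torusTwoPoint d L N U v lam 0 x) ∧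
    -- the Fourier sums are non-negative and converge
    (∀ L' : ℕ, 0 ≤ RPM.fourierSum d L') ∧
    RPM.expectedVisits d 0 ≠ ⊤ ∧
    Tendsto (fun L' : ℕ => RPM.fourierSum d L') atTop
      (𝓝 ((2 * (RPM.expectedVisits d 0).toReal - 1) / (4 * d))) := by
  have hL1 : 1 < L := by omega
  have hc : RPM.Controlled U (RPM.periodic d L v) := RPM.controlled_periodic hsymm htemp hgood
  have hZ := RPM.correlation_zero_pos (N := N) hL2 hc (RPM.weight_one_pos hgood hrange) hlam hN
  refine ⟨⟨?_, RPM.summable_weight hc hlam, fun j =>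
    RPM.summable_weight_mul_linkCount hc hlam _ _ _⟩, fun hperm => ?_, ?_,
    RPM.fourierSum_nonneg, RPM.expectedVisits_ne_top hd, RPM.tendsto_fourierSum hd⟩
  · rw [RPM.partitionClosed_eq hlam]; exact hZ
  · exact RPM.average_twoPoint_ge hL hL2 hlam hN hsymm hsep hc hZ fun j =>
      (RPM.expectedLinks_perm hL1 hlam hN hperm j).le
  · exact RPM.average_twoPoint_ge hL hL2 hlam hN hsymm hsep hc hZ fun j =>
      le_ciSup (Set.finite_range _).bddAbove j
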